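/- Let $0<\alpha<1$ and $0<\gamma\le\alpha$, and let $(T_n)_{n\ge1}$ be alpha-gamma trees: $T_n$ is a random rooted tree without vertices of degree $2$, with a root of degree $1$ and $n$ leaves labelled $1,\dots,n$; $T_1$ and $T_2$ are the unique such trees with one and two leaves; and, for $n\ge2$, given $T_1,\dots,T_n$, assign weight $1-\alpha$ to each edge of $T_n$ adjacent to a leaf, weight $\gamma$ to each other edge, and weight $(c-1)\alpha-\gamma$ to each vertex of degree $c+1\ge3$ (branch point), select an edge or branch point with probability proportional to its weight, and attach the new leaf $n+1$ by a new edge to a new vertex placed on the selected edge, or to the selected branch point, to obtain $T_{n+1}$. Fix $k\ge2$. Let $v_1,\dots,v_\ell$ be the branch points of $T_k$, enumerated in any way determined by $T_k$ (e.g. by depth first search), let $c_1+1,\dots,c_\ell+1$ be their degrees in $T_k$, and put $\overline w=(k-1)\alpha-\ell\gamma$. For $n\ge k$ regard $v_1,\dots,v_\ell$ as vertices of $T_n$, and let $W_{n,k}$ be the number of those leaves $k+1,\dots,n$ of $T_n$ that lie in subtrees attached to the subtree of $T_n$ spanned by the root and the leaves $1,\dots,k$ elsewhere than at $v_1,\dots,v_\ell$.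 Then there are random variables $W_k$, $M_k$ and $D_k'=(D_{k,1}',\dots,D_{k,\ell}')$ such that $W_{n,k}/n\to W_k$ a.s. and $$\frac{\deg_{T_n}(v_i)}{n^{\alpha}}\longrightarrow C_{k,i}=(1-W_k)^{\alpha}\,M_k\,D_{k,i}'\quad\text{a.s. as }n\to\infty,\qquad i=1,\dots,\ell .$$ If $\gamma<\alpha$, these can be chosen so that, conditionally given $T_k$, the variables $W_k$, $M_k$, $D_k'$ are independent, and - $W_k\sim\mathrm{beta}(k(1-\alpha)+\ell\gamma,\ \overline w)$; - $M_k$ has density $\dfrac{\Gamma(\overline w+1)}{\Gamma(\overline w/\alpha+1)}\,s^{\overline w/\alpha}g_\alpha(s)$, $s\in(0,\infty)$, where $g_\alpha$ is the Mittag-Leffler density, that is, the density of $\sigma_1^{-\alpha}$ for a subordinator $\sigma$ with $\mathbb E(e^{-\lambda\sigma_1})=e^{-\lambda^\alpha}$, $\lambda\ge0$; - $D_k'\sim\mathrm{Dirichlet}(c_1-1-\gamma/\alpha,\dots,c_\ell-1-\gamma/\alpha)$. If $\gamma=\alpha$ (so that $T_k$ is binary, $\overline w=0$, and all these Dirichlet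 parameters are $0$), then $W_k=1$ a.s., so that $C_k=0$. -/

import Mathlib

open MeasureTheory ProbabilityTheory Filter Topology

namespace AlphaGamma

/-! ### Labelled trees

A rooted tree with leaves labelled by `[n] = {1, …, n}` and without vertices of degree two is
encoded by the family of the label sets of its vertices other than the root: a vertex is the set
of the leaf labels at or above it, the leaf `i` is the singleton `{i}`, the vertex adjacent to the
root is `[n]` itself, and the parent-child relation is covering for inclusion.  The root is an
additional vertex of degree one, joined to `[n]`.  Each vertex `A` other than the root stands also
for the edge that leads to `A` from its parent (or from the root). -/

/-- Families of finite sets of labels, used to encode labelled trees. -/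
abbrev LTree := Finset (Finset ℕ)

/-- The children of the vertex `A` in `t`: the maximal vertices strictly included in `A`. -/
def children (t : LTree) (A : Finset ℕ) : Finset (Finset ℕ) :=
  t.filter fun C => C ⊂ A ∧ ∀ D ∈ t, C ⊆ D → D ⊆ A → D = C ∨ D = A

/-- The degree of a vertex other than the root: its children, and the edge to its parent. -/
def degree (t : LTree) (A : Finset ℕ) : ℕ := (children t A).card + 1

/-- The branch points: the vertices that are neither the root nor a leaf. -/
def branchPoints (t : LTree) : Finset (Finset ℕ) := t.filter fun A => 2 ≤ A.card

/-- The unique tree with one leaf. -/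
def tree1 : LTree := {{1}}

/-- The unique tree with two leaves. -/
def tree2 : LTree := {{1}, {2}, {1, 2}}

/-! ### The growth rules -/

/-- Insertion of the leaf `j` on the edge from the parent of `A` to `A`.  The new branch point is
`A ∪ {j}`, with children `A` and `{j}`; the label `j` is added to the strict ancestors of `A`. -/
def growEdge (j : ℕ) (t : LTree) (A : Finset ℕ) : LTree :=
  (t.filter fun C => ¬ A ⊂ C) ∪ ((t.filter fun C => A ⊆ C).image fun C => insert j C) ∪ {{j}}

/-- Insertion of the leaf `j` at the branch point `A`.  The leaf `{j}` becomes a child of this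
vertex, and the label `j` is added to it and to its ancestors. -/
def growVertex (j : ℕ) (t : LTree) (A : Finset ℕ) : LTree :=
  (t.filter fun C => ¬ A ⊆ C) ∪ ((t.filter fun C => A ⊆ C).image fun C => insert j C) ∪ {{j}}

/-- The weight of the edge that leads to `A`: `1 - α` if `A` is a leaf, `γ` otherwise. -/
noncomputable def edgeWeight (α γ : ℝ) (A : Finset ℕ) : ℝ :=
  if A.card = 1 then 1 - α else γ

/-- The weight `(c - 1) α - γ` of a branch point of degree `c + 1`. -/
noncomputable def vertexWeight (α γ : ℝ) (t : LTree) (A : Finset ℕ) : ℝ :=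
  (((children t A).card : ℝ) - 1) * α - γ

/-- The total weight of the edges and branch points of `t`. -/
noncomputable def totalWeight (α γ : ℝ) (t : LTree) : ℝ :=
  ∑ A ∈ t, edgeWeight α γ A + ∑ A ∈ branchPoints t, vertexWeight α γ t A

/-- The probability that the insertion of the leaf `j` turns `t` into `t'`, when an edge or a
branch point of `t` is selected with probability proportional to its weight. -/
noncomputable def growProb (α γ : ℝ) (j : ℕ) (t t' : LTree) : ℝ :=
  (∑ A ∈ t, (if growEdge j t A = t' then edgeWeight α γ A else 0) +
    ∑ A ∈ branchPoints t, (if growVertex j t A = t' then vertexWeight α γ t A else 0)) /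
  totalWeight α γ t

/-- `(T n, n ≥ 1)` is a sequence of random trees grown by the alpha-gamma rules: `T 1` and `T 2`
are the unique trees with one and two leaves and, for `n ≥ 2`, given `T 1, …, T n` the tree
`T (n + 1)` is obtained by the insertion of the leaf `n + 1` at an edge or a branch point of `T n`
selected with probability proportional to the weights.  (`T 0` plays no role.) -/
structure IsAlphaGammaSequence {Ω : Type*} [MeasurableSpace Ω] (μ : Measure Ω) (α γ : ℝ)
    (T : ℕ → Ω → LTree) : Prop where
  measurableSet_eq : ∀ n, 1 ≤ n → ∀ t : LTree, MeasurableSet {ω | T n ω = t}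
  init : ∀ᵐ ω ∂μ, T 1 ω = tree1 ∧ T 2 ω = tree2
  step : ∀ n, 2 ≤ n → ∀ t : ℕ → LTree,
    μ.real {ω | ∀ i ∈ Finset.Icc 1 (n + 1), T i ω = t i} =
      μ.real {ω | ∀ i ∈ Finset.Icc 1 n, T i ω = t i} * growProb α γ (n + 1) (t n) (t (n + 1))

/-! ### Vertices and subtrees of `T n` seen from `T k`, for `k ≤ n` -/

/-- The vertex of `t` that corresponds to the branch point `B` of a smaller tree: the smallest
vertex of `t` whose label set includes `B`. -/
def vertexOver (t : LTree) (B : Finset ℕ) : Finset ℕ :=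
  (t.sup id).filter fun i => ∀ A ∈ t, B ⊆ A → i ∈ A

/-- The vertex at which the leaf `j` of `t` is attached (through a subtree) to the subtree spanned
by the root and the leaves `1, …, k`: the smallest vertex of `t` above which there are both `j` and
one of the leaves `1, …, k`. -/
def attachVertex (k : ℕ) (t : LTree) (j : ℕ) : Finset ℕ :=
  (t.sup id).filter fun i => ∀ A ∈ t, j ∈ A → (A ∩ Finset.Icc 1 k).Nonempty → i ∈ A

/-- The number `W_{n,k}` of those leaves `k + 1, …, n` of the tree `t` (with leaves `1, …, n`)
that are attached to the subtree spanned by the root and the leaves `1, …, k` elsewhere than at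
the branch points of `s`, that is, in the interior of its edges; here `s` is the tree with leaves
`1, …, k` from which `t` has been grown. -/
def edgeLeafCount (k n : ℕ) (s t : LTree) : ℕ :=
  ((Finset.Ioc k n).filter fun j =>
    ∀ B ∈ branchPoints s, attachVertex k t j ≠ vertexOver t B).card

/-! ### Distributions -/

/-- `ν` is the law of `σ₁` for a subordinator `σ` with Laplace exponent `lam ↦ lam ^ α`. -/
structure IsStableLaw (α : ℝ) (ν : Measure ℝ) : Prop where
  isProbabilityMeasure : IsProbabilityMeasure ν
  pos : ∀ᵐ x ∂ν, 0 < x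
  laplace : ∀ lam : ℝ, 0 ≤ lam → ∫ x, Real.exp (-(lam * x)) ∂ν = Real.exp (-(lam ^ α))

/-- `g` is (a version of) the Mittag-Leffler density on `(0, ∞)`: the density of `σ₁ ^ (-α)` for
a subordinator `σ` with Laplace exponent `lam ↦ lam ^ α`. -/
def IsMittagLefflerDensity (α : ℝ) (g : ℝ → ℝ) : Prop :=
  Measurable g ∧ (∀ s, 0 ≤ g s) ∧
    ∃ ν : Measure ℝ, IsStableLaw α ν ∧
      ν.map (fun x => x ^ (-α)) =
        (volume.restrict (Set.Ioi 0)).withDensity fun s => ENNReal.ofReal (g s)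

/-- The measure on `(0, ∞)` with density
`s ↦ Γ(θ + 1) / Γ(θ / α + 1) * s ^ (θ / α) * g s`. -/
noncomputable def tiltedMeasure (α θ : ℝ) (g : ℝ → ℝ) : Measure ℝ :=
  (volume.restrict (Set.Ioi 0)).withDensity fun s =>
    ENNReal.ofReal (Real.Gamma (θ + 1) / Real.Gamma (θ / α + 1) * s ^ (θ / α) * g s)

open scoped Classical in
/-- The density of the first `m` marginals of the Dirichlet distribution with `m + 1`
parameters. -/
noncomputable def dirichletPDF {m : ℕ} (a : Fin (m + 1) → ℝ) (x : Fin m → ℝ) : ℝ :=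
  if (∀ i, 0 < x i) ∧ ∑ i, x i < 1 then
    Real.Gamma (∑ i, a i) / (∏ i, Real.Gamma (a i)) *
      (∏ i, x i ^ (a i.castSucc - 1)) * (1 - ∑ i, x i) ^ (a (Fin.last m) - 1)
  else 0

/-- The Dirichlet distribution with parameters `a 0, …, a m > 0`. -/
noncomputable def dirichletMeasure {m : ℕ} (a : Fin (m + 1) → ℝ) : Measure (Fin (m + 1) → ℝ) :=
  (volume.withDensity fun x : Fin m → ℝ => ENNReal.ofReal (dirichletPDF a x)).map
    fun x => Fin.snoc (α := fun _ => ℝ) x (1 - ∑ i, x i)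

end AlphaGamma

open MeasureTheory ProbabilityTheory Filter Topology


namespace AlphaGamma

/-! ### Asymptotics of ratios of Gamma functions -/

/-! Condition on `T k = s`. Seen from `s`, the growing tree is an urn. A subtree with `j` leaves,
together with the edge below it, has weight `j - α` whatever its shape
(`IsTree.sum_posWeight_subtree`), so the total weight of `T n` is always `n - α`. The new leaf lands
on the part over the edges of `s` with weight `spineWeight`, which then increases by one; it is
attached to the vertex over a branch point `B` of `s` with weight `α * overWeight`, and then
`overWeight` increases by one; any other move changes none of these quantities.

Rising factorials are eigenfunctions of such dynamics, because `x * (rising (x + 1) r - rising x r)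
= r * rising x r`. Hence the product of rising factorials `profile`, with exponents `p` and `r B`,
is multiplied in the mean by `(n - α + x) / (n - α)` where `x = p + α * ∑ r B`
(`sum_moveWeight_mul_profile`). Divided by a quotient of Gamma functions of order `n ^ x`, it is a
nonnegative martingale, hence converges almost surely. The case `p = 1`, `r = 0` gives the limit `W`
of the leaf counts, and `p = 0` with a single exponent one gives the limits `C` of the degrees.

The square of a profile is at most the profile with doubled exponents, so the normalised profiles
are bounded in `L²` and their constant means pass to the limit: this yields all joint moments of `W`
and `C` on `{T k = s}` (`integral_limit`). If `γ < α`, they are the moments of `(W, (1 - W) ^ α * M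
* D)` for independent beta, tilted Mittag-Leffler and Dirichlet variables (`lintegral_productLaw`).
They grow at most like factorials times powers, so they determine the law, by analyticity of the
moment generating function (`measure_ext_of_joint_moments`). As the entries of `D` sum to one, `M`
and `D` are recovered from `W` and `C`. If `γ = α`, first moments suffice: `W ≤ 1` has conditional
mean one and `C ≥ 0` has conditional mean zero.

The Mittag-Leffler density is itself constructed from moments: an infinite product of independent
beta variables gives a law with moments `r! / Γ(1 + α r)`, and moment determinacy identifies the
Laplace transform of its power `-1 / α` with that of the stable law. -/

lemma Gamma_add_nat_add_one {x : ℝ} (hx : 0 < x) (n : ℕ) :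
    Real.Gamma (x + n + 1) = (∏ j ∈ Finset.range (n + 1), (x + j)) * Real.Gamma x := by
  induction n with
  | zero => simp [Real.Gamma_add_one hx.ne']
  | succ n ih =>
    have h : x + (n + 1 : ℕ) ≠ 0 := by positivity
    rw [Real.Gamma_add_one h, Finset.prod_range_succ, mul_right_comm, ← ih]
    push_cast
    rw [← add_assoc]
    ring

/-- This is Gauss's product formula for Gamma at `x` and at `x + δ`: in the quotient of the two
sequences the factorials cancel and `n ^ δ` remains. -/
lemma tendsto_Gamma_ratio_aux {x δ : ℝ} (hx : 0 < x) (hδ : 0 ≤ δ) :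
    Tendsto (fun n : ℕ => Real.Gamma (x + n + 1 + δ) / (Real.Gamma (x + n + 1) * (n : ℝ) ^ δ))
      atTop (𝓝 1) := by
  have hxδ : 0 < x + δ := by positivity
  have h1 := (Real.GammaSeq_tendsto_Gamma x).div (Real.GammaSeq_tendsto_Gamma (x + δ))
    (Real.Gamma_pos_of_pos hxδ).ne'
  have h2 := h1.const_mul (Real.Gamma (x + δ) / Real.Gamma x)
  have hG := (Real.Gamma_pos_of_pos hx).ne'
  have hG' := (Real.Gamma_pos_of_pos hxδ).ne'
  rw [show Real.Gamma (x + δ) / Real.Gamma x * (Real.Gamma x / Real.Gamma (x + δ)) = 1 by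
    field_simp] at h2
  refine h2.congr' ?_
  filter_upwards [eventually_gt_atTop 0] with n hn
  have hn' : (0 : ℝ) < n := by exact_mod_cast hn
  have e1 := Gamma_add_nat_add_one hx n
  have e2 := Gamma_add_nat_add_one hxδ n
  rw [show x + n + 1 + δ = x + δ + n + 1 by ring, e1, e2]
  have p1 : (∏ j ∈ Finset.range (n + 1), (x + j)) ≠ 0 :=
    Finset.prod_ne_zero_iff.2 fun j _ => by positivity
  have p2 : (∏ j ∈ Finset.range (n + 1), (x + δ + j)) ≠ 0 :=
    Finset.prod_ne_zero_iff.2 fun j _ => by positivity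
  have p3 : (n : ℝ) ^ δ ≠ 0 := by positivity
  have p4 : (n : ℝ) ^ x ≠ 0 := by positivity
  have p5 : ((n.factorial : ℕ) : ℝ) ≠ 0 := by positivity
  simp only [Pi.div_apply, Real.GammaSeq, Real.rpow_add hn']
  field_simp

/-- `Γ(n + c + δ) / Γ(n + c)` is asymptotic to `n ^ δ`. -/
lemma tendsto_Gamma_ratio {c δ : ℝ} (hc : -1 < c) (hδ : 0 ≤ δ) :
    Tendsto (fun n : ℕ => Real.Gamma (n + c + δ) / (Real.Gamma (n + c) * (n : ℝ) ^ δ))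
      atTop (𝓝 1) := by
  -- The shift by two writes `n + 2 + c` as `(c + 1) + n + 1` with `c + 1 > 0`, the form needed for
  -- Gauss's formula.
  rw [← tendsto_add_atTop_iff_nat 2]
  have h1 := tendsto_Gamma_ratio_aux (x := c + 1) (by linarith) hδ
  have h3 : Tendsto (fun n : ℕ => ((n : ℝ) / ((n : ℝ) + 2)) ^ δ) atTop (𝓝 1) := by
    have h := (tendsto_natCast_div_add_atTop (2 : ℝ)).rpow_const (p := δ) (Or.inl one_ne_zero)
    simpa using h
  have h4 := h1.mul h3
  rw [one_mul] at h4
  refine h4.congr' ?_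
  filter_upwards [eventually_gt_atTop 0] with n hn
  have hn' : (0 : ℝ) < n := by exact_mod_cast hn
  rw [Real.div_rpow hn'.le (by positivity)]
  push_cast
  rw [show (n : ℝ) + 2 + c + δ = c + 1 + n + 1 + δ by ring,
    show (n : ℝ) + 2 + c = c + 1 + n + 1 by ring]
  have p3 : (n : ℝ) ^ δ ≠ 0 := by positivity
  have p4 : ((n : ℝ) + 2) ^ δ ≠ 0 := by positivity
  have p5 : Real.Gamma (c + 1 + n + 1) ≠ 0 := (Real.Gamma_pos_of_pos (by linarith)).ne'
  field_simp

/-- Gamma is monotone on `[2, ∞)` with value one at two; on `[1, 2]` use `Γ(x) = Γ(x + 1) / x`. The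
bound keeps reciprocals of Gamma under control in the moment estimates. -/
lemma half_le_Gamma {x : ℝ} (hx : 1 ≤ x) : 1 / 2 ≤ Real.Gamma x := by
  have h2 : ∀ y : ℝ, 2 ≤ y → 1 ≤ Real.Gamma y := fun y hy => by
    have := Real.Gamma_strictMonoOn_Ici.monotoneOn (Set.mem_Ici.2 le_rfl) (Set.mem_Ici.2 hy) hy
    rwa [Real.Gamma_two] at this
  rcases le_total 2 x with h | h
  · linarith [h2 x h]
  · have h3 := h2 (x + 1) (by linarith)
    rw [Real.Gamma_add_one (by linarith)] at h3
    nlinarith [Real.Gamma_pos_of_pos (show 0 < x by linarith)]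

/-! ### Rising factorials -/

/-- The rising factorial `x (x + 1) ⋯ (x + r - 1)`. -/
noncomputable def rising (x : ℝ) (r : ℕ) : ℝ := ∏ j ∈ Finset.range r, (x + j)

@[simp] lemma rising_zero (x : ℝ) : rising x 0 = 1 := by simp [rising]

@[simp] lemma rising_one (x : ℝ) : rising x 1 = x := by simp [rising]

lemma rising_succ (x : ℝ) (r : ℕ) : rising x (r + 1) = rising x r * (x + r) :=
  Finset.prod_range_succ _ _

/-- Both sides are the rising factorial of length `r + 1`. Equivalently, `rising · r` is an
eigenfunction, with eigenvalue `r`, of `f ↦ x * (f (x + 1) - f x)`; this is the source of all the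
martingales below. -/
lemma mul_rising_add_one (x : ℝ) (r : ℕ) : x * rising (x + 1) r = (x + r) * rising x r := by
  have h : rising x (r + 1) = x * rising (x + 1) r := by
    rw [rising, Finset.prod_range_succ', rising, mul_comm]
    simp only [Nat.cast_zero, add_zero]
    congr 1
    refine Finset.prod_congr rfl fun j _ => ?_
    push_cast; ring
  rw [← h, rising_succ, mul_comm]

lemma rising_nonneg {x : ℝ} (hx : 0 ≤ x) (r : ℕ) : 0 ≤ rising x r :=
  Finset.prod_nonneg fun j _ => by positivity

/-- The last `r` factors of the longer product dominate the first `r`. This turns second moments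
into first moments with doubled exponents. -/
lemma rising_sq_le {x : ℝ} (hx : 0 ≤ x) (r : ℕ) : rising x r ^ 2 ≤ rising x (2 * r) := by
  rw [two_mul, rising, rising, Finset.prod_range_add, sq]
  refine mul_le_mul_of_nonneg_left ?_ (rising_nonneg hx r)
  refine Finset.prod_le_prod (fun j _ => by positivity) fun j _ => ?_
  push_cast
  linarith [(Nat.cast_nonneg r : (0 : ℝ) ≤ r)]

/-- Factor by factor, `x + j ≤ (1 + x) * (j + 1)`. -/
lemma rising_le {x : ℝ} (hx : 0 ≤ x) (r : ℕ) : rising x r ≤ (1 + x) ^ r * r.factorial := by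
  induction r with
  | zero => simp
  | succ r ih =>
    rw [rising_succ, Nat.factorial_succ, pow_succ]
    push_cast
    calc rising x r * (x + r) ≤ ((1 + x) ^ r * r.factorial) * ((1 + x) * (r + 1)) := by
          refine mul_le_mul ih ?_ (by positivity) (by positivity)
          nlinarith [(Nat.cast_nonneg r : (0 : ℝ) ≤ r)]
      _ = _ := by ring

lemma Gamma_add_nat {x : ℝ} (hx : 0 < x) (r : ℕ) :
    Real.Gamma (x + r) = rising x r * Real.Gamma x := by
  cases r with
  | zero => simp
  | succ r =>
    push_cast
    rw [← add_assoc, Gamma_add_nat_add_one hx, rising]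

lemma tendsto_rising_div_pow {u v : ℕ → ℝ} {c : ℝ} (hv : Tendsto v atTop atTop)
    (h : Tendsto (fun n => u n / v n) atTop (𝓝 c)) (r : ℕ) :
    Tendsto (fun n => rising (u n) r / v n ^ r) atTop (𝓝 (c ^ r)) := by
  have h1 : ∀ j : ℕ, Tendsto (fun n => (u n + j) / v n) atTop (𝓝 c) := fun j => by
    have := h.add (tendsto_const_nhds (x := (j : ℝ)).div_atTop hv)
    simpa [add_div] using this
  have h2 := tendsto_finsetProd (Finset.range r) fun j _ => h1 j
  simp only [Finset.prod_div_distrib, Finset.prod_const, Finset.card_range] at h2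
  exact h2

/-! ### Determination of measures by their moments -/

/-- The exponential series is integrated term by term; the factorials cancel and a geometric series
of ratio `t * R` remains. -/
lemma integrable_exp_mul_abs_of_moments (μ : Measure ℝ) {C R t : ℝ} (hC : 0 ≤ C) (hR : 0 < R)
    (ht : 0 ≤ t) (htR : t * R < 1)
    (h : ∀ n : ℕ, ∫⁻ x, ENNReal.ofReal (|x| ^ n) ∂μ ≤ ENNReal.ofReal (C * R ^ n * n.factorial)) :
    Integrable (fun x => Real.exp (t * |x|)) μ := by
  refine ⟨by fun_prop, ?_⟩
  rw [hasFiniteIntegral_iff_ofReal (ae_of_all _ fun x => (Real.exp_pos _).le)]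
  have e : ∀ x : ℝ, ENNReal.ofReal (Real.exp (t * |x|)) =
      ∑' n : ℕ, ENNReal.ofReal (t ^ n / n.factorial) * ENNReal.ofReal (|x| ^ n) := fun x => by
    have hs := Real.summable_pow_div_factorial (t * |x|)
    rw [Real.exp_eq_exp_ℝ, NormedSpace.exp_eq_tsum_div, ENNReal.ofReal_tsum_of_nonneg
      (fun n => by positivity) hs]
    congr 1; ext n
    rw [← ENNReal.ofReal_mul (by positivity), mul_pow]
    congr 1; ring
  simp_rw [e]
  rw [lintegral_tsum (fun n => by fun_prop)]
  calc ∑' n : ℕ, ∫⁻ x, ENNReal.ofReal (t ^ n / n.factorial) * ENNReal.ofReal (|x| ^ n) ∂μ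
      ≤ ∑' n : ℕ, ENNReal.ofReal (C * (t * R) ^ n) := by
        refine ENNReal.tsum_le_tsum fun n => ?_
        rw [lintegral_const_mul _ (by fun_prop)]
        refine (mul_le_mul_right (h n) _).trans ?_
        rw [← ENNReal.ofReal_mul (by positivity)]
        refine ENNReal.ofReal_le_ofReal (le_of_eq ?_)
        have : (n.factorial : ℝ) ≠ 0 := by positivity
        rw [mul_pow]; field_simp
    _ = ENNReal.ofReal (∑' n : ℕ, C * (t * R) ^ n) := by
        rw [ENNReal.ofReal_tsum_of_nonneg (fun n => by positivity)]
        exact (summable_geometric_of_lt_one (by positivity) htR).mul_left C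
    _ < ⊤ := ENNReal.ofReal_lt_top

/-- Two finite measures on the line with the same moments are equal, if their absolute moments do
not grow faster than those of an exponential distribution. -/
lemma measure_ext_of_moments (μ ν : Measure ℝ) [IsFiniteMeasure μ] [IsFiniteMeasure ν] {C R : ℝ}
    (hC : 0 ≤ C) (hR : 0 < R)
    (hμ : ∀ n : ℕ, ∫⁻ x, ENNReal.ofReal (|x| ^ n) ∂μ ≤ ENNReal.ofReal (C * R ^ n * n.factorial))
    (hν : ∀ n : ℕ, ∫⁻ x, ENNReal.ofReal (|x| ^ n) ∂ν ≤ ENNReal.ofReal (C * R ^ n * n.factorial))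
    (h : ∀ n : ℕ, ∫ x, x ^ n ∂μ = ∫ x, x ^ n ∂ν) : μ = ν := by
  set t : ℝ := 1 / (2 * R) with ht
  have htpos : 0 < t := by positivity
  have htR : t * R < 1 := by rw [ht]; field_simp; norm_num
  have key : ∀ ρ : Measure ℝ, (∀ n : ℕ, ∫⁻ x, ENNReal.ofReal (|x| ^ n) ∂ρ ≤
      ENNReal.ofReal (C * R ^ n * n.factorial)) →
      Set.Ioo (-t) t ⊆ interior (integrableExpSet (id : ℝ → ℝ) ρ) := fun ρ hρ => by
    refine interior_maximal ?_ isOpen_Ioo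
    intro u hu
    have hi := integrable_exp_mul_abs_of_moments ρ hC hR htpos.le htR hρ
    refine hi.mono' (by fun_prop) (ae_of_all _ fun x => ?_)
    rw [Real.norm_eq_abs, abs_of_pos (Real.exp_pos _), Real.exp_le_exp]
    calc u * id x ≤ |u * x| := le_abs_self _
      _ = |u| * |x| := abs_mul _ _
      _ ≤ t * |x| := mul_le_mul_of_nonneg_right (abs_lt.2 hu).le (abs_nonneg _)
  have h0 : (0 : ℝ) ∈ Set.Ioo (-t) t := ⟨by linarith, htpos⟩
  -- Both generating functions are analytic at the origin, and their Taylor coefficients there are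
  -- given by the moments.
  have hE : complexMGF (id : ℝ → ℝ) μ =ᶠ[𝓝 0] complexMGF (id : ℝ → ℝ) ν := by
    have a1 : AnalyticAt ℂ (complexMGF (id : ℝ → ℝ) μ) 0 := analyticAt_complexMGF (key μ hμ h0)
    have a2 : AnalyticAt ℂ (complexMGF (id : ℝ → ℝ) ν) 0 := analyticAt_complexMGF (key ν hν h0)
    have f1 := a1.hasFPowerSeriesAt
    have f2 := a2.hasFPowerSeriesAt
    have hc : ∀ n : ℕ, iteratedDeriv n (complexMGF (id : ℝ → ℝ) μ) 0 =
        iteratedDeriv n (complexMGF (id : ℝ → ℝ) ν) 0 := fun n => by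
      rw [iteratedDeriv_complexMGF (by simpa using key μ hμ h0),
        iteratedDeriv_complexMGF (by simpa using key ν hν h0)]
      simp only [id, zero_mul, Complex.exp_zero, mul_one]
      have := congrArg (fun y : ℝ => (y : ℂ)) (h n)
      rw [← integral_complex_ofReal, ← integral_complex_ofReal] at this
      simpa using this
    simp_rw [hc] at f1
    filter_upwards [f1.eventually_hasSum, f2.eventually_hasSum] with z h1 h2
    simpa using h1.unique h2
  -- The identity theorem extends the equality to the whole vertical strip, which contains the
  -- imaginary axis, where the generating functions are the characteristic functions.
  set S : Set ℂ := {z | z.re ∈ Set.Ioo (-t) t} with hS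
  have hSconn : IsPreconnected S :=
    ((convex_Ioo (-t) t).linear_preimage Complex.reCLM.toLinearMap).isPreconnected
  have heq : Set.EqOn (complexMGF (id : ℝ → ℝ) μ) (complexMGF (id : ℝ → ℝ) ν) S :=
    (analyticOnNhd_complexMGF.mono fun z hz => key μ hμ hz).eqOn_of_preconnected_of_eventuallyEq
      (analyticOnNhd_complexMGF.mono fun z hz => key ν hν hz) hSconn
      (show (0 : ℂ) ∈ S by simpa [hS] using htpos) hE
  refine Measure.ext_of_charFun (funext fun u => ?_)
  rw [← complexMGF_id_mul_I, ← complexMGF_id_mul_I]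
  exact heq (by simpa [hS] using htpos)

lemma sum_abs_pow_le {ι : Type*} [Fintype ι] [Nonempty ι] (x : ι → ℝ) (n : ℕ) :
    (∑ j, |x j|) ^ n ≤ (Fintype.card ι : ℝ) ^ n * ∑ j, |x j| ^ n := by
  obtain ⟨j, hj⟩ := Finite.exists_max fun j => |x j|
  have h1 : ∑ i, |x i| ≤ Fintype.card ι * |x j| := by
    simpa using Finset.sum_le_card_nsmul Finset.univ (fun i => |x i|) _ fun i _ => hj i
  calc (∑ j, |x j|) ^ n ≤ (Fintype.card ι * |x j|) ^ n :=
        pow_le_pow_left₀ (Finset.sum_nonneg fun i _ => abs_nonneg _) h1 n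
    _ = (Fintype.card ι : ℝ) ^ n * |x j| ^ n := mul_pow _ _ _
    _ ≤ _ := by
        gcongr
        exact Finset.single_le_sum (f := fun j => |x j| ^ n) (fun i _ => by positivity)
          (Finset.mem_univ j)

/-! ### Moment determinacy in several variables -/

section MultivariateMoments

variable {E ι : Type*} [NormedAddCommGroup E] [NormedSpace ℝ E] [MeasurableSpace E] [BorelSpace E]
  [Fintype ι] {f : ι → E →L[ℝ] ℝ} {C R : ℝ}

lemma lintegral_sum_abs_pow_le (ρ : Measure E)
    (hρ : ∀ j (n : ℕ), ∫⁻ x, ENNReal.ofReal (|f j x| ^ n) ∂ρ ≤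
      ENNReal.ofReal (C * R ^ n * n.factorial)) (n : ℕ) :
    ∫⁻ x, ENNReal.ofReal (∑ j, |f j x| ^ n) ∂ρ ≤
      Fintype.card ι * ENNReal.ofReal (C * R ^ n * n.factorial) := by
  simp_rw [ENNReal.ofReal_sum_of_nonneg (fun j _ => pow_nonneg (abs_nonneg (f j _)) n)]
  rw [lintegral_finsetSum _ (fun j _ => by fun_prop)]
  simpa using Finset.sum_le_card_nsmul Finset.univ _ _ fun j _ => hρ j n

lemma integrable_monomial [Nonempty ι] (ρ : Measure E)
    (hρ : ∀ j (n : ℕ), ∫⁻ x, ENNReal.ofReal (|f j x| ^ n) ∂ρ ≤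
      ENNReal.ofReal (C * R ^ n * n.factorial)) (r : ι → ℕ) :
    Integrable (fun x => ∏ j, f j x ^ r j) ρ := by
  have hi : Integrable (fun x => (Fintype.card ι : ℝ) ^ (∑ j, r j) *
      ∑ j, |f j x| ^ (∑ j, r j)) ρ := by
    refine Integrable.const_mul ⟨by fun_prop, ?_⟩ _
    rw [hasFiniteIntegral_iff_ofReal (ae_of_all _ fun x => by positivity)]
    refine (lintegral_sum_abs_pow_le ρ hρ _).trans_lt ?_
    exact ENNReal.mul_lt_top (ENNReal.natCast_lt_top _) ENNReal.ofReal_lt_top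
  refine hi.mono' (by fun_prop) (ae_of_all _ fun x => ?_)
  rw [Real.norm_eq_abs, Finset.abs_prod]
  refine le_trans ?_ (sum_abs_pow_le (fun j => f j x) _)
  rw [← Finset.prod_pow_eq_pow_sum]
  refine Finset.prod_le_prod (fun j _ => abs_nonneg _) fun j _ => ?_
  rw [abs_pow]
  exact pow_le_pow_left₀ (abs_nonneg _)
    (Finset.single_le_sum (f := fun j => |f j x|) (fun i _ => abs_nonneg _) (Finset.mem_univ j)) _

/-- Two finite measures on a Banach space whose dual is spanned by finitely many functionals are
equal if all joint moments of these functionals coincide, and if the absolute moments do not grow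
faster than those of an exponential distribution. -/
lemma measure_ext_of_joint_moments [Nonempty ι] [CompleteSpace E] [SecondCountableTopology E]
    (μ ν : Measure E) [IsFiniteMeasure μ] [IsFiniteMeasure ν]
    (hf : ∀ L : E →L[ℝ] ℝ, ∃ p : ι → ℝ, ∀ x, L x = ∑ j, p j * f j x) (hC : 0 ≤ C) (hR : 0 < R)
    (hμ : ∀ j (n : ℕ), ∫⁻ x, ENNReal.ofReal (|f j x| ^ n) ∂μ ≤
      ENNReal.ofReal (C * R ^ n * n.factorial))
    (hν : ∀ j (n : ℕ), ∫⁻ x, ENNReal.ofReal (|f j x| ^ n) ∂ν ≤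
      ENNReal.ofReal (C * R ^ n * n.factorial))
    (h : ∀ r : ι → ℕ, ∫ x, ∏ j, f j x ^ r j ∂μ = ∫ x, ∏ j, f j x ^ r j ∂ν) : μ = ν := by
  classical
  refine Measure.ext_of_charFunDual (funext fun L => ?_)
  -- Cramér-Wold: it suffices to compare the images under each functional `L`, which are measures on
  -- the line.
  rw [charFunDual_eq_charFun_map_one, charFunDual_eq_charFun_map_one]
  congr 1
  obtain ⟨p, hp⟩ := hf L
  -- The summand one keeps the growth constant positive even for `L = 0`.
  set P : ℝ := 1 + ∑ j, |p j| with hP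
  have hP0 : 0 ≤ ∑ j, |p j| := Finset.sum_nonneg fun j _ => abs_nonneg _
  have hPpos : 0 < P := by linarith
  have hd : (0 : ℝ) < Fintype.card ι := by exact_mod_cast Fintype.card_pos
  have hpow : ∀ x n, |L x| ^ n ≤ (P * Fintype.card ι) ^ n * ∑ j, |f j x| ^ n := fun x n => by
    have h1 : |L x| ≤ P * ∑ j, |f j x| := by
      rw [hp, Finset.mul_sum]
      refine (Finset.abs_sum_le_sum_abs _ _).trans (Finset.sum_le_sum fun j _ => ?_)
      rw [abs_mul]
      refine mul_le_mul_of_nonneg_right ?_ (abs_nonneg _)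
      have := Finset.single_le_sum (f := fun j => |p j|) (fun i _ => abs_nonneg _)
        (Finset.mem_univ j)
      linarith
    calc |L x| ^ n ≤ (P * ∑ j, |f j x|) ^ n := pow_le_pow_left₀ (abs_nonneg _) h1 n
      _ = P ^ n * (∑ j, |f j x|) ^ n := mul_pow _ _ _
      _ ≤ P ^ n * ((Fintype.card ι : ℝ) ^ n * ∑ j, |f j x| ^ n) := by
          gcongr; exact sum_abs_pow_le _ _
      _ = _ := by rw [mul_pow, mul_assoc]
  have hbound : ∀ ρ : Measure E, (∀ j (n : ℕ), ∫⁻ x, ENNReal.ofReal (|f j x| ^ n) ∂ρ ≤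
      ENNReal.ofReal (C * R ^ n * n.factorial)) → ∀ n : ℕ,
      ∫⁻ y, ENNReal.ofReal (|y| ^ n) ∂(ρ.map L) ≤ ENNReal.ofReal
        ((Fintype.card ι * C) * (P * Fintype.card ι * R) ^ n * n.factorial) := fun ρ hρ n => by
    rw [lintegral_map (by fun_prop) (by fun_prop)]
    calc ∫⁻ x, ENNReal.ofReal (|L x| ^ n) ∂ρ
        ≤ ∫⁻ x, ENNReal.ofReal ((P * Fintype.card ι) ^ n) *
            ENNReal.ofReal (∑ j, |f j x| ^ n) ∂ρ := lintegral_mono fun x => by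
          rw [← ENNReal.ofReal_mul (by positivity)]
          exact ENNReal.ofReal_le_ofReal (hpow x n)
      _ ≤ ENNReal.ofReal ((P * Fintype.card ι) ^ n) *
            (Fintype.card ι * ENNReal.ofReal (C * R ^ n * n.factorial)) := by
          rw [lintegral_const_mul _ (by fun_prop)]
          gcongr
          exact lintegral_sum_abs_pow_le ρ hρ n
      _ = _ := by
          rw [← ENNReal.ofReal_natCast, ← ENNReal.ofReal_mul (by positivity),
            ← ENNReal.ofReal_mul (by positivity)]
          congr 1
          rw [mul_pow, mul_pow, mul_pow]
          ring
  refine measure_ext_of_moments _ _ (by positivity) (by positivity) (hbound μ hμ) (hbound ν hν)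
    fun n => ?_
  rw [integral_map (by fun_prop) (by fun_prop), integral_map (by fun_prop) (by fun_prop)]
  -- By the multinomial theorem the moments of `L` are linear combinations of the joint moments.
  have hexp : ∀ x, L x ^ n = ∑ r ∈ Finset.piAntidiag Finset.univ n,
      ((Nat.multinomial Finset.univ r : ℝ) * ∏ j, p j ^ r j) * ∏ j, f j x ^ r j := fun x => by
    rw [hp, Finset.sum_pow_eq_sum_piAntidiag]
    refine Finset.sum_congr rfl fun r _ => ?_
    simp_rw [mul_pow, Finset.prod_mul_distrib, mul_assoc]
  simp_rw [hexp]
  rw [integral_finsetSum _ fun r _ => (integrable_monomial μ hμ r).const_mul _,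
    integral_finsetSum _ fun r _ => (integrable_monomial ν hν r).const_mul _]
  refine Finset.sum_congr rfl fun r _ => ?_
  rw [integral_const_mul, integral_const_mul, h]

end MultivariateMoments

/-! ### Convergence of moments -/

/-- A sequence which is bounded in `L²` and converges almost surely has convergent means. -/
lemma tendsto_integral_of_sq_bounded {Ω : Type*} [MeasurableSpace Ω] (μ : Measure Ω)
    [IsFiniteMeasure μ] {X : ℕ → Ω → ℝ} {Y : Ω → ℝ} (hX : ∀ n, Measurable (X n)) {C : ℝ}
    (hC : ∀ n, ∫⁻ ω, ENNReal.ofReal (X n ω ^ 2) ∂μ ≤ ENNReal.ofReal C)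
    (hXY : ∀ᵐ ω ∂μ, Tendsto (fun n => X n ω) atTop (𝓝 (Y ω))) :
    Integrable Y μ ∧ Tendsto (fun n => ∫ ω, X n ω ∂μ) atTop (𝓝 (∫ ω, Y ω ∂μ)) := by
  have hYm : AEMeasurable Y μ := aemeasurable_of_tendsto_metrizable_ae atTop
    (fun n => (hX n).aemeasurable) hXY
  -- Fatou's lemma carries the `L²` bound over to the limit.
  have hfatou : ∫⁻ ω, ENNReal.ofReal (Y ω ^ 2) ∂μ ≤ ENNReal.ofReal C := by
    calc ∫⁻ ω, ENNReal.ofReal (Y ω ^ 2) ∂μ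
        = ∫⁻ ω, liminf (fun n => ENNReal.ofReal (X n ω ^ 2)) atTop ∂μ := by
          refine lintegral_congr_ae ?_
          filter_upwards [hXY] with ω hω
          exact ((ENNReal.tendsto_ofReal (hω.pow 2)).liminf_eq).symm
      _ ≤ liminf (fun n => ∫⁻ ω, ENNReal.ofReal (X n ω ^ 2) ∂μ) atTop :=
          lintegral_liminf_le fun n => by fun_prop
      _ ≤ ENNReal.ofReal C := by
          refine liminf_le_of_le (by isBoundedDefault) fun b hb => ?_
          obtain ⟨n, hn⟩ := hb.exists
          exact hn.trans (hC n)
  have hY : Integrable Y μ := by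
    have h1 : Integrable (fun ω => 1 + Y ω ^ 2) μ := by
      refine (integrable_const _).add ⟨by fun_prop, ?_⟩
      rw [hasFiniteIntegral_iff_ofReal (ae_of_all _ fun ω => sq_nonneg _)]
      exact hfatou.trans_lt ENNReal.ofReal_lt_top
    refine h1.mono' hYm.aestronglyMeasurable (ae_of_all _ fun ω => ?_)
    rw [Real.norm_eq_abs]
    nlinarith [sq_nonneg (|Y ω| - 1), sq_abs (Y ω)]
  have hint : ∀ n, Integrable (X n) μ := fun n => by
    have h1 : Integrable (fun ω => 1 + X n ω ^ 2) μ := by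
      refine (integrable_const _).add ⟨by fun_prop, ?_⟩
      rw [hasFiniteIntegral_iff_ofReal (ae_of_all _ fun ω => sq_nonneg _)]
      exact (hC n).trans_lt ENNReal.ofReal_lt_top
    refine h1.mono' (hX n).aestronglyMeasurable (ae_of_all _ fun ω => ?_)
    rw [Real.norm_eq_abs]
    nlinarith [sq_nonneg (|X n ω| - 1), sq_abs (X n ω)]
  refine ⟨hY, ?_⟩
  have hui : UnifIntegrable X 1 μ := by
    refine unifIntegrable_of le_rfl ENNReal.one_ne_top
      (fun n => (hX n).aestronglyMeasurable) fun ε hε => ?_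
    -- Beyond the threshold `c = (|C| + 1) / ε` one has `|X| ≤ X ^ 2 / c`, so the tail integral is
    -- at most `C / c ≤ ε`. The summand one makes `c` positive.
    have hcpos : 0 < (|C| + 1) / ε := by positivity
    refine ⟨⟨(|C| + 1) / ε, hcpos.le⟩, fun n => ?_⟩
    rw [eLpNorm_one_eq_lintegral_enorm]
    calc ∫⁻ ω, ‖({x | (⟨(|C| + 1) / ε, hcpos.le⟩ : NNReal) ≤ ‖X n x‖₊}.indicator (X n)) ω‖ₑ ∂μ
        ≤ ∫⁻ ω, ENNReal.ofReal (ε / (|C| + 1)) * ENNReal.ofReal (X n ω ^ 2) ∂μ := by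
          refine lintegral_mono fun ω => ?_
          by_cases hω : (⟨(|C| + 1) / ε, hcpos.le⟩ : NNReal) ≤ ‖X n ω‖₊
          · rw [Set.indicator_of_mem (by exact hω), ← ENNReal.ofReal_mul (by positivity),
              ← ofReal_norm]
            refine ENNReal.ofReal_le_ofReal ?_
            have h2 : (|C| + 1) / ε ≤ |X n ω| := by exact_mod_cast hω
            rw [Real.norm_eq_abs, ← sq_abs, div_mul_eq_mul_div, le_div_iff₀ (by positivity)]
            rw [div_le_iff₀ hε] at h2
            nlinarith [abs_nonneg (X n ω)]
          · rw [Set.indicator_of_notMem (by exact hω)]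
            simp
      _ ≤ ENNReal.ofReal (ε / (|C| + 1)) * ENNReal.ofReal C := by
          rw [lintegral_const_mul _ (by fun_prop)]
          exact mul_le_mul_right (hC n) _
      _ ≤ ENNReal.ofReal ε := by
          rw [← ENNReal.ofReal_mul (by positivity)]
          refine ENNReal.ofReal_le_ofReal ?_
          rw [div_mul_eq_mul_div, div_le_iff₀ (by positivity)]
          nlinarith [le_abs_self C]
  have hL := tendsto_Lp_finite_of_tendsto_ae le_rfl ENNReal.one_ne_top
    (fun n => (hX n).aestronglyMeasurable) (memLp_one_iff_integrable.2 hY) hui hXY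
  exact tendsto_integral_of_L1' Y hY.aestronglyMeasurable (Eventually.of_forall hint) hL

end AlphaGamma

namespace AlphaGamma

/-! ### Moments of the beta distribution -/

lemma ae_betaMeasure_mem_Ioo (a b : ℝ) : ∀ᵐ x ∂(betaMeasure a b), x ∈ Set.Ioo (0 : ℝ) 1 := by
  rw [betaMeasure, ae_withDensity_iff (by unfold betaPDF; fun_prop)]
  refine ae_of_all _ fun x hx => ?_
  by_contra hcon
  exact hx (by rw [betaPDF_eq, if_neg (by simpa using hcon)]; simp)

/-- The factor `x ^ p * (1 - x) ^ q` only shifts the two parameters of the beta density, so the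
integral is a quotient of normalising constants. -/
lemma lintegral_betaMeasure_rpow {a b p q : ℝ} (ha : 0 < a) (hb : 0 < b) (hp : 0 ≤ p)
    (hq : 0 ≤ q) :
    ∫⁻ x, ENNReal.ofReal (x ^ p * (1 - x) ^ q) ∂(betaMeasure a b) =
      ENNReal.ofReal (beta (a + p) (b + q) / beta a b) := by
  have h0 := beta_pos ha hb
  have h1 := beta_pos (show 0 < a + p by positivity) (show 0 < b + q by positivity)
  have hm : ∀ u v : ℝ, Measurable (betaPDF u v) := fun u v => by unfold betaPDF; fun_prop
  rw [betaMeasure, lintegral_withDensity_eq_lintegral_mul _ (hm a b) (by fun_prop)]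
  have e : ∀ x : ℝ, (betaPDF a b * fun x => ENNReal.ofReal (x ^ p * (1 - x) ^ q)) x =
      ENNReal.ofReal (beta (a + p) (b + q) / beta a b) * betaPDF (a + p) (b + q) x := fun x => by
    rw [Pi.mul_apply]
    by_cases hx : 0 < x ∧ x < 1
    · have hx2 : 0 < 1 - x := by linarith [hx.2]
      rw [betaPDF_of_pos_lt_one hx.1 hx.2, betaPDF_of_pos_lt_one hx.1 hx.2,
        ← ENNReal.ofReal_mul (by have := hx.1; positivity), ← ENNReal.ofReal_mul (by positivity)]
      congr 1
      rw [show a + p - 1 = a - 1 + p by ring, show b + q - 1 = b - 1 + q by ring,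
        Real.rpow_add hx.1, Real.rpow_add hx2]
      field_simp
    · rw [betaPDF_eq, betaPDF_eq, if_neg hx, if_neg hx]; simp
  simp_rw [e]
  rw [lintegral_const_mul _ (hm _ _), lintegral_betaPDF_eq_one (by positivity) (by positivity),
    mul_one]

lemma lintegral_betaMeasure_pow {a b : ℝ} (ha : 0 < a) (hb : 0 < b) (r : ℕ) :
    ∫⁻ x, ENNReal.ofReal (|x| ^ r) ∂(betaMeasure a b) =
      ENNReal.ofReal (rising a r / rising (a + b) r) := by
  have h := lintegral_betaMeasure_rpow ha hb (Nat.cast_nonneg r) le_rfl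
  calc _ = ∫⁻ x, ENNReal.ofReal (x ^ (r : ℝ) * (1 - x) ^ (0 : ℝ)) ∂(betaMeasure a b) := by
        refine lintegral_congr_ae ?_
        filter_upwards [ae_betaMeasure_mem_Ioo a b] with x hx
        rw [abs_of_pos hx.1]; simp
    _ = _ := by
        rw [h]
        congr 1
        have e : a + r + (b + 0) = a + b + r := by ring
        rw [beta, beta, e, Gamma_add_nat ha, Gamma_add_nat (add_pos ha hb), add_zero]
        have h1 := (Real.Gamma_pos_of_pos ha).ne'
        have h2 := (Real.Gamma_pos_of_pos hb).ne'
        have h3 := (Real.Gamma_pos_of_pos (add_pos ha hb)).ne'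
        field_simp

/-! ### Infinite products of independent random variables -/

/-- The partial products form a nonnegative martingale of constant mean one, hence one bounded in
`L¹`. -/
lemma exists_tendsto_prod_of_iIndepFun {Ω : Type*} [MeasurableSpace Ω] {P : Measure Ω}
    [IsProbabilityMeasure P] {Y : ℕ → Ω → ℝ} (hY : ∀ j, Measurable (Y j)) (hind : iIndepFun Y P)
    (hpos : ∀ j ω, 0 ≤ Y j ω) (hmean : ∀ j, ∫⁻ ω, ENNReal.ofReal (Y j ω) ∂P = 1) :
    ∃ X : Ω → ℝ, Measurable X ∧
      ∀ᵐ ω ∂P, Tendsto (fun n => ∏ j ∈ Finset.range n, Y j ω) atTop (𝓝 (X ω)) := by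
  have hone : ∀ n, ∫⁻ ω, ENNReal.ofReal (∏ j ∈ Finset.range n, Y j ω) ∂P = 1 := fun n => by
    have h := lintegral_prod_eq_prod_lintegral_of_indepFun (Finset.range n)
      (fun j ω => ENNReal.ofReal (Y j ω))
      (hind.comp (fun _ => ENNReal.ofReal) fun _ => ENNReal.measurable_ofReal)
      (fun j => (hY j).ennreal_ofReal)
    simp_rw [hmean, Finset.prod_const_one] at h
    rw [← h]
    refine lintegral_congr fun ω => ENNReal.ofReal_prod_of_nonneg fun j _ => hpos j ω
  have hpos' : ∀ n ω, 0 ≤ ∏ j ∈ Finset.range n, Y j ω := fun n ω =>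
    Finset.prod_nonneg fun j _ => hpos j ω
  have hint : ∀ n, Integrable (fun ω => ∏ j ∈ Finset.range n, Y j ω) P := fun n => by
    refine ⟨by fun_prop, ?_⟩
    rw [hasFiniteIntegral_iff_ofReal (ae_of_all _ (hpos' n)), hone]
    exact ENNReal.one_lt_top
  have hYint : ∀ j, Integrable (Y j) P := fun j => by
    refine ⟨by fun_prop, ?_⟩
    rw [hasFiniteIntegral_iff_ofReal (ae_of_all _ (hpos j)), hmean]
    exact ENNReal.one_lt_top
  have hYone : ∀ j, ∫ ω, Y j ω ∂P = 1 := fun j => by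
    rw [integral_eq_lintegral_of_nonneg_ae (ae_of_all _ (hpos j)) (by fun_prop), hmean]
    simp
  have hsm : ∀ j, StronglyMeasurable (Y j) := fun j => (hY j).stronglyMeasurable
  set F := Filtration.natural Y hsm with hF
  -- The product runs over `n + 1` factors, so that `X n` involves exactly the variables known at
  -- time `n` of the natural filtration.
  set X : ℕ → Ω → ℝ := fun n ω => ∏ j ∈ Finset.range (n + 1), Y j ω with hX
  have hadp : StronglyAdapted F X := fun n => by
    refine Finset.stronglyMeasurable_fun_prod _ fun j hj => ?_
    exact (Filtration.stronglyAdapted_natural hsm j).mono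
      (F.mono (Nat.lt_succ_iff.1 (Finset.mem_range.1 hj)))
  have hmart : Martingale X F P := by
    refine martingale_nat hadp (fun n => hint (n + 1)) fun n => ?_
    have e : X (n + 1) = X n * Y (n + 1) := by
      ext ω; exact Finset.prod_range_succ _ _
    have h1 := condExp_mul_of_stronglyMeasurable_left (μ := P) (hadp n)
      (by rw [← e]; exact hint (n + 2)) (hYint (n + 1))
    have h2 := hind.condExp_natural_ae_eq_of_lt hsm (Nat.lt_succ_self n)
    rw [e]
    filter_upwards [h1, h2] with ω h1 h2
    rw [h1, Pi.mul_apply]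
    rw [h2, hYone, mul_one]
  have hlim := hmart.submartingale.ae_tendsto_limitProcess (R := 1) fun n => by
    rw [eLpNorm_one_eq_lintegral_enorm]
    refine le_of_eq ?_
    rw [ENNReal.coe_one, ← hone (n + 1)]
    refine lintegral_congr fun ω => ?_
    rw [← ofReal_norm, Real.norm_of_nonneg (hpos' (n + 1) ω)]
  refine ⟨_, (Filtration.stronglyMeasurable_limit_process' (f := X) (ℱ := F) (μ := P)).measurable, ?_⟩
  filter_upwards [hlim] with ω hω
  exact (tendsto_add_atTop_iff_nat 1).1 hω

/-- The moments of order `2 * r` converge, hence are bounded, so the `r`-th powers are bounded in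
`L²` and their means converge to that of the limit. -/
lemma tendsto_integral_pow_of_tendsto {Ω : Type*} [MeasurableSpace Ω] {P : Measure Ω}
    [IsFiniteMeasure P] {X : ℕ → Ω → ℝ} {Y : Ω → ℝ} (hX : ∀ n, Measurable (X n))
    (hpos : ∀ n ω, 0 ≤ X n ω) (hXY : ∀ᵐ ω ∂P, Tendsto (fun n => X n ω) atTop (𝓝 (Y ω)))
    {m : ℕ → ℕ → ℝ} (hm : ∀ n r, ∫⁻ ω, ENNReal.ofReal (X n ω ^ r) ∂P = ENNReal.ofReal (m n r))
    (hm0 : ∀ n r, 0 ≤ m n r) {l : ℕ → ℝ}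
    (hl : ∀ r, Tendsto (fun n => m n r) atTop (𝓝 (l r))) (r : ℕ) :
    ∫⁻ ω, ENNReal.ofReal (Y ω ^ r) ∂P = ENNReal.ofReal (l r) := by
  obtain ⟨C, hC⟩ := (hl (2 * r)).bddAbove_range
  have h := tendsto_integral_of_sq_bounded P (X := fun n ω => X n ω ^ r) (Y := fun ω => Y ω ^ r)
    (C := C) (fun n => by fun_prop) (fun n => by
      simp_rw [← pow_mul, mul_comm r 2, hm]
      exact ENNReal.ofReal_le_ofReal (hC ⟨n, rfl⟩))
    (by filter_upwards [hXY] with ω hω using hω.pow r)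
  have hY : ∀ᵐ ω ∂P, 0 ≤ Y ω ^ r := by
    filter_upwards [hXY] with ω hω
    exact pow_nonneg (ge_of_tendsto' hω fun n => hpos n ω) r
  rw [← ofReal_integral_eq_lintegral_ofReal h.1 hY]
  congr 1
  refine tendsto_nhds_unique h.2 ((hl r).congr fun n => ?_)
  rw [integral_eq_lintegral_of_nonneg_ae (ae_of_all _ fun ω => pow_nonneg (hpos n ω) r)
    (by fun_prop), hm, ENNReal.toReal_ofReal (hm0 n r)]

/-! ### The Mittag-Leffler distribution -/

/-- The product equals `Γ(n + 1 + β) / (Γ(1 + β) * Γ(n + 1))`. -/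
lemma tendsto_prod_add_div {β : ℝ} (hβ : 0 ≤ β) :
    Tendsto (fun n : ℕ => (∏ j ∈ Finset.range n, ((j : ℝ) + 1 + β) / (j + 1)) / (n : ℝ) ^ β) atTop
      (𝓝 (1 / Real.Gamma (1 + β))) := by
  have h := (tendsto_Gamma_ratio (c := 1) (by norm_num) hβ).const_mul (1 / Real.Gamma (1 + β))
  rw [mul_one] at h
  refine h.congr fun n => ?_
  have e : ∀ y : ℝ, ∏ j ∈ Finset.range n, ((j : ℝ) + 1 + y) = rising (1 + y) n := fun y =>
    Finset.prod_congr rfl fun j _ => by ring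
  have e0 := e 0
  simp only [add_zero] at e0
  have h1 := Gamma_add_nat (show (0 : ℝ) < 1 + β by positivity) n
  have h2 := Gamma_add_nat (show (0 : ℝ) < 1 by norm_num) n
  rw [Finset.prod_div_distrib, e, e0, show (n : ℝ) + 1 + β = 1 + β + n by ring,
    show (n : ℝ) + 1 = 1 + n by ring, h1, h2, Real.Gamma_one, mul_one]
  have h3 := (Real.Gamma_pos_of_pos (show (0 : ℝ) < 1 + β by positivity)).ne'
  field_simp

/-- Existence of a distribution with the moments of the size-biased Mittag-Leffler distribution. -/
lemma exists_measure_moments_biased {α : ℝ} (hα0 : 0 < α) (hα1 : α < 1) :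
    ∃ μ : Measure ℝ, IsProbabilityMeasure μ ∧ (∀ᵐ x ∂μ, 0 ≤ x) ∧
      ∀ r : ℕ, ∫⁻ x, ENNReal.ofReal (x ^ r) ∂μ =
        ENNReal.ofReal (rising (1 / α) r / Real.Gamma (1 + α * r)) := by
  have hb : 0 < 1 / α - 1 := by rw [sub_pos, lt_div_iff₀ hα0]; linarith
  -- The beta parameters `x j + 1` and `1 / α - 1` sum to `x (j + 1)`, which makes the moments of
  -- the product telescope.
  set x : ℕ → ℝ := fun j => ((j : ℝ) + 1) / α with hx
  have hxpos : ∀ j, 0 < x j := fun j => by positivity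
  have hxb : ∀ j, x j + 1 + (1 / α - 1) = x (j + 1) := fun j => by
    simp only [hx]; push_cast; field_simp; ring
  have : ∀ j, IsProbabilityMeasure (betaMeasure (x j + 1) (1 / α - 1)) := fun j =>
    isProbabilityMeasureBeta (by have := hxpos j; positivity) hb
  obtain ⟨Ω, _, P, B, hBm, hBl, hBi, _⟩ :=
    exists_hasLaw_indepFun (fun _ : ℕ => ℝ) fun j => betaMeasure (x j + 1) (1 / α - 1)
  -- The inverse of the mean of the `j`-th beta variable.
  set d : ℕ → ℝ := fun j => x (j + 1) / (x j + 1) with hd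
  have hdpos : ∀ j, 0 < d j := fun j => by
    have := hxpos j; have := hxpos (j + 1); positivity
  set Y : ℕ → Ω → ℝ := fun j ω => d j * |B j ω| with hY
  have hYm : ∀ j, Measurable (Y j) := fun j => by fun_prop
  have hY0 : ∀ j ω, 0 ≤ Y j ω := fun j ω => mul_nonneg (hdpos j).le (abs_nonneg _)
  have hYi : iIndepFun Y P := hBi.comp (fun j y => d j * |y|) fun j => by fun_prop
  have hYr : ∀ j r, ∫⁻ ω, ENNReal.ofReal (Y j ω ^ r) ∂P =
      ENNReal.ofReal (d j ^ r * (rising (x j + 1) r / rising (x (j + 1)) r)) := fun j r => by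
    have h := lintegral_betaMeasure_pow (a := x j + 1) (by have := hxpos j; positivity) hb r
    rw [hxb, ← (hBl j).map_eq, lintegral_map (by fun_prop) (hBm j)] at h
    rw [ENNReal.ofReal_mul (pow_nonneg (hdpos j).le r), ← h, ← lintegral_const_mul _ (by fun_prop)]
    refine lintegral_congr fun ω => ?_
    rw [← ENNReal.ofReal_mul (pow_nonneg (hdpos j).le r), ← mul_pow]
  have hmean : ∀ j, ∫⁻ ω, ENNReal.ofReal (Y j ω) ∂P = 1 := fun j => by
    have h := hYr j 1
    simp only [pow_one, rising_one, hd] at h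
    rw [h, ← ENNReal.ofReal_one]
    congr 1
    have := hxpos j; have := hxpos (j + 1)
    field_simp
  obtain ⟨X, hXm, hX⟩ := exists_tendsto_prod_of_iIndepFun hYm hYi hY0 hmean
  set q : ℕ → ℕ → ℝ := fun n r => ∏ j ∈ Finset.range n, ((j : ℝ) + 1 + α * r) / (j + 1) with hq
  have hqpos : ∀ n r, 0 < q n r := fun n r => Finset.prod_pos fun j _ => by positivity
  -- The closed form of the `r`-th moment of the partial product: `rising (x j + 1) r` is `(x j + r)
  -- / x j * rising (x j) r`, so the rising factorials telescope, and the product of the quotients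
  -- `(x j + r) / x j` is `q n r`.
  set m : ℕ → ℕ → ℝ := fun n r =>
    (x n / x 0) ^ r * (q n r / q n 1 ^ r) * (rising (x 0) r / rising (x n) r) with hm
  have hrpos : ∀ n r, 0 < rising (x n) r := fun n r =>
    Finset.prod_pos fun j _ => by have := hxpos n; positivity
  have hm0 : ∀ n r, 0 ≤ m n r := fun n r => by
    have := hxpos n; have := hxpos 0; have := hqpos n r; have := hqpos n 1
    have := hrpos n r; have := hrpos 0 r
    simp only [hm]; positivity
  have hmY : ∀ n r, ∫⁻ ω, ENNReal.ofReal ((∏ j ∈ Finset.range n, Y j ω) ^ r) ∂P =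
      ENNReal.ofReal (m n r) := fun n r => by
    have h := lintegral_prod_eq_prod_lintegral_of_indepFun (Finset.range n)
      (fun j ω => ENNReal.ofReal (Y j ω ^ r))
      (hYi.comp (fun _ y => ENNReal.ofReal (y ^ r)) fun _ => by fun_prop)
      (fun j => by fun_prop)
    simp_rw [hYr] at h
    have hpos2 : ∀ j, 0 ≤ d j ^ r * (rising (x j + 1) r / rising (x (j + 1)) r) := fun j => by
      have := hdpos j; have := hrpos (j + 1) r
      have := rising_nonneg (show 0 ≤ x j + 1 by have := hxpos j; positivity) r
      positivity
    rw [← ENNReal.ofReal_prod_of_nonneg fun j _ => hpos2 j] at h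
    calc _ = ∫⁻ ω, ∏ j ∈ Finset.range n, ENNReal.ofReal (Y j ω ^ r) ∂P :=
          lintegral_congr fun ω => by
            rw [← Finset.prod_pow, ENNReal.ofReal_prod_of_nonneg fun j _ => pow_nonneg (hY0 j ω) r]
      _ = _ := by
          rw [h]
          congr 1
          clear h
          induction n with
          | zero =>
            have := (hxpos 0).ne'; have := (hrpos 0 r).ne'
            simp [hm, hq, this]
            field_simp
            rw [one_pow]
          | succ n ih =>
            rw [Finset.prod_range_succ, ih]
            have hx1 := hxpos n
            have e1 : rising (x n + 1) r = (x n + r) / x n * rising (x n) r := by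
              rw [div_mul_eq_mul_div, ← mul_rising_add_one]; field_simp
            have e2 : ∀ r : ℕ, q (n + 1) r = q n r * ((x n + r) / x n) := fun r => by
              simp only [hq]
              rw [Finset.prod_range_succ]
              congr 1
              simp only [hx]; field_simp
            simp only [hm, e1, e2, hd, div_pow, mul_pow, Nat.cast_one]
            have := (hxpos n).ne'; have := (hxpos 0).ne'; have := (hqpos n 1).ne'
            have := (hrpos n r).ne'; have := (hrpos (n + 1) r).ne'
            have : x n + 1 ≠ 0 := by positivity
            field_simp
  set l : ℕ → ℝ := fun r =>
    (α * Real.Gamma (1 + α)) ^ r * (rising (1 / α) r / Real.Gamma (1 + α * r)) with hl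
  have hlim : ∀ r, Tendsto (fun n => m n r) atTop (𝓝 (l r)) := fun r => by
    have hxt : Tendsto x atTop atTop := by
      simp only [hx]
      exact (tendsto_atTop_add_const_right _ _ tendsto_natCast_atTop_atTop).atTop_div_const hα0
    have t1 := tendsto_rising_div_pow hxt (u := x) (c := 1)
      (tendsto_const_nhds.congr fun n => (div_self (hxpos n).ne').symm) r
    rw [one_pow] at t1
    have t2 := tendsto_prod_add_div (β := α * r) (by positivity)
    have t3 := (tendsto_prod_add_div hα0.le).pow r
    have hG := Real.Gamma_pos_of_pos (show 0 < 1 + α by positivity)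
    have t4 := ((t2.div t3 (by positivity)).div t1 one_ne_zero).const_mul
      ((1 / x 0) ^ r * rising (x 0) r)
    have e0 : x 0 = 1 / α := by simp [hx]
    have el : (1 / x 0) ^ r * rising (x 0) r *
        (1 / Real.Gamma (1 + α * r) / (1 / Real.Gamma (1 + α)) ^ r / 1) = l r := by
      simp only [hl, e0, one_div, div_one, div_inv_eq_mul, inv_pow, mul_pow]
      ring
    rw [el] at t4
    refine t4.congr' ?_
    filter_upwards [eventually_gt_atTop 0] with n hn
    have hn' : (0 : ℝ) < n := by exact_mod_cast hn
    have p1 : ((n : ℝ) ^ α) ^ r = (n : ℝ) ^ (α * r) := by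
      rw [Real.rpow_mul hn'.le, Real.rpow_natCast]
    have p2 : (n : ℝ) ^ (α * r) ≠ 0 := by positivity
    simp only [hm, hq, Nat.cast_one, mul_one, Pi.div_apply]
    have := (hqpos n 1).ne'
    simp only [hq, Nat.cast_one, mul_one] at this
    have := (hxpos n).ne'; have := (hxpos 0).ne'; have := (hrpos n r).ne'
    rw [div_pow (∏ j ∈ Finset.range n, ((j : ℝ) + 1 + α) / (j + 1)), p1, div_pow (x n), div_pow 1,
      one_pow]
    field_simp
  have hXr := tendsto_integral_pow_of_tendsto (fun n => by fun_prop)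
    (fun n ω => Finset.prod_nonneg fun j _ => hY0 j ω) hX hmY hm0 hlim
  have hG := Real.Gamma_pos_of_pos (show 0 < 1 + α by positivity)
  -- Rescaling by `c` removes the geometric factor in the limiting moments `l r`.
  set c : ℝ := (α * Real.Gamma (1 + α))⁻¹ with hc
  have hcpos : 0 < c := by positivity
  refine ⟨P.map fun ω => c * X ω, Measure.isProbabilityMeasure_map (by fun_prop), ?_, fun r => ?_⟩
  · rw [ae_map_iff (by fun_prop) measurableSet_Ici]
    filter_upwards [hX] with ω hω
    exact mul_nonneg hcpos.le
      (ge_of_tendsto' hω fun n => Finset.prod_nonneg fun j _ => hY0 j ω)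
  · rw [lintegral_map (by fun_prop) (by fun_prop)]
    simp_rw [mul_pow, ENNReal.ofReal_mul (pow_nonneg hcpos.le r)]
    rw [lintegral_const_mul _ (by fun_prop), hXr, ← ENNReal.ofReal_mul (by positivity)]
    congr 1
    simp only [hl, hc]
    rw [← mul_assoc, ← mul_pow, inv_mul_cancel₀ (by positivity), one_pow, one_mul]

end AlphaGamma

/-! ### Existence, Laplace transform and moments of the Mittag-Leffler distribution -/

namespace AlphaGamma

lemma lintegral_rpow_mul_exp_neg_mul_rpow {p q b : ℝ} (hp : 0 < p) (hq : -1 < q) (hb : 0 < b) :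
    ∫⁻ x in Set.Ioi (0 : ℝ), ENNReal.ofReal (x ^ q * Real.exp (-b * x ^ p)) =
      ENNReal.ofReal (b ^ (-(q + 1) / p) * (1 / p) * Real.Gamma ((q + 1) / p)) := by
  rw [← integral_rpow_mul_exp_neg_mul_rpow hp hq hb,
    ofReal_integral_eq_lintegral_ofReal (integrableOn_rpow_mul_exp_neg_mul_rpow hq hp hb)]
  filter_upwards [self_mem_ae_restrict measurableSet_Ioi] with x hx
  have : (0 : ℝ) < x := hx
  positivity

/-- Existence of a distribution with the moments of the Mittag-Leffler distribution and without
singular part outside the origin. -/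
lemma exists_measure_moments_mittagLeffler {α : ℝ} (hα0 : 0 < α) (hα1 : α < 1) :
    ∃ ρ : Measure ℝ, IsProbabilityMeasure ρ ∧ (∀ᵐ x ∂ρ, 0 ≤ x) ∧
      (∀ r : ℕ, ∫⁻ x, ENNReal.ofReal (x ^ r) ∂ρ =
        ENNReal.ofReal (r.factorial / Real.Gamma (1 + α * r))) ∧
      (ρ {0} = 0 → ρ ≪ volume) := by
  obtain ⟨μ, hμ, hμ0, hμr⟩ := exists_measure_moments_biased hα0 hα1
  have hb : 0 < 1 / α - 1 := by rw [sub_pos, lt_div_iff₀ hα0]; linarith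
  -- An independent beta factor with moments `r! / rising (1 / α) r` undoes the size-biasing. It
  -- also makes the product absolutely continuous away from the origin, as the beta law has a
  -- density.
  set ν := betaMeasure 1 (1 / α - 1) with hν
  have : IsProbabilityMeasure ν := isProbabilityMeasureBeta one_pos hb
  have hae : ∀ᵐ z ∂(ν.prod μ), 0 < z.1 ∧ 0 ≤ z.2 := by
    have h1 := Measure.quasiMeasurePreserving_fst (μ := ν) (ν := μ) |>.ae
      (ae_betaMeasure_mem_Ioo 1 (1 / α - 1))
    have h2 := Measure.quasiMeasurePreserving_snd (μ := ν) (ν := μ) |>.ae hμ0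
    filter_upwards [h1, h2] with z h1 h2 using ⟨h1.1, h2⟩
  refine ⟨(ν.prod μ).map fun z => z.1 * z.2, Measure.isProbabilityMeasure_map (by fun_prop), ?_,
    fun r => ?_, fun h0 => ?_⟩
  · rw [ae_map_iff (by fun_prop) measurableSet_Ici]
    filter_upwards [hae] with z hz using mul_nonneg hz.1.le hz.2
  · rw [lintegral_map (by fun_prop) (by fun_prop)]
    calc _ = ∫⁻ z, ENNReal.ofReal (|z.1| ^ r) * ENNReal.ofReal (z.2 ^ r) ∂(ν.prod μ) := by
          refine lintegral_congr_ae ?_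
          filter_upwards [hae] with z hz
          rw [← ENNReal.ofReal_mul (by positivity), abs_of_pos hz.1, mul_pow]
      _ = _ := by
          rw [lintegral_prod_mul (f := fun x => ENNReal.ofReal (|x| ^ r))
            (g := fun x => ENNReal.ofReal (x ^ r)) (by fun_prop) (by fun_prop), hμr, hν,
            lintegral_betaMeasure_pow one_pos hb]
          have h1 : 0 < rising (1 / α) r := Finset.prod_pos fun j _ => by positivity
          have h2 : rising 1 r = r.factorial := by
            have h3 := Gamma_add_nat one_pos r
            rw [Real.Gamma_one, mul_one, add_comm, Real.Gamma_nat_eq_factorial] at h3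
            exact h3.symm
          have h4 := Real.Gamma_pos_of_pos (show 0 < 1 + α * r by positivity)
          rw [show 1 + (1 / α - 1) = 1 / α by ring, h2, ← ENNReal.ofReal_mul (by positivity)]
          congr 1
          field_simp
  · refine Measure.AbsolutelyContinuous.mk fun s hs hs0 => ?_
    rw [Measure.map_apply (by fun_prop) hs,
      Measure.prod_apply_symm ((show Measurable fun z : ℝ × ℝ => z.1 * z.2 by fun_prop) hs)]
    rw [Measure.map_apply (by fun_prop) (measurableSet_singleton 0)] at h0
    -- An atom of `μ` at the origin would be an atom of the product law there. For every other value
    -- `y` the slice of a null set is a rescaled null set.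
    have hμne : ∀ᵐ y ∂μ, y ≠ 0 := by
      have h1 : (ν.prod μ) (Set.univ ×ˢ {0}) = 0 := by
        refine measure_mono_null ?_ h0
        rintro ⟨x, y⟩ ⟨-, hy⟩
        have hy' : y = 0 := hy
        simp [hy']
      rw [Measure.prod_prod, measure_univ, one_mul] at h1
      rw [ae_iff]
      simpa using h1
    rw [lintegral_eq_zero_iff' (by
      exact (measurable_measure_prodMk_right
        ((show Measurable fun z : ℝ × ℝ => z.1 * z.2 by fun_prop) hs)).aemeasurable)]
    filter_upwards [hμne] with y hy
    have hac : ν ≪ volume := withDensity_absolutelyContinuous _ _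
    refine hac ?_
    have e : (fun x : ℝ => (x, y)) ⁻¹' ((fun z : ℝ × ℝ => z.1 * z.2) ⁻¹' s) =
        (fun x : ℝ => x * y) ⁻¹' s := rfl
    rw [e, Real.volume_preimage_mul_right hy, hs0, mul_zero]

/-- The Laplace transform of `x ^ (-1 / α)` under the Mittag-Leffler distribution. -/
lemma lintegral_exp_of_moments {α : ℝ} (hα0 : 0 < α) {ρ : Measure ℝ} [IsProbabilityMeasure ρ]
    (h0 : ∀ᵐ x ∂ρ, 0 ≤ x)
    (hr : ∀ r : ℕ, ∫⁻ x, ENNReal.ofReal (x ^ r) ∂ρ =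
        ENNReal.ofReal (r.factorial / Real.Gamma (1 + α * r))) {u : ℝ} (hu : 0 < u) :
    ∫⁻ x in Set.Ioi 0, ENNReal.ofReal (Real.exp (-(u / x) ^ (1 / α))) ∂ρ =
      ENNReal.ofReal (Real.exp (-u)) := by
  -- Instead of computing `ψ`, one compares the measures with densities `ψ u` and `exp (-u)` on the
  -- half-line: both have moments `n!`. The set of integration excludes the origin because an atom
  -- of `ρ` there is not yet ruled out.
  set ψ : ℝ → ENNReal := fun u =>
    ∫⁻ x in Set.Ioi 0, ENNReal.ofReal (Real.exp (-(u / x) ^ (1 / α))) ∂ρ with hψ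
  have hψm : Measurable ψ := by
    refine Measurable.lintegral_prod_left'
      (f := fun z : ℝ × ℝ => ENNReal.ofReal (Real.exp (-(z.2 / z.1) ^ (1 / α)))) ?_
    fun_prop
  set V : Measure ℝ := volume.restrict (Set.Ioi 0) with hV
  set e : ℝ → ENNReal := fun u => ENNReal.ofReal (Real.exp (-u)) with he
  have hem : Measurable e := by fun_prop
  have hVpos : ∀ᵐ u ∂V, 0 < u := self_mem_ae_restrict measurableSet_Ioi
  have momψ : ∀ n : ℕ, ∫⁻ u, ENNReal.ofReal (|u| ^ n) ∂(V.withDensity ψ) =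
      ENNReal.ofReal n.factorial := fun n => by
    rw [lintegral_withDensity_eq_lintegral_mul _ hψm (by fun_prop)]
    calc ∫⁻ u, (ψ * fun u => ENNReal.ofReal (|u| ^ n)) u ∂V
        = ∫⁻ u, ∫⁻ x in Set.Ioi 0, ENNReal.ofReal (u ^ (n : ℝ) *
            Real.exp (-(x ^ (-(1 / α))) * u ^ (1 / α))) ∂ρ ∂V := by
          refine lintegral_congr_ae ?_
          filter_upwards [hVpos] with u hu
          rw [Pi.mul_apply, hψ, ← lintegral_mul_const _ (by fun_prop)]
          refine lintegral_congr_ae ?_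
          filter_upwards [self_mem_ae_restrict measurableSet_Ioi] with x hx
          have hx' : (0 : ℝ) < x := hx
          rw [← ENNReal.ofReal_mul (by positivity), abs_of_pos hu, Real.rpow_natCast, mul_comm,
            Real.div_rpow hu.le hx'.le, Real.rpow_neg hx'.le]
          congr 3
          ring
      _ = ∫⁻ x in Set.Ioi 0, ∫⁻ u, ENNReal.ofReal (u ^ (n : ℝ) *
            Real.exp (-(x ^ (-(1 / α))) * u ^ (1 / α))) ∂V ∂ρ := by
          refine lintegral_lintegral_swap ?_
          refine Measurable.aemeasurable ?_
          simp only [Function.uncurry_def]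
          fun_prop
      -- After Fubini, the integral in `u` is a Gamma integral proportional to `x ^ (n + 1)`, so
      -- only an integer moment of `ρ` is needed.
      _ = ∫⁻ x in Set.Ioi 0, ENNReal.ofReal (α * Real.Gamma (α * (n + 1))) *
            ENNReal.ofReal (x ^ (n + 1)) ∂ρ := by
          refine lintegral_congr_ae ?_
          filter_upwards [self_mem_ae_restrict measurableSet_Ioi] with x hx
          have hx' : (0 : ℝ) < x := hx
          have hn : (0 : ℝ) ≤ n := Nat.cast_nonneg n
          have hG := Real.Gamma_pos_of_pos (show 0 < α * (n + 1) by positivity)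
          rw [hV, lintegral_rpow_mul_exp_neg_mul_rpow (by positivity) (by linarith)
            (by positivity), ← ENNReal.ofReal_mul (by positivity), ← Real.rpow_mul hx'.le]
          congr 1
          rw [show -(1 / α) * (-((n : ℝ) + 1) / (1 / α)) = ((n + 1 : ℕ) : ℝ) by
            push_cast; field_simp, Real.rpow_natCast,
            show ((n : ℝ) + 1) / (1 / α) = α * (n + 1) by field_simp]
          rw [one_div_one_div]; ring
      _ = ENNReal.ofReal (α * Real.Gamma (α * (n + 1))) *
            ∫⁻ x, ENNReal.ofReal (x ^ (n + 1)) ∂ρ := by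
          rw [lintegral_const_mul _ (by fun_prop)]
          congr 1
          rw [← lintegral_indicator measurableSet_Ioi]
          refine lintegral_congr_ae ?_
          filter_upwards [h0] with x hx
          rcases hx.eq_or_lt with hx | hx
          · simp [← hx]
          · rw [Set.indicator_of_mem (by exact hx)]
      _ = _ := by
          have hG := Real.Gamma_pos_of_pos (show 0 < α * (n + 1) by positivity)
          rw [hr, ← ENNReal.ofReal_mul (by positivity)]
          congr 1
          push_cast
          rw [add_comm 1, Real.Gamma_add_one (by positivity), Nat.factorial_succ]
          push_cast
          field_simp
  have mome : ∀ n : ℕ, ∫⁻ u, ENNReal.ofReal (|u| ^ n) ∂(V.withDensity e) =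
      ENNReal.ofReal n.factorial := fun n => by
    rw [lintegral_withDensity_eq_lintegral_mul _ hem (by fun_prop)]
    calc ∫⁻ u, (e * fun u => ENNReal.ofReal (|u| ^ n)) u ∂V
        = ∫⁻ u, ENNReal.ofReal (u ^ (n : ℝ) * Real.exp (-1 * u ^ (1 : ℝ))) ∂V := by
          refine lintegral_congr_ae ?_
          filter_upwards [hVpos] with u hu
          rw [Pi.mul_apply, he, ← ENNReal.ofReal_mul (by positivity), abs_of_pos hu,
            Real.rpow_natCast, mul_comm]
          simp
      _ = _ := by
          rw [hV, lintegral_rpow_mul_exp_neg_mul_rpow one_pos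
            (by linarith [(Nat.cast_nonneg n : (0 : ℝ) ≤ n)]) one_pos]
          simp [Real.Gamma_nat_eq_factorial]
  have fin : ∀ f : ℝ → ENNReal, (∀ n : ℕ, ∫⁻ u, ENNReal.ofReal (|u| ^ n) ∂(V.withDensity f) =
      ENNReal.ofReal n.factorial) → IsFiniteMeasure (V.withDensity f) := fun f hf => by
    have := hf 0
    simp only [pow_zero, ENNReal.ofReal_one, lintegral_const, one_mul] at this
    exact ⟨by rw [this]; exact ENNReal.ofReal_lt_top⟩
  have mom : ∀ f : ℝ → ENNReal, (∀ n : ℕ, ∫⁻ u, ENNReal.ofReal (|u| ^ n) ∂(V.withDensity f) =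
      ENNReal.ofReal n.factorial) → ∀ n : ℕ, ∫ u, u ^ n ∂(V.withDensity f) = n.factorial :=
    fun f hf n => by
      have hpos : ∀ᵐ u ∂(V.withDensity f), 0 < u := withDensity_absolutelyContinuous V f hVpos
      rw [integral_eq_lintegral_of_nonneg_ae (by filter_upwards [hpos] with u hu; positivity)
        (by fun_prop)]
      rw [lintegral_congr_ae (g := fun u => ENNReal.ofReal (|u| ^ n))
        (by filter_upwards [hpos] with u hu; rw [abs_of_pos hu]), hf]
      exact ENNReal.toReal_ofReal (by positivity)
  have hfin := fin ψ momψ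
  have hfin' := fin e mome
  have heq : V.withDensity ψ = V.withDensity e :=
    measure_ext_of_moments _ _ (C := 1) (R := 1) zero_le_one one_pos
      (fun n => by rw [momψ]; simp) (fun n => by rw [mome]; simp)
      fun n => by rw [mom ψ momψ, mom e mome]
  have hae : ψ =ᵐ[V] e :=
    (withDensity_eq_iff_of_sigmaFinite hψm.aemeasurable hem.aemeasurable).1 heq
  -- The densities agree almost everywhere, hence on a dense set; monotonicity of `ψ` and continuity
  -- of the exponential extend this to every `u > 0`.
  have hanti : ∀ u v, 0 < u → u ≤ v → ψ v ≤ ψ u := fun u v hu huv => by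
    refine lintegral_mono_ae ?_
    filter_upwards [self_mem_ae_restrict measurableSet_Ioi] with x hx
    have hx' : (0 : ℝ) < x := hx
    refine ENNReal.ofReal_le_ofReal (Real.exp_le_exp.2 (neg_le_neg ?_))
    exact Real.rpow_le_rpow (by positivity) (by gcongr) (by positivity)
  have hdense : ∀ a b : ℝ, 0 ≤ a → a < b → ∃ w ∈ Set.Ioo a b, ψ w = e w := fun a b ha hab => by
    by_contra! hcon
    have h1 : ∀ᵐ u ∂V, u ∉ Set.Ioo a b := by
      filter_upwards [hae] with u hu hmem using hcon u hmem hu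
    rw [ae_iff] at h1
    simp only [not_not, Set.ofPred_mem_eq] at h1
    rw [hV, Measure.restrict_apply measurableSet_Ioo, Set.inter_eq_left.2
      (show Set.Ioo a b ⊆ Set.Ioi 0 from fun y hy => lt_of_le_of_lt ha hy.1), Real.volume_Ioo, ENNReal.ofReal_eq_zero] at h1
    linarith
  have hecont : Continuous e := ENNReal.continuous_ofReal.comp (Real.continuous_exp.comp continuous_neg)
  refine le_antisymm ?_ ?_
  · refine ge_of_tendsto ((hecont.tendsto u).mono_left (nhdsWithin_le_nhds (s := Set.Iio u))) ?_
    filter_upwards [Ioo_mem_nhdsLT hu] with a ha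
    obtain ⟨w, hw, hw'⟩ := hdense a u ha.1.le ha.2
    calc ψ u ≤ ψ w := hanti w u (ha.1.trans hw.1) hw.2.le
      _ = e w := hw'
      _ ≤ e a := ENNReal.ofReal_le_ofReal (Real.exp_le_exp.2 (by linarith [hw.1]))
  · refine le_of_tendsto ((hecont.tendsto u).mono_left (nhdsWithin_le_nhds (s := Set.Ioi u))) ?_
    filter_upwards [self_mem_nhdsWithin] with b hb
    obtain ⟨w, hw, hw'⟩ := hdense u b hu.le hb
    calc e b ≤ e w := ENNReal.ofReal_le_ofReal (Real.exp_le_exp.2 (by linarith [hw.2]))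
      _ = ψ w := hw'.symm
      _ ≤ ψ u := hanti u w hu hw.1.le

/-- Existence of the Mittag-Leffler density. -/
lemma exists_isMittagLefflerDensity {α : ℝ} (hα0 : 0 < α) (hα1 : α < 1) :
    ∃ g : ℝ → ℝ, IsMittagLefflerDensity α g := by
  obtain ⟨ρ, hρ, h0, hr, hac⟩ := exists_measure_moments_mittagLeffler hα0 hα1
  have hL := fun u : ℝ => lintegral_exp_of_moments hα0 h0 hr (u := u)
  have hIoi : ρ (Set.Ioi 0) = 1 := by
    refine le_antisymm prob_le_one ?_
    -- The transform at `u` is at most the mass of the open half-line; letting `u` tend to zero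
    -- gives mass one, so there is no atom at the origin.
    have hle : ∀ u : ℝ, 0 < u → ENNReal.ofReal (Real.exp (-u)) ≤ ρ (Set.Ioi 0) := fun u hu => by
      rw [← hL u hu, ← setLIntegral_one]
      refine lintegral_mono_ae ?_
      filter_upwards [self_mem_ae_restrict measurableSet_Ioi] with x hx
      have hx' : (0 : ℝ) < x := hx
      rw [← ENNReal.ofReal_one]
      refine ENNReal.ofReal_le_ofReal (Real.exp_le_one_iff.2 ?_)
      have : 0 ≤ (u / x) ^ (1 / α) := by positivity
      linarith
    have hc : Tendsto (fun u : ℝ => ENNReal.ofReal (Real.exp (-u))) (𝓝[>] 0) (𝓝 1) := by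
      have h1 : Continuous fun u : ℝ => ENNReal.ofReal (Real.exp (-u)) :=
        ENNReal.continuous_ofReal.comp (Real.continuous_exp.comp continuous_neg)
      have h2 := (h1.tendsto 0).mono_left (nhdsWithin_le_nhds (s := Set.Ioi (0 : ℝ)))
      simpa using h2
    exact le_of_tendsto hc (by filter_upwards [self_mem_nhdsWithin] with u hu using hle u hu)
  have hcompl : ρ (Set.Ioi 0)ᶜ = 0 := (prob_compl_eq_zero_iff measurableSet_Ioi).2 hIoi
  have hpos : ∀ᵐ x ∂ρ, x ∈ Set.Ioi (0 : ℝ) := mem_ae_iff.2 hcompl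
  have hρac : ρ ≪ volume := hac (measure_mono_null (by simp) hcompl)
  have hrestr : ρ.restrict (Set.Ioi 0) = ρ := Measure.restrict_eq_self_of_ae_mem hpos
  have hν : IsProbabilityMeasure (ρ.map fun x : ℝ => x ^ (-(1 / α))) :=
    Measure.isProbabilityMeasure_map (by fun_prop)
  refine ⟨fun s => (ρ.rnDeriv volume s).toReal, by fun_prop, fun s => ENNReal.toReal_nonneg,
    ρ.map fun x => x ^ (-(1 / α)), ⟨hν, ?_, fun lam hlam => ?_⟩, ?_⟩
  · rw [ae_map_iff (by fun_prop) measurableSet_Ioi]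
    filter_upwards [hpos] with x hx using Real.rpow_pos_of_pos hx _
  · rcases hlam.eq_or_lt with rfl | hlam
    · have := probReal_univ (μ := ρ.map fun x : ℝ => x ^ (-(1 / α)))
      simpa [Real.zero_rpow hα0.ne'] using this
    rw [integral_map (by fun_prop) (by fun_prop), integral_eq_lintegral_of_nonneg_ae
      (ae_of_all _ fun x => (Real.exp_pos _).le) (by fun_prop), ← hrestr]
    -- With `u = lam ^ α` one has `(u / x) ^ (1 / α) = lam * x ^ (-(1 / α))`.
    have h1 := hL (lam ^ α) (by positivity)
    rw [lintegral_congr_ae (g := fun x =>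
      ENNReal.ofReal (Real.exp (-(lam ^ α / x) ^ (1 / α)))), h1,
      ENNReal.toReal_ofReal (Real.exp_pos _).le]
    filter_upwards [self_mem_ae_restrict measurableSet_Ioi] with x hx
    have hx' : (0 : ℝ) < x := hx
    rw [Real.div_rpow (by positivity) hx'.le, ← Real.rpow_mul hlam.le,
      mul_one_div_cancel hα0.ne', Real.rpow_one, Real.rpow_neg hx'.le, div_eq_mul_inv lam]
  · rw [Measure.map_map (by fun_prop) (by fun_prop)]
    calc ρ.map ((fun x : ℝ => x ^ (-α)) ∘ fun x : ℝ => x ^ (-(1 / α))) = ρ.map id := by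
          refine Measure.map_congr ?_
          filter_upwards [hpos] with x hx
          have hx' : (0 : ℝ) < x := hx
          rw [Function.comp_apply, ← Real.rpow_mul hx'.le, neg_mul_neg,
            one_div_mul_cancel hα0.ne', Real.rpow_one, id]
      _ = ρ.restrict (Set.Ioi 0) := by rw [Measure.map_id, hrestr]
      _ = (volume.withDensity (ρ.rnDeriv volume)).restrict (Set.Ioi 0) := by
          rw [Measure.withDensity_rnDeriv_eq _ _ hρac]
      _ = (volume.restrict (Set.Ioi 0)).withDensity (ρ.rnDeriv volume) :=
          restrict_withDensity measurableSet_Ioi _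
      _ = _ := by
          refine withDensity_congr_ae (ae_restrict_of_ae ?_)
          filter_upwards [Measure.rnDeriv_lt_top ρ volume] with s hs
          rw [ENNReal.ofReal_toReal hs.ne]

/-- The moments of the Mittag-Leffler distribution. -/
lemma lintegral_rpow_mul_of_isMittagLefflerDensity {α : ℝ} (hα0 : 0 < α) {g : ℝ → ℝ}
    (hg : IsMittagLefflerDensity α g) {z : ℝ} (hz : 0 < z) :
    ∫⁻ s in Set.Ioi 0, ENNReal.ofReal (s ^ z * g s) =
      ENNReal.ofReal (Real.Gamma (1 + z) / Real.Gamma (1 + α * z)) := by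
  obtain ⟨hgm, hg0, ν, ⟨hν, hνpos, hνL⟩, hmap⟩ := hg
  have hαz : 0 < α * z := by positivity
  have hG := Real.Gamma_pos_of_pos hαz
  have e1 : ∫⁻ s in Set.Ioi 0, ENNReal.ofReal (s ^ z * g s) =
      ∫⁻ x, ENNReal.ofReal (x ^ (-(α * z))) ∂ν := by
    calc ∫⁻ s in Set.Ioi 0, ENNReal.ofReal (s ^ z * g s)
        = ∫⁻ s, ENNReal.ofReal (s ^ z) ∂(ν.map (fun x => x ^ (-α))) := by
          rw [hmap, lintegral_withDensity_eq_lintegral_mul _ (by fun_prop) (by fun_prop)]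
          refine lintegral_congr_ae ?_
          filter_upwards [self_mem_ae_restrict measurableSet_Ioi] with s hs
          have hs' : (0 : ℝ) < s := hs
          rw [Pi.mul_apply, ← ENNReal.ofReal_mul (hg0 s), mul_comm]
      _ = _ := by
          rw [lintegral_map (by fun_prop) (by fun_prop)]
          refine lintegral_congr_ae ?_
          filter_upwards [hνpos] with x hx
          rw [← Real.rpow_mul hx.le, neg_mul]
  -- Negative moments come from the Laplace transform: `Γ(α z) * x ^ (-(α z))` is the integral of `u
  -- ^ (α z - 1) * exp (-(u x))` over `u > 0`, and Fubini brings in `exp (-u ^ α)`.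
  have e2 : ENNReal.ofReal (Real.Gamma (α * z)) * ∫⁻ x, ENNReal.ofReal (x ^ (-(α * z))) ∂ν =
      ENNReal.ofReal ((1 / α) * Real.Gamma z) := by
    rw [← lintegral_const_mul _ (by fun_prop)]
    calc ∫⁻ x, ENNReal.ofReal (Real.Gamma (α * z)) * ENNReal.ofReal (x ^ (-(α * z))) ∂ν
        = ∫⁻ x, (∫⁻ u in Set.Ioi (0 : ℝ),
            ENNReal.ofReal (u ^ (α * z - 1) * Real.exp (-(u * x)))) ∂ν := by
          refine lintegral_congr_ae ?_
          filter_upwards [hνpos] with x hx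
          have h := lintegral_rpow_mul_exp_neg_mul_rpow (p := 1) (q := α * z - 1) one_pos
            (by linarith) hx
          simp only [Real.rpow_one, sub_add_cancel, div_one, mul_one] at h
          rw [← ENNReal.ofReal_mul hG.le, mul_comm, ← h]
          refine lintegral_congr fun u => ?_
          congr 3; ring
      _ = ∫⁻ u in Set.Ioi (0 : ℝ), ∫⁻ x,
            ENNReal.ofReal (u ^ (α * z - 1) * Real.exp (-(u * x))) ∂ν := by
          refine lintegral_lintegral_swap ?_
          refine Measurable.aemeasurable ?_
          simp only [Function.uncurry_def]
          fun_prop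
      _ = ∫⁻ u in Set.Ioi (0 : ℝ),
            ENNReal.ofReal (u ^ (α * z - 1) * Real.exp (-1 * u ^ α)) := by
          refine lintegral_congr_ae ?_
          filter_upwards [self_mem_ae_restrict measurableSet_Ioi] with u hu
          have hu' : (0 : ℝ) < u := hu
          have hi : Integrable (fun x => Real.exp (-(u * x))) ν := by
            -- Without integrability the Bochner integral would be zero, but the Laplace transform
            -- is positive.
            by_contra hcon
            have := hνL u hu'.le
            rw [integral_undef hcon] at this
            exact (Real.exp_pos _).ne this
          have hp : 0 ≤ u ^ (α * z - 1) := by positivity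
          simp_rw [ENNReal.ofReal_mul hp]
          rw [lintegral_const_mul _ (by fun_prop),
            ← ofReal_integral_eq_lintegral_ofReal hi (ae_of_all _ fun x => (Real.exp_pos _).le),
            hνL u hu'.le, neg_one_mul]
      _ = _ := by
          rw [lintegral_rpow_mul_exp_neg_mul_rpow hα0 (by linarith) one_pos]
          congr 1
          rw [Real.one_rpow, one_mul, sub_add_cancel, mul_div_cancel_left₀ _ hα0.ne']
  have hGz := Real.Gamma_pos_of_pos hz
  rw [e1, ← ENNReal.mul_right_inj (a := ENNReal.ofReal (Real.Gamma (α * z))) (by simpa using hG)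
    ENNReal.ofReal_ne_top, e2, ← ENNReal.ofReal_mul hG.le]
  congr 1
  rw [add_comm 1, add_comm 1, Real.Gamma_add_one hz.ne', Real.Gamma_add_one hαz.ne']
  field_simp

end AlphaGamma

namespace AlphaGamma

/-! ### The Dirichlet distribution -/

lemma measurableSet_forall_pos (m : ℕ) : MeasurableSet {x : Fin m → ℝ | ∀ i, 0 < x i} := by
  rw [Set.ofPred_forall]
  exact MeasurableSet.iInter fun i => measurableSet_lt measurable_const (measurable_pi_apply i)

lemma measurableSet_simplex {m : ℕ} (c : ℝ) :
    MeasurableSet {x : Fin m → ℝ | (∀ i, 0 < x i) ∧ ∑ i, x i < c} :=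
  (measurableSet_forall_pos m).inter
    (measurableSet_lt (Finset.measurable_fun_sum _ fun i _ => measurable_pi_apply i)
      measurable_const)

lemma measurable_dirichletPDF {m : ℕ} (a : Fin (m + 1) → ℝ) : Measurable (dirichletPDF a) := by
  classical
  unfold dirichletPDF
  exact Measurable.ite (measurableSet_simplex 1) (by fun_prop) (by fun_prop)

lemma measurable_snoc_one_sub_sum {m : ℕ} : Measurable fun x : Fin m → ℝ =>
    (Fin.snoc (α := fun _ => ℝ) x (1 - ∑ i, x i) : Fin (m + 1) → ℝ) := by
  refine measurable_pi_lambda _ fun i => ?_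
  refine Fin.lastCases ?_ (fun j => ?_) i
  · simp only [Fin.snoc_last]; fun_prop
  · simp only [Fin.snoc_castSucc]; fun_prop

/-- The substitution `x = c * y` reduces this to the normalisation of the beta density. -/
lemma lintegral_beta_scaled {p q c : ℝ} (hp : 0 < p) (hq : 0 < q) (hc : 0 < c) :
    ∫⁻ x, ENNReal.ofReal (if 0 < x ∧ x < c then x ^ (p - 1) * (c - x) ^ (q - 1) else 0) =
      ENNReal.ofReal (c ^ (p + q - 1) * (Real.Gamma p * Real.Gamma q / Real.Gamma (p + q))) := by
  have hmeas : Measurable fun x : ℝ =>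
      ENNReal.ofReal (if 0 < x ∧ x < c then x ^ (p - 1) * (c - x) ^ (q - 1) else 0) :=
    (Measurable.ite (by measurability) (by fun_prop) (by fun_prop)).ennreal_ofReal
  have hB := beta_pos hp hq
  rw [← Real.smul_map_volume_mul_left hc.ne', lintegral_smul_measure, lintegral_map hmeas
    (by fun_prop)]
  have e : ∀ y : ℝ, ENNReal.ofReal (if 0 < c * y ∧ c * y < c then
      (c * y) ^ (p - 1) * (c - c * y) ^ (q - 1) else 0) =
      ENNReal.ofReal (c ^ (p + q - 2) * beta p q) * betaPDF p q y := fun y => by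
    have h1 : (0 < c * y ∧ c * y < c) ↔ (0 < y ∧ y < 1) := by
      rw [mul_pos_iff_of_pos_left hc, mul_lt_iff_lt_one_right hc]
    rw [betaPDF_eq, ← ENNReal.ofReal_mul (by positivity)]
    congr 1
    by_cases hy : 0 < y ∧ y < 1
    · have hy2 : 0 < 1 - y := by linarith [hy.2]
      rw [if_pos (h1.2 hy), if_pos hy, show c - c * y = c * (1 - y) by ring,
        Real.mul_rpow hc.le hy.1.le, Real.mul_rpow hc.le hy2.le,
        show p + q - 2 = (p - 1) + (q - 1) by ring, Real.rpow_add hc]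
      field_simp
    · rw [if_neg (fun h => hy (h1.1 h)), if_neg hy, mul_zero]
  simp_rw [e]
  rw [lintegral_const_mul _ (by unfold betaPDF; fun_prop), lintegral_betaPDF_eq_one hp hq, mul_one,
    abs_of_pos hc, smul_eq_mul, ← ENNReal.ofReal_mul hc.le, beta, ← mul_assoc]
  congr 2
  rw [show p + q - 1 = 1 + (p + q - 2) by ring, Real.rpow_add hc, Real.rpow_one]

open scoped Classical in
/-- The integral of the non-normalised Dirichlet density over a scaled simplex. -/
lemma lintegral_dirichlet_scaled {m : ℕ} (a : Fin (m + 1) → ℝ) (ha : ∀ i, 0 < a i) {c : ℝ}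
    (hc : 0 < c) :
    ∫⁻ x : Fin m → ℝ, ENNReal.ofReal (if (∀ i, 0 < x i) ∧ ∑ i, x i < c then
      (∏ i, x i ^ (a i.castSucc - 1)) * (c - ∑ i, x i) ^ (a (Fin.last m) - 1) else 0) =
    ENNReal.ofReal (c ^ (∑ i, a i - 1) * ((∏ i, Real.Gamma (a i)) / Real.Gamma (∑ i, a i))) := by
  -- Fixing the first coordinate `x` leaves the same integral over the simplex of size `c - x`,
  -- hence the need for all sizes; what remains is a scaled beta integral in `x`.
  induction m generalizing c with
  | zero =>
    have := (Real.Gamma_pos_of_pos (ha 0)).ne'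
    have h0 : (volume : Measure (Fin 0 → ℝ)) = Measure.dirac (fun i => i.elim0) := by
      rw [volume_pi, Measure.pi_of_empty (x := fun i => i.elim0)]
    rw [h0, lintegral_dirac]
    simp [hc, this]
  | succ m ih =>
    set f : (Fin (m + 1) → ℝ) → ENNReal := fun x =>
      ENNReal.ofReal (if (∀ i, 0 < x i) ∧ ∑ i, x i < c then
      (∏ i, x i ^ (a i.castSucc - 1)) * (c - ∑ i, x i) ^ (a (Fin.last (m + 1)) - 1) else 0) with hf
    have hfm : Measurable f := by
      exact (Measurable.ite (measurableSet_simplex c) (by fun_prop) (by fun_prop)).ennreal_ofReal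
    have hvp := (volume_preserving_piFinSuccAbove (fun _ : Fin (m + 1) => ℝ) 0).symm
    rw [← hvp.lintegral_comp hfm, Measure.volume_eq_prod, lintegral_prod _ (by
      exact (hfm.comp (MeasurableEquiv.measurable _)).aemeasurable)]
    have hs : 0 < ∑ i : Fin (m + 1), a i.succ :=
      Finset.sum_pos (fun i _ => ha _) Finset.univ_nonempty
    have hG := Real.Gamma_pos_of_pos hs
    have hPG : 0 < ∏ i : Fin (m + 1), Real.Gamma (a i.succ) :=
      Finset.prod_pos fun i _ => Real.Gamma_pos_of_pos (ha _)
    have key : ∀ x : ℝ, ∫⁻ y : Fin m → ℝ,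
        f ((MeasurableEquiv.piFinSuccAbove (fun _ : Fin (m + 1) => ℝ) 0).symm (x, y)) =
        ENNReal.ofReal ((∏ i : Fin (m + 1), Real.Gamma (a i.succ)) /
          Real.Gamma (∑ i : Fin (m + 1), a i.succ)) *
        ENNReal.ofReal (if 0 < x ∧ x < c then
          x ^ (a 0 - 1) * (c - x) ^ (∑ i : Fin (m + 1), a i.succ - 1) else 0) := fun x => by
      have e : ∀ y : Fin m → ℝ,
          f ((MeasurableEquiv.piFinSuccAbove (fun _ : Fin (m + 1) => ℝ) 0).symm (x, y)) =
          ENNReal.ofReal (if 0 < x ∧ x < c then x ^ (a 0 - 1) else 0) *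
          ENNReal.ofReal (if (∀ i, 0 < y i) ∧ ∑ i, y i < c - x then
            (∏ i, y i ^ (a i.castSucc.succ - 1)) *
            (c - x - ∑ i, y i) ^ (a (Fin.last m).succ - 1) else 0) := fun y => by
        have hcons : (MeasurableEquiv.piFinSuccAbove (fun _ : Fin (m + 1) => ℝ) 0).symm (x, y) =
            (Fin.cons x y : Fin (m + 1) → ℝ) := by
          ext i
          refine Fin.cases ?_ (fun j => ?_) i <;>
            simp [MeasurableEquiv.piFinSuccAbove, Fin.insertNthEquiv]
        rw [hcons, hf]
        simp only [Fin.forall_fin_succ, Fin.cons_zero, Fin.cons_succ, Fin.sum_univ_succ,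
          Fin.prod_univ_succ, Fin.castSucc_zero, Fin.succ_last, ← Fin.succ_castSucc]
        by_cases h : (0 < x ∧ ∀ i, 0 < y i) ∧ x + ∑ i, y i < c
        · have hy : 0 ≤ ∑ i, y i := Finset.sum_nonneg fun i _ => (h.1.2 i).le
          rw [if_pos h, if_pos ⟨h.1.1, by linarith [h.2]⟩, if_pos ⟨h.1.2, by linarith [h.2]⟩,
            ← ENNReal.ofReal_mul (Real.rpow_nonneg h.1.1.le _), ← mul_assoc, sub_sub]
        · rw [if_neg h]
          by_cases hx : 0 < x ∧ x < c
          · rw [if_neg (c := (∀ i, 0 < y i) ∧ ∑ i, y i < c - x) fun h' =>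
              h ⟨⟨hx.1, h'.1⟩, by linarith [h'.2]⟩]
            simp
          · rw [if_neg hx]; simp
      simp_rw [e]
      by_cases hx : 0 < x ∧ x < c
      · rw [lintegral_const_mul' _ _ ENNReal.ofReal_ne_top,
          ih (fun i => a i.succ) (fun i => ha _) (show 0 < c - x by linarith [hx.2])]
        rw [if_pos hx, if_pos hx, ← ENNReal.ofReal_mul (by have := hx.1; positivity),
          ← ENNReal.ofReal_mul (by positivity)]
        congr 1; ring
      · simp [hx]
    simp_rw [key]
    rw [lintegral_const_mul' _ _ ENNReal.ofReal_ne_top, lintegral_beta_scaled (ha 0) hs hc,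
      ← ENNReal.ofReal_mul (by positivity), Fin.sum_univ_succ a,
      Fin.prod_univ_succ fun i => Real.Gamma (a i)]
    congr 1
    field_simp

/-- A monomial with exponents `r` shifts the parameters from `a` to `a + r`, so the moment is a
quotient of Dirichlet integrals. -/
lemma lintegral_dirichletMeasure {m : ℕ} (a : Fin (m + 1) → ℝ) (ha : ∀ i, 0 < a i)
    (r : Fin (m + 1) → ℕ) :
    ∫⁻ d, ENNReal.ofReal (∏ i, d i ^ r i) ∂(dirichletMeasure a) =
      ENNReal.ofReal ((∏ i, rising (a i) (r i)) / rising (∑ i, a i) (∑ i, r i)) := by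
  classical
  have hsnoc := measurable_snoc_one_sub_sum (m := m)
  have hpdf := measurable_dirichletPDF a
  have hS : 0 < ∑ i, a i := Finset.sum_pos (fun i _ => ha i) Finset.univ_nonempty
  have hGS := Real.Gamma_pos_of_pos hS
  have hPG : 0 < ∏ i, Real.Gamma (a i) := Finset.prod_pos fun i _ => Real.Gamma_pos_of_pos (ha i)
  rw [dirichletMeasure, lintegral_map (by fun_prop) hsnoc,
    lintegral_withDensity_eq_lintegral_mul _ (by fun_prop) (by fun_prop)]
  set b : Fin (m + 1) → ℝ := fun i => a i + r i with hb
  have hbpos : ∀ i, 0 < b i := fun i => by have := ha i; positivity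
  have e : ∀ x : Fin m → ℝ, ((fun x => ENNReal.ofReal (dirichletPDF a x)) * fun x =>
      ENNReal.ofReal (∏ i, (Fin.snoc (α := fun _ => ℝ) x (1 - ∑ i, x i) : Fin (m + 1) → ℝ) i ^ r i))
        x = ENNReal.ofReal (Real.Gamma (∑ i, a i) / ∏ i, Real.Gamma (a i)) *
      ENNReal.ofReal (if (∀ i, 0 < x i) ∧ ∑ i, x i < 1 then
      (∏ i, x i ^ (b i.castSucc - 1)) * (1 - ∑ i, x i) ^ (b (Fin.last m) - 1) else 0) := fun x => by
    rw [Pi.mul_apply, dirichletPDF]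
    by_cases hx : (∀ i, 0 < x i) ∧ ∑ i, x i < 1
    · have hx1 : 0 < 1 - ∑ i, x i := by linarith [hx.2]
      have hp : 0 ≤ ∏ i, x i ^ (a i.castSucc - 1) :=
        Finset.prod_nonneg fun i _ => Real.rpow_nonneg (hx.1 i).le _
      rw [if_pos hx, if_pos hx, ← ENNReal.ofReal_mul (by positivity),
        ← ENNReal.ofReal_mul (by positivity), Fin.prod_univ_castSucc
          (f := fun i => (Fin.snoc (α := fun _ => ℝ) x (1 - ∑ i, x i) : Fin (m + 1) → ℝ) i ^ r i)]
      simp only [Fin.snoc_castSucc, Fin.snoc_last]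
      congr 1
      have h1 : ∏ i, x i ^ (b i.castSucc - 1) =
          (∏ i, x i ^ (a i.castSucc - 1)) * ∏ i, x i ^ r i.castSucc := by
        rw [← Finset.prod_mul_distrib]
        refine Finset.prod_congr rfl fun i _ => ?_
        rw [hb, show a i.castSucc + (r i.castSucc : ℝ) - 1 = a i.castSucc - 1 + r i.castSucc by ring,
          Real.rpow_add (hx.1 i), Real.rpow_natCast]
      rw [h1, hb, show a (Fin.last m) + (r (Fin.last m) : ℝ) - 1 =
        a (Fin.last m) - 1 + r (Fin.last m) by ring, Real.rpow_add hx1, Real.rpow_natCast]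
      ring
    · rw [if_neg hx, if_neg hx]; simp
  simp_rw [e]
  rw [lintegral_const_mul' _ _ ENNReal.ofReal_ne_top, lintegral_dirichlet_scaled b hbpos one_pos,
    Real.one_rpow, one_mul, ← ENNReal.ofReal_mul (by positivity)]
  congr 1
  have h2 : ∏ i, Real.Gamma (b i) = (∏ i, rising (a i) (r i)) * ∏ i, Real.Gamma (a i) := by
    rw [← Finset.prod_mul_distrib]
    exact Finset.prod_congr rfl fun i _ => Gamma_add_nat (ha i) _
  have h3 : ∑ i, b i = ∑ i, a i + (∑ i, r i : ℕ) := by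
    simp only [hb, Finset.sum_add_distrib]; push_cast; rfl
  rw [h2, h3, Gamma_add_nat hS]
  have : rising (∑ i, a i) (∑ i, r i) ≠ 0 := Finset.prod_ne_zero_iff.2 fun j _ => by positivity
  field_simp

lemma isProbabilityMeasure_dirichletMeasure {m : ℕ} (a : Fin (m + 1) → ℝ) (ha : ∀ i, 0 < a i) :
    IsProbabilityMeasure (dirichletMeasure a) := by
  have h := lintegral_dirichletMeasure a ha 0
  simp only [Pi.zero_apply, pow_zero, Finset.prod_const_one, ENNReal.ofReal_one, lintegral_const,
    one_mul, rising_zero, Finset.sum_const_zero, div_one] at h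
  exact ⟨h⟩

lemma ae_dirichletMeasure {m : ℕ} (a : Fin (m + 1) → ℝ) :
    ∀ᵐ d ∂(dirichletMeasure a), (∀ i, 0 < d i) ∧ ∑ i, d i = 1 := by
  have hsnoc := measurable_snoc_one_sub_sum (m := m)
  have hpdf := measurable_dirichletPDF a
  have hms : MeasurableSet {d : Fin (m + 1) → ℝ | (∀ i, 0 < d i) ∧ ∑ i, d i = 1} := by
    exact (measurableSet_forall_pos (m + 1)).inter
      (measurableSet_eq_fun (Finset.measurable_fun_sum _ fun i _ => measurable_pi_apply i)
        measurable_const)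
  rw [dirichletMeasure, ae_map_iff hsnoc.aemeasurable hms, ae_withDensity_iff (by fun_prop)]
  refine ae_of_all _ fun x hx => ?_
  have hx' : (∀ i, 0 < x i) ∧ ∑ i, x i < 1 := by
    by_contra hcon
    exact hx (by rw [dirichletPDF, if_neg hcon, ENNReal.ofReal_zero])
  refine ⟨fun i => ?_, ?_⟩
  · refine Fin.lastCases ?_ (fun j => ?_) i
    · simp only [Fin.snoc_last]; linarith [hx'.2]
    · simp only [Fin.snoc_castSucc]; exact hx'.1 j
  · rw [Fin.sum_univ_castSucc]; simp

/-! ### The tilted Mittag-Leffler distribution -/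

/-- Up to the normalising constant this is the Mittag-Leffler moment of order `θ / α + r`. -/
lemma lintegral_tiltedMeasure {α θ : ℝ} (hα0 : 0 < α) (hθ : 0 < θ) {g : ℝ → ℝ}
    (hg : IsMittagLefflerDensity α g) (r : ℕ) :
    ∫⁻ s, ENNReal.ofReal (s ^ r) ∂(tiltedMeasure α θ g) =
      ENNReal.ofReal (Real.Gamma (θ + 1) / Real.Gamma (θ / α + 1) *
        (Real.Gamma (θ / α + 1 + r) / Real.Gamma (θ + 1 + α * r))) := by
  have hgm := hg.1
  have hg0 := hg.2.1
  have h1 := Real.Gamma_pos_of_pos (show 0 < θ + 1 by positivity)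
  have h2 := Real.Gamma_pos_of_pos (show 0 < θ / α + 1 by positivity)
  rw [tiltedMeasure, lintegral_withDensity_eq_lintegral_mul _ (by fun_prop) (by fun_prop)]
  have hz : 0 < θ / α + r := by positivity
  have h3 := lintegral_rpow_mul_of_isMittagLefflerDensity hα0 hg hz
  rw [show 1 + (θ / α + r) = θ / α + 1 + r by ring,
    show 1 + α * (θ / α + r) = θ + 1 + α * r by field_simp; ring] at h3
  rw [ENNReal.ofReal_mul (by positivity), ← h3, ← lintegral_const_mul _ (by fun_prop)]
  refine lintegral_congr_ae ?_
  filter_upwards [self_mem_ae_restrict measurableSet_Ioi] with s hs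
  have hs' : (0 : ℝ) < s := hs
  rw [Pi.mul_apply, ← ENNReal.ofReal_mul (by have := hg0 s; positivity),
    ← ENNReal.ofReal_mul (by positivity), Real.rpow_add hs', Real.rpow_natCast]
  congr 1; ring

lemma isProbabilityMeasure_tiltedMeasure {α θ : ℝ} (hα0 : 0 < α) (hθ : 0 < θ) {g : ℝ → ℝ}
    (hg : IsMittagLefflerDensity α g) : IsProbabilityMeasure (tiltedMeasure α θ g) := by
  have h := lintegral_tiltedMeasure hα0 hθ hg 0
  have h1 := (Real.Gamma_pos_of_pos (show 0 < θ + 1 by positivity)).ne'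
  have h2 := (Real.Gamma_pos_of_pos (show 0 < θ / α + 1 by positivity)).ne'
  simp only [pow_zero, ENNReal.ofReal_one, lintegral_const, one_mul, Nat.cast_zero, add_zero,
    mul_zero] at h
  refine ⟨h.trans ?_⟩
  rw [← ENNReal.ofReal_one]
  congr 1
  field_simp

lemma ae_tiltedMeasure_pos (α θ : ℝ) (g : ℝ → ℝ) : ∀ᵐ s ∂(tiltedMeasure α θ g), 0 < s :=
  withDensity_absolutelyContinuous _ _ (self_mem_ae_restrict measurableSet_Ioi)

end AlphaGamma

namespace AlphaGamma

/-! ### Identification of the joint law of the limits -/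

/-- The joint moments of `W` and `(1 - W) ^ α * M * D`, with `N = a + θ`. -/
noncomputable def jointMoment {ι : Type*} [Fintype ι] (α a N : ℝ) (b : ι → ℝ) (p : ℕ)
    (r : ι → ℕ) : ℝ :=
  rising a p * (∏ i, rising (b i) (r i)) *
    (Real.Gamma N / Real.Gamma (N + p + α * (∑ i, r i : ℕ)))

/-- The joint law of independent beta, tilted Mittag-Leffler and Dirichlet variables. -/
noncomputable def productLaw {m : ℕ} (α a θ : ℝ) (g : ℝ → ℝ) (b : Fin (m + 1) → ℝ) :
    Measure (ℝ × ℝ × (Fin (m + 1) → ℝ)) :=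
  (betaMeasure a θ).prod ((tiltedMeasure α θ g).prod (dirichletMeasure b))

section

variable {m : ℕ} {α a θ : ℝ} {g : ℝ → ℝ} {b : Fin (m + 1) → ℝ}

lemma sum_pos_of_forall_pos (hb : ∀ i, 0 < b i) : 0 < ∑ i, b i :=
  Finset.sum_pos (fun i _ => hb i) Finset.univ_nonempty

lemma isProbabilityMeasure_productLaw (hα0 : 0 < α) (ha : 0 < a) (hb : ∀ i, 0 < b i)
    (hθ : 0 < θ) (hg : IsMittagLefflerDensity α g) :
    IsProbabilityMeasure (productLaw α a θ g b) := by
  have := isProbabilityMeasureBeta ha hθ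
  have := isProbabilityMeasure_tiltedMeasure hα0 hθ hg
  have := isProbabilityMeasure_dirichletMeasure b hb
  unfold productLaw
  infer_instance

lemma ae_productLaw (hα0 : 0 < α) (ha : 0 < a) (hb : ∀ i, 0 < b i) (hθ : 0 < θ)
    (hg : IsMittagLefflerDensity α g) :
    ∀ᵐ z ∂(productLaw α a θ g b),
      z.1 ∈ Set.Ioo (0 : ℝ) 1 ∧ 0 < z.2.1 ∧ (∀ i, 0 < z.2.2 i) ∧ ∑ i, z.2.2 i = 1 := by
  have := isProbabilityMeasureBeta ha hθ
  have := isProbabilityMeasure_tiltedMeasure hα0 hθ hg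
  have := isProbabilityMeasure_dirichletMeasure b hb
  have h1 := Measure.quasiMeasurePreserving_fst (μ := betaMeasure a θ)
    (ν := (tiltedMeasure α θ g).prod (dirichletMeasure b)) |>.ae (ae_betaMeasure_mem_Ioo a θ)
  have h2 := Measure.quasiMeasurePreserving_snd (μ := betaMeasure a θ)
    (ν := (tiltedMeasure α θ g).prod (dirichletMeasure b)) |>.ae
    (Measure.quasiMeasurePreserving_fst (μ := tiltedMeasure α θ g)
      (ν := dirichletMeasure b) |>.ae (ae_tiltedMeasure_pos α θ g))
  have h3 := Measure.quasiMeasurePreserving_snd (μ := betaMeasure a θ)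
    (ν := (tiltedMeasure α θ g).prod (dirichletMeasure b)) |>.ae
    (Measure.quasiMeasurePreserving_snd (μ := tiltedMeasure α θ g)
      (ν := dirichletMeasure b) |>.ae (ae_dirichletMeasure b))
  unfold productLaw
  filter_upwards [h1, h2, h3] with z h1 h2 h3 using ⟨h1, h2, h3⟩

/-- By independence the moment splits into three factors, with `R = ∑ r i`. The relation `θ = α * ∑
b i` makes them fit: `Γ(θ + α R)` cancels between the beta and the Mittag-Leffler factor, and
`rising (∑ b i) R` between the Mittag-Leffler and the Dirichlet factor. -/
lemma lintegral_productLaw (hα0 : 0 < α) (ha : 0 < a) (hb : ∀ i, 0 < b i)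
    (hθ : θ = α * ∑ i, b i) (hg : IsMittagLefflerDensity α g) (p : ℕ) (r : Fin (m + 1) → ℕ) :
    ∫⁻ z, ENNReal.ofReal (z.1 ^ p * ∏ i, ((1 - z.1) ^ α * z.2.1 * z.2.2 i) ^ r i)
      ∂(productLaw α a θ g b) = ENNReal.ofReal (jointMoment α a (a + θ) b p r) := by
  have hS := sum_pos_of_forall_pos hb
  have hθ0 : 0 < θ := by rw [hθ]; positivity
  have hae := ae_productLaw hα0 ha hb hθ0 hg
  have := isProbabilityMeasureBeta ha hθ0
  have := isProbabilityMeasure_tiltedMeasure hα0 hθ0 hg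
  have := isProbabilityMeasure_dirichletMeasure b hb
  set R : ℕ := ∑ i, r i with hR
  have h1 : ∫⁻ z, ENNReal.ofReal (z.1 ^ p * ∏ i, ((1 - z.1) ^ α * z.2.1 * z.2.2 i) ^ r i)
      ∂(productLaw α a θ g b) =
      ∫⁻ z, ENNReal.ofReal (z.1 ^ (p : ℝ) * (1 - z.1) ^ (α * R)) * (ENNReal.ofReal (z.2.1 ^ R) *
        ENNReal.ofReal (∏ i, z.2.2 i ^ r i)) ∂(productLaw α a θ g b) := by
    refine lintegral_congr_ae ?_
    filter_upwards [hae] with z hz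
    have hz1 : 0 < 1 - z.1 := by linarith [hz.1.2]
    have hz0 := hz.1.1
    have hz2 := hz.2.1
    rw [← ENNReal.ofReal_mul (by positivity), ← ENNReal.ofReal_mul (by positivity)]
    congr 1
    rw [Real.rpow_natCast, Real.rpow_mul hz1.le, Real.rpow_natCast]
    simp_rw [mul_pow, Finset.prod_mul_distrib, Finset.prod_pow_eq_pow_sum]
    ring
  rw [h1, productLaw, lintegral_prod_mul
    (f := fun x : ℝ => ENNReal.ofReal (x ^ (p : ℝ) * (1 - x) ^ (α * R)))
    (g := fun y : ℝ × (Fin (m + 1) → ℝ) => ENNReal.ofReal (y.1 ^ R) *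
        ENNReal.ofReal (∏ i, y.2 i ^ r i)) (by fun_prop) (by fun_prop),
    lintegral_prod_mul (f := fun x : ℝ => ENNReal.ofReal (x ^ R))
    (g := fun y : Fin (m + 1) → ℝ => ENNReal.ofReal (∏ i, y i ^ r i)) (by fun_prop)
      (Measurable.aemeasurable (by fun_prop)),
    lintegral_betaMeasure_rpow ha hθ0 (by positivity) (by positivity),
    lintegral_tiltedMeasure hα0 hθ0 hg, lintegral_dirichletMeasure b hb]
  have hR0 : (0 : ℝ) ≤ R := Nat.cast_nonneg R
  have hSα : θ / α = ∑ i, b i := by rw [hθ]; field_simp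
  have g1 := Real.Gamma_pos_of_pos ha
  have g2 := Real.Gamma_pos_of_pos hθ0
  have g3 := Real.Gamma_pos_of_pos hS
  have g4 := Real.Gamma_pos_of_pos (show 0 < a + θ by positivity)
  have g5 := Real.Gamma_pos_of_pos (show 0 < θ + α * R by positivity)
  have g6 := Real.Gamma_pos_of_pos (show 0 < a + θ + p + α * R by positivity)
  have g7 : 0 < rising (∑ i, b i) R := Finset.prod_pos fun j _ => by positivity
  have g8 : 0 ≤ rising a p := rising_nonneg ha.le p
  have g9 : 0 < ∑ i, b i + R := by positivity
  have g10 : 0 < θ + α * R := by positivity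
  have g11 : 0 < ∏ i, rising (b i) (r i) :=
    Finset.prod_pos fun i _ => Finset.prod_pos fun j _ => by have := hb i; positivity
  have e1 : beta (a + p) (θ + α * R) / beta a θ =
      rising a p * Real.Gamma (θ + α * R) / Real.Gamma θ *
        (Real.Gamma (a + θ) / Real.Gamma (a + θ + p + α * R)) := by
    rw [beta, beta, Gamma_add_nat ha, show a + p + (θ + α * R) = a + θ + p + α * R by ring]
    field_simp
  have e2 : Real.Gamma (θ + 1) / Real.Gamma (θ / α + 1) *
      (Real.Gamma (θ / α + 1 + R) / Real.Gamma (θ + 1 + α * R)) =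
      Real.Gamma θ * rising (∑ i, b i) R / Real.Gamma (θ + α * R) := by
    rw [hSα, show ∑ i, b i + 1 + (R : ℝ) = ∑ i, b i + R + 1 by ring,
      show θ + 1 + α * (R : ℝ) = θ + α * R + 1 by ring, Real.Gamma_add_one hθ0.ne',
      Real.Gamma_add_one hS.ne', Real.Gamma_add_one g9.ne', Real.Gamma_add_one g10.ne',
      Gamma_add_nat hS]
    rw [show θ + α * R = α * (∑ i, b i + R) by rw [hθ]; ring] at *
    rw [hθ]
    field_simp
  rw [e1, e2, ← ENNReal.ofReal_mul (by positivity), ← ENNReal.ofReal_mul (by positivity),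
    jointMoment, ← hR]
  congr 1
  field_simp

/-- The coordinates of `(w, c)`. -/
noncomputable def coordinate (m : ℕ) : Option (Fin (m + 1)) → (ℝ × (Fin (m + 1) → ℝ)) →L[ℝ] ℝ
  | none => ContinuousLinearMap.fst ℝ ℝ (Fin (m + 1) → ℝ)
  | some i => (ContinuousLinearMap.proj (R := ℝ) (φ := fun _ : Fin (m + 1) => ℝ) i).comp
      (ContinuousLinearMap.snd ℝ ℝ (Fin (m + 1) → ℝ))

lemma jointMoment_nonneg {ι : Type*} [Fintype ι] {α a N : ℝ} {b : ι → ℝ} (hα0 : 0 ≤ α)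
    (ha : 0 ≤ a) (hb : ∀ i, 0 ≤ b i) (hN : 0 < N) (p : ℕ) (r : ι → ℕ) :
    0 ≤ jointMoment α a N b p r := by
  have h1 := Real.Gamma_pos_of_pos hN
  have h2 := Real.Gamma_pos_of_pos (show 0 < N + p + α * (∑ i, r i : ℕ) by positivity)
  have h3 := rising_nonneg ha p
  have h4 : 0 ≤ ∏ i, rising (b i) (r i) := Finset.prod_nonneg fun i _ => rising_nonneg (hb i) _
  unfold jointMoment
  positivity

/-- Variables with the joint moments `jointMoment` have the same joint law as
`(W, (1 - W) ^ α * M * D)`. -/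
lemma map_eq_of_jointMoments (hα0 : 0 < α) (ha : 0 < a) (hb : ∀ i, 0 < b i)
    (hθ : θ = α * ∑ i, b i) (hN : 1 ≤ a + θ) (hg : IsMittagLefflerDensity α g)
    (μ : Measure (ℝ × (Fin (m + 1) → ℝ))) [IsProbabilityMeasure μ]
    (hpos : ∀ᵐ z ∂μ, 0 ≤ z.1 ∧ ∀ i, 0 ≤ z.2 i)
    (hμ : ∀ p r, ∫⁻ z, ENNReal.ofReal (z.1 ^ p * ∏ i, z.2 i ^ r i) ∂μ =
      ENNReal.ofReal (jointMoment α a (a + θ) b p r)) :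
    μ.map (fun z => (z.1, (∑ i, z.2 i) / (1 - z.1) ^ α, fun i => z.2 i / ∑ i, z.2 i)) =
      productLaw α a θ g b := by
  have hS := sum_pos_of_forall_pos hb
  have hθ0 : 0 < θ := by rw [hθ]; positivity
  have := isProbabilityMeasure_productLaw hα0 ha hb hθ0 hg
  have hae := ae_productLaw hα0 ha hb hθ0 hg
  -- `Φ` builds `(W, C)` from `(W, M, D)`, and `Ψ` inverts it where the entries of `D` sum to one.
  -- Only `(W, C)` has computable joint moments on both sides, so the laws are compared there and
  -- then transported by `Ψ`.
  set Φ : ℝ × ℝ × (Fin (m + 1) → ℝ) → ℝ × (Fin (m + 1) → ℝ) :=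
    fun z => (z.1, fun i => (1 - z.1) ^ α * z.2.1 * z.2.2 i) with hΦ
  have hΦm : Measurable Φ := by fun_prop
  set Ψ : ℝ × (Fin (m + 1) → ℝ) → ℝ × ℝ × (Fin (m + 1) → ℝ) :=
    fun z => (z.1, (∑ i, z.2 i) / (1 - z.1) ^ α, fun i => z.2 i / ∑ i, z.2 i) with hΨ
  have hΨm : Measurable Ψ := by fun_prop
  set ν := (productLaw α a θ g b).map Φ with hν
  have : IsProbabilityMeasure ν := Measure.isProbabilityMeasure_map hΦm.aemeasurable
  have hν' : ∀ p r, ∫⁻ z, ENNReal.ofReal (z.1 ^ p * ∏ i, z.2 i ^ r i) ∂ν =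
      ENNReal.ofReal (jointMoment α a (a + θ) b p r) := fun p r => by
    rw [hν, lintegral_map (by fun_prop) hΦm]
    exact lintegral_productLaw hα0 ha hb hθ hg p r
  have hνpos : ∀ᵐ z ∂ν, 0 ≤ z.1 ∧ ∀ i, 0 ≤ z.2 i := by
    have hms : MeasurableSet {z : ℝ × (Fin (m + 1) → ℝ) | 0 ≤ z.1 ∧ ∀ i, 0 ≤ z.2 i} := by
      have h1 : IsClosed {z : ℝ × (Fin (m + 1) → ℝ) | 0 ≤ z.1 ∧ ∀ i, 0 ≤ z.2 i} := by
        have h2 : IsClosed {z : ℝ × (Fin (m + 1) → ℝ) | ∀ i, 0 ≤ z.2 i} := by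
          rw [Set.ofPred_forall]
          exact isClosed_iInter fun i => isClosed_le continuous_const (by fun_prop)
        exact (isClosed_le continuous_const continuous_fst).inter h2
      exact h1.measurableSet
    rw [hν, ae_map_iff hΦm.aemeasurable hms]
    filter_upwards [hae] with z hz
    have hz1 : 0 < 1 - z.1 := by linarith [hz.1.2]
    have hz2 := hz.2.1
    exact ⟨hz.1.1.le, fun i => by have := hz.2.2.1 i; simp only [hΦ]; positivity⟩
  have hGN := Real.Gamma_pos_of_pos (show 0 < a + θ by positivity)
  -- It dominates `1 + a` and every `1 + b i`, the growth rates supplied by `rising_le`.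
  set Rr : ℝ := 1 + a + ∑ i, b i with hRr
  have hbound : ∀ ρ : Measure (ℝ × (Fin (m + 1) → ℝ)), (∀ᵐ z ∂ρ, 0 ≤ z.1 ∧ ∀ i, 0 ≤ z.2 i) →
      (∀ p r, ∫⁻ z, ENNReal.ofReal (z.1 ^ p * ∏ i, z.2 i ^ r i) ∂ρ =
        ENNReal.ofReal (jointMoment α a (a + θ) b p r)) → ∀ j (n : ℕ),
      ∫⁻ z, ENNReal.ofReal (|coordinate m j z| ^ n) ∂ρ ≤
        ENNReal.ofReal (2 * Real.Gamma (a + θ) * Rr ^ n * n.factorial) := fun ρ hρ hρ' j n => by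
    -- Here `1 ≤ a + θ` enters, through the lower bound one half for Gamma.
    have hq : ∀ x : ℝ, 0 ≤ x → Real.Gamma (a + θ) / Real.Gamma (a + θ + x) ≤
        2 * Real.Gamma (a + θ) := fun x hx => by
      have := half_le_Gamma (show 1 ≤ a + θ + x by linarith)
      rw [div_le_iff₀ (by linarith)]
      nlinarith
    cases j with
    | none =>
      have e := hρ' n 0
      calc _ = ∫⁻ z, ENNReal.ofReal (z.1 ^ n * ∏ i, z.2 i ^ (0 : Fin (m + 1) → ℕ) i) ∂ρ := by
            refine lintegral_congr_ae ?_
            filter_upwards [hρ] with z hz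
            simp [coordinate, abs_of_nonneg hz.1]
        _ ≤ _ := by
            rw [e]
            refine ENNReal.ofReal_le_ofReal ?_
            have h1 := hq n (Nat.cast_nonneg n)
            have h2 : rising a n ≤ Rr ^ n * n.factorial := (rising_le ha.le n).trans (by
              gcongr; linarith)
            simp only [jointMoment, Pi.zero_apply, rising_zero, Finset.prod_const_one,
              Finset.sum_const_zero, Nat.cast_zero, mul_zero, add_zero, mul_one]
            calc _ ≤ (Rr ^ n * n.factorial) * (2 * Real.Gamma (a + θ)) :=
                  mul_le_mul h2 h1 (div_nonneg hGN.le (Real.Gamma_pos_of_pos (by positivity)).le)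
                    (by positivity)
              _ = _ := by ring
    | some j =>
      have e := hρ' 0 (Pi.single j n)
      calc _ = ∫⁻ z, ENNReal.ofReal (z.1 ^ 0 * ∏ i, z.2 i ^ (Pi.single j n : Fin (m + 1) → ℕ) i)
              ∂ρ := by
            refine lintegral_congr_ae ?_
            filter_upwards [hρ] with z hz
            rw [Finset.prod_eq_single j (fun i _ hi => by simp [hi]) (by simp)]
            simp [coordinate, abs_of_nonneg (hz.2 j)]
        _ ≤ _ := by
            rw [e]
            refine ENNReal.ofReal_le_ofReal ?_
            have h1 := hq (α * n) (by positivity)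
            have hbj : b j ≤ ∑ i, b i := Finset.single_le_sum (fun i _ => (hb i).le)
              (Finset.mem_univ j)
            have h2 : rising (b j) n ≤ Rr ^ n * n.factorial := (rising_le (hb j).le n).trans (by
              have := hb j
              gcongr; linarith)
            rw [jointMoment, Finset.prod_eq_single j (fun i _ hi => by simp [hi]) (by simp),
              Finset.sum_pi_single']
            simp only [Pi.single_eq_same, rising_zero, Nat.cast_zero, add_zero, one_mul,
              Finset.mem_univ, if_true]
            calc _ ≤ (Rr ^ n * n.factorial) * (2 * Real.Gamma (a + θ)) :=
                  mul_le_mul h2 h1 (div_nonneg hGN.le (Real.Gamma_pos_of_pos (by positivity)).le)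
                    (by positivity)
              _ = _ := by ring
  have hcoord : ∀ (r : Option (Fin (m + 1)) → ℕ) (z : ℝ × (Fin (m + 1) → ℝ)),
      ∏ j, coordinate m j z ^ r j = z.1 ^ r none * ∏ i, z.2 i ^ r (some i) := fun r z => by
    rw [Fintype.prod_option]; rfl
  have hint : ∀ ρ : Measure (ℝ × (Fin (m + 1) → ℝ)), (∀ᵐ z ∂ρ, 0 ≤ z.1 ∧ ∀ i, 0 ≤ z.2 i) →
      (∀ p r, ∫⁻ z, ENNReal.ofReal (z.1 ^ p * ∏ i, z.2 i ^ r i) ∂ρ =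
        ENNReal.ofReal (jointMoment α a (a + θ) b p r)) → ∀ r : Option (Fin (m + 1)) → ℕ,
      ∫ z, ∏ j, coordinate m j z ^ r j ∂ρ =
        jointMoment α a (a + θ) b (r none) fun i => r (some i) := fun ρ hρ hρ' r => by
    simp_rw [hcoord]
    rw [integral_eq_lintegral_of_nonneg_ae _ (by fun_prop), hρ', ENNReal.toReal_ofReal
      (jointMoment_nonneg hα0.le ha.le (fun i => (hb i).le) (by linarith) _ _)]
    filter_upwards [hρ] with z hz
    exact mul_nonneg (pow_nonneg hz.1 _) (Finset.prod_nonneg fun i _ => pow_nonneg (hz.2 i) _)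
  have hspan : ∀ L : (ℝ × (Fin (m + 1) → ℝ)) →L[ℝ] ℝ, ∃ p : Option (Fin (m + 1)) → ℝ,
      ∀ z, L z = ∑ j, p j * coordinate m j z := fun L => by
    refine ⟨fun j => j.elim (L (1, 0)) fun i => L (0, Pi.single i 1), fun z => ?_⟩
    have hz : z = z.1 • ((1 : ℝ), (0 : Fin (m + 1) → ℝ)) +
        ∑ i, z.2 i • ((0 : ℝ), (Pi.single i 1 : Fin (m + 1) → ℝ)) := by
      refine Prod.ext ?_ ?_
      · simp [Prod.fst_sum]
      · ext j
        simp [Prod.snd_sum, Finset.sum_apply, Pi.single_apply]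
    conv_lhs => rw [hz, map_add, map_sum]
    simp_rw [map_smul, smul_eq_mul]
    rw [Fintype.sum_option]
    simp only [Option.elim, coordinate]
    simp [mul_comm]
  have heq : μ = ν := measure_ext_of_joint_moments μ ν hspan (C := 2 * Real.Gamma (a + θ))
    (R := Rr) (by positivity) (by positivity) (hbound μ hpos hμ) (hbound ν hνpos hν')
    fun r => by rw [hint μ hpos hμ, hint ν hνpos hν']
  rw [heq, hν, Measure.map_map hΨm hΦm]
  conv_rhs => rw [← Measure.map_id (μ := productLaw α a θ g b)]
  refine Measure.map_congr ?_
  filter_upwards [hae] with z hz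
  have hz1 : 0 < 1 - z.1 := by linarith [hz.1.2]
  have hz2 := hz.2.1
  have hz3 : ((1 - z.1) ^ α) ≠ 0 := by positivity
  have hsum : ∑ i, (1 - z.1) ^ α * z.2.1 * z.2.2 i = (1 - z.1) ^ α * z.2.1 := by
    rw [← Finset.mul_sum, hz.2.2.2, mul_one]
  simp only [Function.comp_apply, hΦ, hΨ, hsum, id]
  refine Prod.ext rfl (Prod.ext ?_ (funext fun i => ?_))
  · simp only; field_simp
  · simp only; field_simp

end

end AlphaGamma

namespace AlphaGamma

/-! ### Laminar families -/

/-- The family `t` encodes a tree with leaves `1, …, n`. -/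
structure IsTree (n : ℕ) (t : LTree) : Prop where
  top_mem : Finset.Icc 1 n ∈ t
  singleton_mem : ∀ i ∈ Finset.Icc 1 n, {i} ∈ t
  nonempty : ∀ A ∈ t, A.Nonempty
  subset : ∀ A ∈ t, A ⊆ Finset.Icc 1 n
  laminar : ∀ A ∈ t, ∀ B ∈ t, A ⊆ B ∨ B ⊆ A ∨ Disjoint A B

lemma mem_children {t : LTree} {A C : Finset ℕ} : C ∈ children t A ↔
    C ∈ t ∧ C ⊂ A ∧ ∀ D ∈ t, C ⊆ D → D ⊆ A → D = C ∨ D = A := by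
  simp [children]

lemma mem_branchPoints {t : LTree} {A : Finset ℕ} :
    A ∈ branchPoints t ↔ A ∈ t ∧ 2 ≤ A.card := by
  simp [branchPoints]

/-- Take a vertex of largest cardinality among those that include `C` and are strictly below `A`. -/
lemma exists_child {t : LTree} {A C : Finset ℕ} (hC : C ∈ t) (hCA : C ⊂ A) :
    ∃ D ∈ children t A, C ⊆ D := by
  have hne : (t.filter fun D => C ⊆ D ∧ D ⊂ A).Nonempty := ⟨C, by simp [hC, hCA]⟩
  obtain ⟨D, hD, hmax⟩ := Finset.exists_max_image _ Finset.card hne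
  rw [Finset.mem_filter] at hD
  refine ⟨D, mem_children.2 ⟨hD.1, hD.2.2, fun E hE hDE hEA => ?_⟩, hD.2.1⟩
  by_cases h : E = A
  · exact Or.inr h
  · have := hmax E (by simp [hE, hD.2.1.trans hDE, hEA.ssubset_of_ne h])
    exact Or.inl (Finset.eq_of_subset_of_card_le hDE this).symm

namespace IsTree

variable {n : ℕ} {t : LTree}

lemma comparable (ht : IsTree n t) {A B : Finset ℕ} (hA : A ∈ t) (hB : B ∈ t) {x : ℕ} (hxA : x ∈ A) (hxB : x ∈ B) :
    A ⊆ B ∨ B ⊆ A := by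
  rcases ht.laminar A hA B hB with h | h | h
  · exact Or.inl h
  · exact Or.inr h
  · exact absurd hxB (Finset.disjoint_left.1 h hxA)

lemma child_unique (ht : IsTree n t) {A D E : Finset ℕ} (hD : D ∈ children t A) (hE : E ∈ children t A) {x : ℕ}
    (hxD : x ∈ D) (hxE : x ∈ E) : D = E := by
  rw [mem_children] at hD hE
  rcases ht.comparable hD.1 hE.1 hxD hxE with h | h
  · rcases hD.2.2 E hE.1 h hE.2.1.subset with h' | h'
    · exact h'.symm
    · exact absurd h' hE.2.1.ne
  · rcases hE.2.2 D hD.1 h hD.2.1.subset with h' | h'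
    · exact h'
    · exact absurd h' hD.2.1.ne

lemma disjoint_children (ht : IsTree n t) {A D E : Finset ℕ} (hD : D ∈ children t A) (hE : E ∈ children t A)
    (hne : D ≠ E) : Disjoint D E :=
  Finset.disjoint_left.2 fun _ hx hx' => hne (ht.child_unique hD hE hx hx')

/-- All vertices with the property contain `x`, so by laminarity they form a chain, and one of least
cardinality is included in the others. -/
lemma exists_least (ht : IsTree n t) {P : Finset ℕ → Prop} (hP : ∃ A ∈ t, P A) {x : ℕ} (hx : ∀ A ∈ t, P A → x ∈ A) :
    ∃ M ∈ t, P M ∧ ∀ A ∈ t, P A → M ⊆ A := by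
  classical
  obtain ⟨A, hA, hPA⟩ := hP
  obtain ⟨M, hM, hmin⟩ := Finset.exists_min_image (t.filter P) Finset.card ⟨A, by simp [hA, hPA]⟩
  rw [Finset.mem_filter] at hM
  refine ⟨M, hM.1, hM.2, fun B hB hPB => ?_⟩
  rcases ht.comparable hM.1 hB (hx M hM.1 hM.2) (hx B hB hPB) with h | h
  · exact h
  · exact (Finset.eq_of_subset_of_card_le h (hmin B (by simp [hB, hPB]))).symm.subset

/-- The sets `vertexOver` and `attachVertex` are defined as intersections; this identifies them with
least vertices. -/
lemma filter_sup_eq {P : Finset ℕ → Prop} {M : Finset ℕ} (hM : M ∈ t) (hPM : P M)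
    (hmin : ∀ A ∈ t, P A → M ⊆ A) [DecidablePred fun i => ∀ A ∈ t, P A → i ∈ A] :
    ((t.sup id).filter fun i => ∀ A ∈ t, P A → i ∈ A) = M := by
  ext i
  rw [Finset.mem_filter]
  refine ⟨fun h => h.2 M hM hPM, fun h => ⟨?_, fun A hA hPA => hmin A hA hPA h⟩⟩
  exact Finset.mem_sup.2 ⟨M, hM, h⟩

lemma vertexOver_spec (ht : IsTree n t) {B : Finset ℕ} (hB : B.Nonempty) (hBn : B ⊆ Finset.Icc 1 n) :
    vertexOver t B ∈ t ∧ B ⊆ vertexOver t B ∧ ∀ A ∈ t, B ⊆ A → vertexOver t B ⊆ A := by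
  obtain ⟨x, hx⟩ := hB
  obtain ⟨M, hM, hPM, hmin⟩ := ht.exists_least (P := fun A => B ⊆ A) ⟨_, ht.top_mem, hBn⟩
    (x := x) fun A _ h => h hx
  have e : vertexOver t B = M := filter_sup_eq (P := fun A => B ⊆ A) hM hPM hmin
  rw [e]
  exact ⟨hM, hPM, hmin⟩

lemma attachVertex_spec (ht : IsTree n t) {k j : ℕ} (hk : 1 ≤ k) (hj : j ∈ Finset.Icc 1 n) :
    attachVertex k t j ∈ t ∧
      (j ∈ attachVertex k t j ∧ (attachVertex k t j ∩ Finset.Icc 1 k).Nonempty) ∧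
      ∀ A ∈ t, j ∈ A → (A ∩ Finset.Icc 1 k).Nonempty → attachVertex k t j ⊆ A := by
  have hn : 1 ≤ n := by rw [Finset.mem_Icc] at hj; omega
  obtain ⟨M, hM, hPM, hmin⟩ := ht.exists_least
    (P := fun A => j ∈ A ∧ (A ∩ Finset.Icc 1 k).Nonempty)
    ⟨_, ht.top_mem, hj, ⟨1, by simp [hk, hn]⟩⟩ (x := j) fun A _ h => h.1
  have e : attachVertex k t j = M := by
    rw [← filter_sup_eq (P := fun A => j ∈ A ∧ (A ∩ Finset.Icc 1 k).Nonempty) hM hPM hmin]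
    simp only [attachVertex, and_imp]
  rw [e]
  exact ⟨hM, hPM, fun A hA h1 h2 => hmin A hA ⟨h1, h2⟩⟩

end IsTree

/-! ### Weights of subtrees -/

/-- The weight of the edge below `A`, together with the weight of `A` if it is a branch point. -/
noncomputable def posWeight (α γ : ℝ) (t : LTree) (A : Finset ℕ) : ℝ :=
  edgeWeight α γ A + if 2 ≤ A.card then vertexWeight α γ t A else 0

lemma sum_posWeight (α γ : ℝ) (t S : LTree) :
    ∑ A ∈ S, posWeight α γ t A =
      ∑ A ∈ S, edgeWeight α γ A + ∑ A ∈ branchPoints S, vertexWeight α γ t A := by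
  simp only [posWeight, Finset.sum_add_distrib, branchPoints, Finset.sum_filter]

namespace IsTree

variable {n : ℕ} {t : LTree}

lemma biUnion_children (ht : IsTree n t) {A : Finset ℕ} (hA : A ∈ t) (h2 : 2 ≤ A.card) :
    (children t A).biUnion id = A := by
  ext i
  simp only [Finset.mem_biUnion, id]
  constructor
  · rintro ⟨D, hD, hi⟩
    exact (mem_children.1 hD).2.1.subset hi
  · intro hi
    have hss : {i} ⊂ A := by
      refine (Finset.singleton_subset_iff.2 hi).ssubset_of_ne ?_
      rintro rfl
      simp at h2
    obtain ⟨D, hD, hiD⟩ := exists_child (ht.singleton_mem i (ht.subset A hA hi)) hss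
    exact ⟨D, hD, Finset.singleton_subset_iff.1 hiD⟩

lemma sum_card_children (ht : IsTree n t) {A : Finset ℕ} (hA : A ∈ t) (h2 : 2 ≤ A.card) :
    ∑ D ∈ children t A, D.card = A.card := by
  conv_rhs => rw [← ht.biUnion_children hA h2]
  exact (Finset.card_biUnion fun D hD E hE hne => ht.disjoint_children hD hE hne).symm

/-- The children partition `A` and each is a proper subset, so one child or none cannot cover it. -/
lemma two_le_card_children (ht : IsTree n t) {A : Finset ℕ} (hA : A ∈ t) (h2 : 2 ≤ A.card) :
    2 ≤ (children t A).card := by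
  by_contra hcon
  have hle : (children t A).card ≤ 1 := by omega
  have hs := ht.sum_card_children hA h2
  have hlt : ∀ D ∈ children t A, D.card < A.card := fun D hD =>
    Finset.card_lt_card (mem_children.1 hD).2.1
  rcases Finset.card_le_one_iff_subset_singleton.1 hle with ⟨D, hD⟩
  rcases Finset.subset_singleton_iff.1 hD with h | h
  · rw [h] at hs; simp at hs; omega
  · rw [h] at hs; simp at hs
    have := hlt D (by simp [h])
    omega

lemma pairwiseDisjoint_subtrees (ht : IsTree n t) (A : Finset ℕ) (S : Finset (Finset ℕ)) (hS : S ⊆ children t A) :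
    (S : Set (Finset ℕ)).PairwiseDisjoint fun D => t.filter fun C => C ⊆ D := by
  intro D hD E hE hne
  rw [Function.onFun, Finset.disjoint_left]
  intro C hC hC'
  rw [Finset.mem_filter] at hC hC'
  obtain ⟨x, hx⟩ := ht.nonempty C hC.1
  exact hne (ht.child_unique (hS hD) (hS hE) (hC.2 hx) (hC'.2 hx))

/-- Induction on the size. At a branch point with `c` children, the edge and vertex weights `γ + (c
- 1) * α - γ` turn the sum of the terms `D.card - α` into `A.card - α`; a leaf contributes `1 - α`.
-/
lemma sum_posWeight_subtree (ht : IsTree n t) (α γ : ℝ) {A : Finset ℕ} (hA : A ∈ t) :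
    ∑ C ∈ t.filter (fun C => C ⊆ A), posWeight α γ t C = A.card - α := by
  induction hc : A.card using Nat.strong_induction_on generalizing A with
  | _ m ih =>
    have hpos := (ht.nonempty A hA).card_pos
    by_cases h2 : 2 ≤ A.card
    · have e : t.filter (fun C => C ⊆ A) =
          insert A ((children t A).biUnion fun D => t.filter fun C => C ⊆ D) := by
        ext C
        simp only [Finset.mem_filter, Finset.mem_insert, Finset.mem_biUnion]
        constructor
        · rintro ⟨hC, hCA⟩
          rcases eq_or_ne C A with h | h
          · exact Or.inl h
          · obtain ⟨D, hD, hCD⟩ := exists_child hC (hCA.ssubset_of_ne h)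
            exact Or.inr ⟨D, hD, hC, hCD⟩
        · rintro (rfl | ⟨D, hD, hC, hCD⟩)
          · exact ⟨hA, subset_rfl⟩
          · exact ⟨hC, hCD.trans (mem_children.1 hD).2.1.subset⟩
      have hnot : A ∉ (children t A).biUnion fun D => t.filter fun C => C ⊆ D := by
        simp only [Finset.mem_biUnion, Finset.mem_filter, not_exists, not_and]
        intro D hD _ hAD
        exact (mem_children.1 hD).2.1.2 hAD
      rw [e, Finset.sum_insert hnot,
        Finset.sum_biUnion (ht.pairwiseDisjoint_subtrees A _ subset_rfl)]
      have h3 : ∀ D ∈ children t A, ∑ C ∈ t.filter (fun C => C ⊆ D), posWeight α γ t C =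
          (D.card : ℝ) - α := fun D hD =>
        ih D.card (hc ▸ Finset.card_lt_card (mem_children.1 hD).2.1) (mem_children.1 hD).1 rfl
      rw [Finset.sum_congr rfl h3, Finset.sum_sub_distrib, ← Nat.cast_sum,
        ht.sum_card_children hA h2, posWeight, edgeWeight, if_neg (by omega), if_pos h2,
        vertexWeight, Finset.sum_const, nsmul_eq_mul, hc]
      ring
    · have h1 : A.card = 1 := by omega
      have e : t.filter (fun C => C ⊆ A) = {A} := by
        ext C
        simp only [Finset.mem_filter, Finset.mem_singleton]
        constructor
        · rintro ⟨hC, hCA⟩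
          have := (ht.nonempty C hC).card_pos
          exact Finset.eq_of_subset_of_card_le hCA (by omega)
        · rintro rfl
          exact ⟨hA, subset_rfl⟩
      rw [e, Finset.sum_singleton, posWeight, edgeWeight, if_pos h1, if_neg h2, ← hc, h1]
      simp

lemma totalWeight_eq (ht : IsTree n t) (α γ : ℝ) : totalWeight α γ t = n - α := by
  have h := ht.sum_posWeight_subtree α γ ht.top_mem
  rw [Finset.filter_true_of_mem ht.subset, sum_posWeight, Nat.card_Icc] at h
  simpa [totalWeight] using h

lemma card_eq_one_iff (ht : IsTree n t) {A : Finset ℕ} (hA : A ∈ t) : A.card = 1 ↔ ¬ 2 ≤ A.card := by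
  have := (ht.nonempty A hA).card_pos
  omega

lemma card_filter_singletons (ht : IsTree n t) : (t.filter fun A => ¬ 2 ≤ A.card).card = n := by
  have e : t.filter (fun A => ¬ 2 ≤ A.card) = (Finset.Icc 1 n).image fun i => {i} := by
    ext A
    simp only [Finset.mem_filter, Finset.mem_image]
    constructor
    · rintro ⟨hA, h⟩
      obtain ⟨i, rfl⟩ := Finset.card_eq_one.1 ((ht.card_eq_one_iff hA).2 h)
      exact ⟨i, ht.subset _ hA (by simp), rfl⟩
    · rintro ⟨i, hi, rfl⟩
      exact ⟨ht.singleton_mem i hi, by simp⟩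
  rw [e, Finset.card_image_of_injective _ Finset.singleton_injective]
  simp

lemma sum_edgeWeight (ht : IsTree n t) (α γ : ℝ) :
    ∑ A ∈ t, edgeWeight α γ A = n * (1 - α) + (branchPoints t).card * γ := by
  have h1 : ∑ A ∈ t, edgeWeight α γ A =
      ∑ A ∈ t, if 2 ≤ A.card then γ else 1 - α := by
    refine Finset.sum_congr rfl fun A hA => ?_
    rw [edgeWeight]
    by_cases h : 2 ≤ A.card
    · rw [if_pos h, if_neg (by omega)]
    · rw [if_neg h, if_pos ((ht.card_eq_one_iff hA).2 h)]
  rw [h1, Finset.sum_ite, Finset.sum_const, Finset.sum_const, ht.card_filter_singletons]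
  simp only [nsmul_eq_mul, branchPoints]
  ring

/-- The total weight minus the edge weights. This is the parameter `(k - 1) * α - ℓ * γ` of the
theorem, and it vanishes for binary trees when `γ = α`. -/
lemma sum_vertexWeight (ht : IsTree n t) (α γ : ℝ) :
    ∑ A ∈ branchPoints t, vertexWeight α γ t A = (n - 1) * α - (branchPoints t).card * γ := by
  have h1 := ht.totalWeight_eq α γ
  rw [totalWeight, ht.sum_edgeWeight] at h1
  linarith

end IsTree

end AlphaGamma

namespace AlphaGamma

/-! ### Restriction to the first leaves -/

/-- `s` is the tree spanned by the root and the leaves `1, …, k` of `t`. -/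
def Restricts (k : ℕ) (s t : LTree) : Prop :=
  ∀ B, B ∈ s ↔ B.Nonempty ∧ ∃ A ∈ t, A ∩ Finset.Icc 1 k = B

/-- `A` and `B` are below the same vertices of the subtree of `t` spanned by the root and the
leaves `1, …, k`. -/
def InClass (k : ℕ) (t : LTree) (B A : Finset ℕ) : Prop :=
  ∀ D ∈ t, (D ∩ Finset.Icc 1 k).Nonempty → (A ⊆ D ↔ B ⊆ D)

lemma IsTree.restricts_self {n : ℕ} {t : LTree} (ht : IsTree n t) : Restricts n t t := fun B => by
  constructor
  · exact fun hB => ⟨ht.nonempty B hB, B, hB, Finset.inter_eq_left.2 (ht.subset B hB)⟩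
  · rintro ⟨-, A, hA, rfl⟩
    rwa [Finset.inter_eq_left.2 (ht.subset A hA)]

lemma Restricts.mem {k : ℕ} {s t : LTree} (h : Restricts k s t) {A : Finset ℕ} (hA : A ∈ t)
    (hne : (A ∩ Finset.Icc 1 k).Nonempty) : A ∩ Finset.Icc 1 k ∈ s :=
  (h _).2 ⟨hne, A, hA, rfl⟩

lemma inter_Icc_inter_Icc {k n : ℕ} (hkn : k ≤ n) (A : Finset ℕ) :
    A ∩ Finset.Icc 1 n ∩ Finset.Icc 1 k = A ∩ Finset.Icc 1 k := by
  rw [Finset.inter_assoc, Finset.inter_eq_right.2 (Finset.Icc_subset_Icc_right hkn)]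

lemma Restricts.trans {k n : ℕ} {s t u : LTree} (hkn : k ≤ n) (h1 : Restricts k s t)
    (h2 : Restricts n t u) : Restricts k s u := fun B => by
  constructor
  · intro hB
    obtain ⟨hne, A, hA, rfl⟩ := (h1 B).1 hB
    obtain ⟨-, A', hA', rfl⟩ := (h2 A).1 hA
    exact ⟨hne, A', hA', (inter_Icc_inter_Icc hkn A').symm⟩
  · rintro ⟨hne, A, hA, rfl⟩
    have hne' : (A ∩ Finset.Icc 1 n).Nonempty :=
      hne.mono (Finset.inter_subset_inter_left (Finset.Icc_subset_Icc_right hkn))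
    rw [← inter_Icc_inter_Icc hkn] at hne ⊢
    exact h1.mem (h2.mem hA hne') hne

section

variable {k n : ℕ} {s t : LTree} {B : Finset ℕ}

lemma subset_inter_Icc_iff {m : ℕ} {A D : Finset ℕ} (hA : A ⊆ Finset.Icc 1 m) :
    A ⊆ D ∩ Finset.Icc 1 m ↔ A ⊆ D := by
  rw [Finset.subset_inter_iff, and_iff_left hA]

lemma inter_nonempty_of_subset {D : Finset ℕ} (hB : B.Nonempty) (hBk : B ⊆ Finset.Icc 1 k)
    (hBD : B ⊆ D) : (D ∩ Finset.Icc 1 k).Nonempty :=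
  hB.mono (Finset.subset_inter hBD hBk)

/-- Membership in a class depends on the spanned subtree only. -/
lemma Restricts.inClass_iff {u : LTree} (hkn : k ≤ n) (h : Restricts n t u)
    (hBk : B ⊆ Finset.Icc 1 k) {A : Finset ℕ} (hA : A ⊆ Finset.Icc 1 n) :
    InClass k u B A ↔ InClass k t B A := by
  have hBn : B ⊆ Finset.Icc 1 n := hBk.trans (Finset.Icc_subset_Icc_right hkn)
  constructor
  · intro hc D hD hne
    obtain ⟨-, D', hD', rfl⟩ := (h D).1 hD
    rw [subset_inter_Icc_iff hA, subset_inter_Icc_iff hBn]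
    rw [inter_Icc_inter_Icc hkn] at hne
    exact hc D' hD' hne
  · intro hc D hD hne
    have hne' : (D ∩ Finset.Icc 1 n).Nonempty :=
      hne.mono (Finset.inter_subset_inter_left (Finset.Icc_subset_Icc_right hkn))
    rw [← subset_inter_Icc_iff hA, ← subset_inter_Icc_iff hBn]
    rw [← inter_Icc_inter_Icc hkn] at hne
    exact hc _ (h.mem hD hne') hne

lemma Restricts.vertexOver_inter (ht : IsTree n t) (hkn : k ≤ n) (h : Restricts k s t)
    (hB : B ∈ s) : vertexOver t B ∩ Finset.Icc 1 k = B := by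
  obtain ⟨hne, A, hA, rfl⟩ := (h B).1 hB
  have hv := ht.vertexOver_spec hne (Finset.inter_subset_right.trans
    (Finset.Icc_subset_Icc_right hkn))
  refine Finset.Subset.antisymm ?_ (Finset.subset_inter hv.2.1 Finset.inter_subset_right)
  exact Finset.inter_subset_inter_right (hv.2.2 A hA Finset.inter_subset_left)

/-- The classes of distinct vertices are disjoint. -/
lemma Restricts.inClass_unique (ht : IsTree n t) (hkn : k ≤ n) (hs : IsTree k s)
    (h : Restricts k s t) {B' A : Finset ℕ} (hB : B ∈ s) (hB' : B' ∈ s) (hA : InClass k t B A)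
    (hA' : InClass k t B' A) : B = B' := by
  have hsub : ∀ C ∈ s, C ⊆ Finset.Icc 1 n := fun C hC =>
    (hs.subset C hC).trans (Finset.Icc_subset_Icc_right hkn)
  have key : ∀ C ∈ s, ∀ C' ∈ s, InClass k t C A → InClass k t C' A →
      vertexOver t C ⊆ vertexOver t C' := fun C hC C' hC' hc hc' => by
    have hv := ht.vertexOver_spec (hs.nonempty C hC) (hsub C hC)
    have hv' := ht.vertexOver_spec (hs.nonempty C' hC') (hsub C' hC')
    refine hv.2.2 _ hv'.1 ?_
    have hne := inter_nonempty_of_subset (hs.nonempty C' hC') (hs.subset C' hC') hv'.2.1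
    exact (hc _ hv'.1 hne).1 ((hc' _ hv'.1 hne).2 hv'.2.1)
  rw [← h.vertexOver_inter ht hkn hB, ← h.vertexOver_inter ht hkn hB',
    (key B hB B' hB' hA hA').antisymm (key B' hB' B hB hA' hA)]

/-- Both sides name least vertices of the spanned subtree, so they coincide exactly when the same
vertices of that subtree lie above `j` and above `B`. The relation `InClass` is easier to follow
through growth than the vertices themselves. -/
lemma attachVertex_eq_vertexOver_iff (ht : IsTree n t) (hk : 1 ≤ k) (hkn : k ≤ n)
    (hB : B.Nonempty) (hBk : B ⊆ Finset.Icc 1 k) {j : ℕ} (hj : j ∈ Finset.Icc 1 n) :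
    attachVertex k t j = vertexOver t B ↔ InClass k t B {j} := by
  have hv := ht.vertexOver_spec hB (hBk.trans (Finset.Icc_subset_Icc_right hkn))
  have ha := ht.attachVertex_spec hk hj
  constructor
  · intro h D hD hne
    rw [Finset.singleton_subset_iff]
    constructor
    · intro hjD
      exact hv.2.1.trans (h ▸ ha.2.2 D hD hjD hne)
    · intro hBD
      exact hv.2.2 D hD hBD (h ▸ ha.2.1.1)
  · intro h
    refine Finset.Subset.antisymm ?_ ?_
    · have hne := inter_nonempty_of_subset hB hBk hv.2.1
      exact ha.2.2 _ hv.1 (Finset.singleton_subset_iff.1 ((h _ hv.1 hne).2 hv.2.1)) hne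
    · exact hv.2.2 _ ha.1 ((h _ ha.1 ha.2.1.2).1 (Finset.singleton_subset_iff.2 ha.2.1.1))

/-- The children of a vertex of the spanned subtree that belong to this subtree. -/
lemma Restricts.card_children (ht : IsTree n t) (hs : IsTree k s) (hkn : k ≤ n)
    (h : Restricts k s t) (hB : B ∈ s) :
    ((children t (vertexOver t B)).filter fun C => (C ∩ Finset.Icc 1 k).Nonempty).card =
      (children s B).card := by
  have hBne := hs.nonempty B hB
  have hBk := hs.subset B hB
  have hv := ht.vertexOver_spec hBne (hBk.trans (Finset.Icc_subset_Icc_right hkn))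
  have hvi := h.vertexOver_inter ht hkn hB
  refine Finset.card_bij (fun C _ => C ∩ Finset.Icc 1 k) ?_ ?_ ?_
  · intro C hC
    rw [Finset.mem_filter, mem_children] at hC
    obtain ⟨⟨hCt, hCv, hCmax⟩, hne⟩ := hC
    refine mem_children.2 ⟨h.mem hCt hne, ?_, ?_⟩
    · refine Finset.ssubset_iff_subset_ne.2 ⟨?_, fun heq => ?_⟩
      · rw [← hvi]; exact Finset.inter_subset_inter_right hCv.subset
      -- A child cannot have the full trace `B`, because the vertex over `B` is the least one
      -- including `B`.
      · exact hCv.2 (hv.2.2 C hCt (heq ▸ Finset.inter_subset_left))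
    · intro E hE hCE hEB
      obtain ⟨-, E', hE', rfl⟩ := (h E).1 hE
      obtain ⟨x, hx⟩ := hne
      have hxC := Finset.mem_of_mem_inter_left hx
      have hxE := Finset.mem_of_mem_inter_left (hCE hx)
      by_cases hEv : B ⊆ E'
      · right
        exact hEB.antisymm (Finset.subset_inter hEv hBk)
      · left
        rcases ht.comparable hE' hCt hxE hxC with h1 | h1
        · exact (Finset.inter_subset_inter_right h1).antisymm hCE
        · rcases ht.comparable hE' hv.1 hxE (hCv.subset hxC) with h2 | h2
          · rcases hCmax E' hE' h1 h2 with h3 | h3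
            · rw [h3]
            · exact absurd (h3 ▸ hv.2.1) hEv
          · exact absurd (hv.2.1.trans h2) hEv
  · intro C hC C' hC' heq
    simp only [Finset.mem_filter] at hC hC'
    obtain ⟨x, hx⟩ := hC.2
    exact ht.child_unique hC.1 hC'.1 (Finset.mem_of_mem_inter_left hx)
      (Finset.mem_of_mem_inter_left ((Finset.ext_iff.1 heq x).1 hx))
  · intro E hE
    rw [mem_children] at hE
    obtain ⟨hEs, hEB, hEmax⟩ := hE
    obtain ⟨hEne, E', hE', hEE⟩ := (h E).1 hEs
    have hEE' : E ⊆ E' := hEE ▸ Finset.inter_subset_left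
    obtain ⟨x, hx⟩ := hEne
    have hE'v : E' ⊂ vertexOver t B := by
      have hnot : ¬ vertexOver t B ⊆ E' := fun hcon => by
        have : B ⊆ E := by
          rw [← hEE]; exact Finset.subset_inter (hv.2.1.trans hcon) hBk
        exact hEB.2 this
      rcases ht.comparable hE' hv.1 (hEE' hx) (hv.2.1 (hEB.subset hx)) with h1 | h1
      · exact ⟨h1, hnot⟩
      · exact absurd h1 hnot
    obtain ⟨C, hC, hEC⟩ := exists_child hE' hE'v
    have hC' := mem_children.1 hC
    have hsub : E ⊆ C ∩ Finset.Icc 1 k := by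
      rw [← hEE]; exact Finset.inter_subset_inter_right hEC
    have hne : (C ∩ Finset.Icc 1 k).Nonempty := ⟨x, hsub hx⟩
    refine ⟨C, Finset.mem_filter.2 ⟨hC, hne⟩, ?_⟩
    rcases hEmax _ (h.mem hC'.1 hne) hsub (by
      rw [← hvi]; exact Finset.inter_subset_inter_right hC'.2.1.subset) with h1 | h1
    · exact h1
    · exact absurd (hv.2.2 C hC'.1 (h1 ▸ Finset.inter_subset_left)) hC'.2.1.2

/-! ### Weights of classes -/

/-- The vertices off the spanned subtree whose class is that of `B`. -/
lemma mem_class_iff (ht : IsTree n t) (hkn : k ≤ n) (hB : B.Nonempty)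
    (hBk : B ⊆ Finset.Icc 1 k) {A : Finset ℕ} (hA : A ∈ t) :
    (¬ (A ∩ Finset.Icc 1 k).Nonempty ∧ InClass k t B A) ↔
      ∃ C ∈ children t (vertexOver t B), ¬ (C ∩ Finset.Icc 1 k).Nonempty ∧ A ⊆ C := by
  have hv := ht.vertexOver_spec hB (hBk.trans (Finset.Icc_subset_Icc_right hkn))
  have hvne := inter_nonempty_of_subset hB hBk hv.2.1
  obtain ⟨x, hx⟩ := ht.nonempty A hA
  constructor
  · rintro ⟨hne, hc⟩
    have hAv : A ⊂ vertexOver t B := by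
      refine ((hc _ hv.1 hvne).2 hv.2.1).ssubset_of_ne fun heq => ?_
      exact hne (heq ▸ hvne)
    obtain ⟨C, hC, hAC⟩ := exists_child hA hAv
    have hC' := mem_children.1 hC
    refine ⟨C, hC, fun hCne => ?_, hAC⟩
    exact hC'.2.1.2 (hv.2.2 C hC'.1 ((hc C hC'.1 hCne).1 hAC))
  · rintro ⟨C, hC, hCne, hAC⟩
    have hC' := mem_children.1 hC
    refine ⟨fun hne => hCne (hne.mono (Finset.inter_subset_inter_right hAC)), fun D hD hDne => ?_⟩
    constructor
    · intro hAD
      have hCD : C ⊆ D := by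
        rcases ht.comparable hC'.1 hD (hAC hx) (hAD hx) with h1 | h1
        · exact h1
        · exact absurd (hDne.mono (Finset.inter_subset_inter_right h1)) hCne
      rcases ht.comparable hD hv.1 (hAD hx) (hC'.2.1.subset (hAC hx)) with h1 | h1
      · rcases hC'.2.2 D hD hCD h1 with h2 | h2
        · exact absurd (h2 ▸ hDne) hCne
        · exact h2 ▸ hv.2.1
      · exact hv.2.1.trans h1
    · intro hBD
      exact hAC.trans (hC'.2.1.subset.trans (hv.2.2 D hD hBD))

open scoped Classical in
/-- The number of leaves in the class of `B`. -/
noncomputable def classLeafCount (k n : ℕ) (t : LTree) (B : Finset ℕ) : ℕ :=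
  ((Finset.Ioc k n).filter fun j => InClass k t B {j}).card

open scoped Classical in
lemma classLeafCount_eq (ht : IsTree n t) (hkn : k ≤ n) (hB : B.Nonempty)
    (hBk : B ⊆ Finset.Icc 1 k) : classLeafCount k n t B =
      ∑ C ∈ (children t (vertexOver t B)).filter (fun C => ¬ (C ∩ Finset.Icc 1 k).Nonempty),
        C.card := by
  rw [classLeafCount]
  refine Eq.trans ?_ (Finset.card_biUnion (t := fun C => C) fun C hC C' hC' hne =>
    ht.disjoint_children (Finset.mem_filter.1 hC).1 (Finset.mem_filter.1 hC').1 hne)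
  congr 1
  ext j
  simp only [Finset.mem_filter, Finset.mem_Ioc, Finset.mem_biUnion]
  constructor
  · rintro ⟨⟨h1, h2⟩, hc⟩
    obtain ⟨C, hC, hCne, hjC⟩ := (mem_class_iff ht hkn hB hBk
      (ht.singleton_mem j (Finset.mem_Icc.2 (by omega)))).1 ⟨by
        rintro ⟨x, hx⟩
        simp only [Finset.mem_inter, Finset.mem_singleton, Finset.mem_Icc] at hx
        omega, hc⟩
    exact ⟨C, ⟨hC, hCne⟩, Finset.singleton_subset_iff.1 hjC⟩
  · rintro ⟨C, ⟨hC, hCne⟩, hjC⟩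
    have hj := ht.subset C (mem_children.1 hC).1 hjC
    have h := (mem_class_iff ht hkn hB hBk (ht.singleton_mem j hj)).2
      ⟨C, hC, hCne, Finset.singleton_subset_iff.2 hjC⟩
    refine ⟨?_, h.2⟩
    rw [Finset.mem_Icc] at hj
    refine ⟨?_, hj.2⟩
    by_contra hcon
    exact hCne ⟨j, by simp [hjC]; omega⟩

open scoped Classical in
-- The class off the spanned subtree is the disjoint union of the full subtrees at those children of
-- the vertex over `B` that miss the first `k` labels. Each weighs its number of leaves minus `α`,
-- and there are as many as the children gained since `s`.
lemma sum_posWeight_class (α γ : ℝ) (ht : IsTree n t) (hs : IsTree k s) (hkn : k ≤ n)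
    (h : Restricts k s t) (hB : B ∈ s) :
    ∑ A ∈ t.filter (fun A => ¬ (A ∩ Finset.Icc 1 k).Nonempty ∧ InClass k t B A),
      posWeight α γ t A =
      classLeafCount k n t B -
        (((children t (vertexOver t B)).card : ℝ) - (children s B).card) * α := by
  have hBne := hs.nonempty B hB
  have hBk := hs.subset B hB
  set S := (children t (vertexOver t B)).filter fun C => ¬ (C ∩ Finset.Icc 1 k).Nonempty with hS
  have e : t.filter (fun A => ¬ (A ∩ Finset.Icc 1 k).Nonempty ∧ InClass k t B A) =
      S.biUnion fun C => t.filter fun A => A ⊆ C := by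
    ext A
    simp only [Finset.mem_filter, Finset.mem_biUnion, hS]
    constructor
    · rintro ⟨hA, hc⟩
      obtain ⟨C, hC, hCne, hAC⟩ := (mem_class_iff ht hkn hBne hBk hA).1 hc
      exact ⟨C, ⟨hC, hCne⟩, hA, hAC⟩
    · rintro ⟨C, ⟨hC, hCne⟩, hA, hAC⟩
      exact ⟨hA, (mem_class_iff ht hkn hBne hBk hA).2 ⟨C, hC, hCne, hAC⟩⟩
  rw [e, Finset.sum_biUnion (ht.pairwiseDisjoint_subtrees _ S (Finset.filter_subset _ _)),
    Finset.sum_congr rfl fun C hC => ht.sum_posWeight_subtree α γ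
      (mem_children.1 (Finset.mem_filter.1 hC).1).1, Finset.sum_sub_distrib, Finset.sum_const,
    classLeafCount_eq ht hkn hBne hBk]
  have hcard := Finset.card_filter_add_card_filter_not (s := children t (vertexOver t B))
    fun C => (C ∩ Finset.Icc 1 k).Nonempty
  rw [h.card_children ht hs hkn hB] at hcard
  have hcard' : (S.card : ℝ) = (children t (vertexOver t B)).card - (children s B).card := by
    rw [← hcard]; push_cast; ring
  rw [nsmul_eq_mul, hcard']
  push_cast
  ring

lemma vertexOver_mem_branchPoints (ht : IsTree n t) (hs : IsTree k s) (hkn : k ≤ n)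
    (hB : B ∈ branchPoints s) : vertexOver t B ∈ branchPoints t := by
  rw [mem_branchPoints] at hB
  have hv := ht.vertexOver_spec (hs.nonempty B hB.1)
    ((hs.subset B hB.1).trans (Finset.Icc_subset_Icc_right hkn))
  exact mem_branchPoints.2 ⟨hv.1, hB.2.trans (Finset.card_le_card hv.2.1)⟩

lemma inClass_iff_eq_vertexOver (ht : IsTree n t) (hkn : k ≤ n) (hB : B.Nonempty)
    (hBk : B ⊆ Finset.Icc 1 k) {A : Finset ℕ} (hA : A ∈ t)
    (hAk : (A ∩ Finset.Icc 1 k).Nonempty) : InClass k t B A ↔ A = vertexOver t B := by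
  have hv := ht.vertexOver_spec hB (hBk.trans (Finset.Icc_subset_Icc_right hkn))
  have hvne := inter_nonempty_of_subset hB hBk hv.2.1
  constructor
  · intro hc
    exact ((hc _ hv.1 hvne).2 hv.2.1).antisymm (hv.2.2 A hA ((hc A hA hAk).1 subset_rfl))
  · rintro rfl D hD hne
    exact ⟨fun h => hv.2.1.trans h, fun h => hv.2.2 D hD h⟩

open scoped Classical in
/-- The total weight of the moves which attach the new leaf at the vertex over `B`. -/
lemma sum_class (α γ : ℝ) (ht : IsTree n t) (hs : IsTree k s) (hkn : k ≤ n)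
    (h : Restricts k s t) (hB : B ∈ branchPoints s) :
    (∑ A ∈ t, if InClass k t B A ∧ ¬ (A ∩ Finset.Icc 1 k).Nonempty then edgeWeight α γ A else 0) +
      (∑ A ∈ branchPoints t, if InClass k t B A then vertexWeight α γ t A else 0) =
      classLeafCount k n t B + vertexWeight α γ s B := by
  have hB' := mem_branchPoints.1 hB
  have hBne := hs.nonempty B hB'.1
  have hBk := hs.subset B hB'.1
  have hw := sum_posWeight_class α γ ht hs hkn h hB'.1
  rw [sum_posWeight] at hw
  have e1 : ∑ A ∈ t.filter (fun A => ¬ (A ∩ Finset.Icc 1 k).Nonempty ∧ InClass k t B A),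
      edgeWeight α γ A =
      ∑ A ∈ t, if InClass k t B A ∧ ¬ (A ∩ Finset.Icc 1 k).Nonempty then edgeWeight α γ A else 0 := by
    rw [Finset.sum_filter]
    exact Finset.sum_congr rfl fun A _ => by simp only [and_comm]
  -- The only vertex of the class that lies on the spanned subtree is the vertex over `B`.
  have e2 : ∑ A ∈ branchPoints t, (if InClass k t B A then vertexWeight α γ t A else 0) =
      ∑ A ∈ branchPoints (t.filter fun A => ¬ (A ∩ Finset.Icc 1 k).Nonempty ∧ InClass k t B A),
        vertexWeight α γ t A + vertexWeight α γ t (vertexOver t B) := by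
    rw [← Finset.sum_filter, add_comm]
    have hnot : vertexOver t B ∉
        branchPoints (t.filter fun A => ¬ (A ∩ Finset.Icc 1 k).Nonempty ∧ InClass k t B A) := by
      rw [mem_branchPoints, Finset.mem_filter]
      rintro ⟨⟨-, h1, -⟩, -⟩
      exact h1 (by rwa [h.vertexOver_inter ht hkn hB'.1])
    rw [← Finset.sum_insert hnot]
    refine Finset.sum_congr ?_ fun _ _ => rfl
    ext A
    simp only [Finset.mem_filter, mem_branchPoints, Finset.mem_insert]
    constructor
    · rintro ⟨⟨hA, h2⟩, hc⟩
      by_cases hAk : (A ∩ Finset.Icc 1 k).Nonempty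
      · exact Or.inl ((inClass_iff_eq_vertexOver ht hkn hBne hBk hA hAk).1 hc)
      · exact Or.inr ⟨⟨hA, hAk, hc⟩, h2⟩
    · rintro (rfl | ⟨⟨hA, hAk, hc⟩, h2⟩)
      · have hv := mem_branchPoints.1 (vertexOver_mem_branchPoints ht hs hkn hB)
        refine ⟨hv, (inClass_iff_eq_vertexOver ht hkn hBne hBk hv.1 ?_).2 rfl⟩
        rwa [h.vertexOver_inter ht hkn hB'.1]
      · exact ⟨⟨hA, h2⟩, hc⟩
  -- Each child gained costs `α` in the subtrees and adds `α` to the weight of the vertex, so only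
  -- the initial weight of `B` and the leaf count remain.
  rw [← e1, e2, ← add_assoc, hw, vertexWeight, vertexWeight]
  ring

/-- Every later leaf is attached at an edge or belongs to the class of exactly one branch point, as
classes of distinct branch points are disjoint. -/
lemma edgeLeafCount_eq (ht : IsTree n t) (hs : IsTree k s) (hk : 1 ≤ k) (hkn : k ≤ n)
    (h : Restricts k s t) :
    edgeLeafCount k n s t + ∑ B ∈ branchPoints s, classLeafCount k n t B = n - k := by
  classical
  have hiff : ∀ j ∈ Finset.Ioc k n, ∀ B ∈ branchPoints s,
      attachVertex k t j = vertexOver t B ↔ InClass k t B {j} := fun j hj B hB => by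
    rw [mem_branchPoints] at hB
    rw [Finset.mem_Ioc] at hj
    exact attachVertex_eq_vertexOver_iff ht hk hkn (hs.nonempty B hB.1) (hs.subset B hB.1)
      (Finset.mem_Icc.2 (by omega))
  have h1 : ∑ B ∈ branchPoints s, classLeafCount k n t B =
      ((Finset.Ioc k n).filter fun j =>
        ¬ ∀ B ∈ branchPoints s, attachVertex k t j ≠ vertexOver t B).card := by
    unfold classLeafCount
    rw [← Finset.card_biUnion]
    · congr 1
      ext j
      simp only [Finset.mem_biUnion, Finset.mem_filter, not_forall, not_not]
      constructor
      · rintro ⟨B, hB, hj, hc⟩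
        exact ⟨hj, B, hB, (hiff j hj B hB).2 hc⟩
      · rintro ⟨hj, B, hB, hc⟩
        exact ⟨B, hB, hj, (hiff j hj B hB).1 hc⟩
    · intro B hB B' hB' hne
      rw [Function.onFun, Finset.disjoint_left]
      intro j hj hj'
      exact hne (h.inClass_unique ht hkn hs (mem_branchPoints.1 hB).1 (mem_branchPoints.1 hB').1
        (Finset.mem_filter.1 hj).2 (Finset.mem_filter.1 hj').2)
  rw [h1, edgeLeafCount, Finset.card_filter_add_card_filter_not, Nat.card_Ioc]

end

end AlphaGamma

namespace AlphaGamma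

/-! ### Growth -/

/-- Insertion of the leaf `j` on the edge below `A` if `e` is true, at `A` if `e` is false. -/
def grow (j : ℕ) (t : LTree) (e : Bool) (A : Finset ℕ) : LTree :=
  if e then growEdge j t A else growVertex j t A

/-- The two insertions differ in one respect: on an edge the old vertex `A` survives beside its
enlarged copy, at a branch point it is replaced. -/
lemma mem_grow {j : ℕ} {t : LTree} {e : Bool} {A C : Finset ℕ} :
    C ∈ grow j t e A ↔ (C ∈ t ∧ (¬ A ⊆ C ∨ (e ∧ C = A))) ∨
      (∃ D ∈ t, A ⊆ D ∧ insert j D = C) ∨ C = {j} := by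
  cases e
  · simp only [grow, growVertex, Bool.false_eq_true, if_false, Finset.mem_union,
      Finset.mem_filter, Finset.mem_image, Finset.mem_singleton, or_assoc, and_assoc, false_and,
      or_false]
  · have : C ∈ t → (¬ A ⊂ C ↔ (¬ A ⊆ C ∨ C = A)) := fun _ => by
      rw [Finset.ssubset_iff_subset_ne, not_and_or, not_not, eq_comm]
    simp only [grow, growEdge, if_true, Finset.mem_union, Finset.mem_filter, Finset.mem_image,
      Finset.mem_singleton, or_assoc, and_assoc, true_and]
    rw [and_congr_right this]

section

variable {k n : ℕ} {s t : LTree} {e : Bool} {A B : Finset ℕ}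

lemma succ_notMem {D : Finset ℕ} (hD : D ⊆ Finset.Icc 1 n) : n + 1 ∉ D := fun h => by
  have := Finset.mem_Icc.1 (hD h)
  omega

lemma insert_succ_inter_Icc (hkn : k ≤ n) (D : Finset ℕ) :
    insert (n + 1) D ∩ Finset.Icc 1 k = D ∩ Finset.Icc 1 k :=
  Finset.insert_inter_of_notMem (by simp; omega)

namespace IsTree

/-- The condition `he` forbids insertion at a leaf, which would destroy its singleton. Laminarity
survives because the label is added to all vertices above `A`, which form a chain. -/
lemma isTree_grow (ht : IsTree n t) (hA : A ∈ t) (he : e ∨ 2 ≤ A.card) :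
    IsTree (n + 1) (grow (n + 1) t e A) where
  top_mem := by
    refine (mem_grow).2 (Or.inr (Or.inl ⟨_, ht.top_mem, ht.subset A hA, ?_⟩))
    exact by ext; simp only [Finset.mem_insert, Finset.mem_Icc]; omega
  singleton_mem i hi := by
    rw [mem_grow]
    by_cases h : i = n + 1
    · exact Or.inr (Or.inr (by rw [h]))
    · have hi' : i ∈ Finset.Icc 1 n := by rw [Finset.mem_Icc] at hi ⊢; omega
      refine Or.inl ⟨ht.singleton_mem i hi', ?_⟩
      by_cases hAi : A ⊆ {i}
      · right
        rw [Finset.Nonempty.subset_singleton_iff (ht.nonempty A hA)] at hAi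
        refine ⟨?_, hAi.symm⟩
        rcases he with he | he
        · exact he
        · rw [hAi] at he; simp at he
      · exact Or.inl hAi
  nonempty C hC := by
    rw [mem_grow] at hC
    rcases hC with ⟨hC, -⟩ | ⟨D, hD, -, rfl⟩ | rfl
    · exact ht.nonempty C hC
    · exact Finset.insert_nonempty _ _
    · exact Finset.singleton_nonempty _
  subset C hC := by
    have hsub : Finset.Icc 1 n ⊆ Finset.Icc 1 (n + 1) := Finset.Icc_subset_Icc_right (by omega)
    rw [mem_grow] at hC
    rcases hC with ⟨hC, -⟩ | ⟨D, hD, -, rfl⟩ | rfl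
    · exact (ht.subset C hC).trans hsub
    · exact Finset.insert_subset (by simp) ((ht.subset D hD).trans hsub)
    · simp
  laminar := by
    have key : ∀ C ∈ t, (¬ A ⊆ C ∨ (e ∧ C = A)) → ∀ D ∈ t, A ⊆ D →
        C ⊆ insert (n + 1) D ∨ Disjoint C (insert (n + 1) D) := fun C hC hCA D hD hAD => by
      rcases ht.laminar C hC D hD with h | h | h
      · exact Or.inl (h.trans (Finset.subset_insert _ _))
      · rcases hCA with h' | ⟨-, rfl⟩
        · exact absurd (hAD.trans h) h'
        · exact Or.inl (hAD.trans (Finset.subset_insert _ _))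
      · exact Or.inr (Finset.disjoint_insert_right.2 ⟨succ_notMem (ht.subset C hC), h⟩)
    intro C hC C' hC'
    rw [mem_grow] at hC hC'
    rcases hC with ⟨hC, hCA⟩ | ⟨D, hD, hAD, rfl⟩ | rfl <;>
      rcases hC' with ⟨hC', hCA'⟩ | ⟨D', hD', hAD', rfl⟩ | rfl
    · exact ht.laminar C hC C' hC'
    · rcases key C hC hCA D' hD' hAD' with h | h
      · exact Or.inl h
      · exact Or.inr (Or.inr h)
    · exact Or.inr (Or.inr (Finset.disjoint_singleton_right.2 (succ_notMem (ht.subset C hC))))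
    · rcases key C' hC' hCA' D hD hAD with h | h
      · exact Or.inr (Or.inl h)
      · exact Or.inr (Or.inr h.symm)
    · obtain ⟨x, hx⟩ := ht.nonempty A hA
      rcases ht.comparable hD hD' (hAD hx) (hAD' hx) with h | h
      · exact Or.inl (Finset.insert_subset_insert _ h)
      · exact Or.inr (Or.inl (Finset.insert_subset_insert _ h))
    · exact Or.inr (Or.inl (by simp))
    · exact Or.inr (Or.inr (Finset.disjoint_singleton_left.2 (succ_notMem (ht.subset C' hC'))))
    · exact Or.inl (by simp)
    · exact Or.inl subset_rfl

lemma restricts_grow (ht : IsTree n t) :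
    Restricts n t (grow (n + 1) t e A) := fun B => by
  constructor
  · intro hB
    refine ⟨ht.nonempty B hB, ?_⟩
    by_cases h : A ⊆ B
    · refine ⟨insert (n + 1) B, (mem_grow).2 (Or.inr (Or.inl ⟨B, hB, h, rfl⟩)), ?_⟩
      rw [insert_succ_inter_Icc le_rfl, Finset.inter_eq_left.2 (ht.subset B hB)]
    · exact ⟨B, (mem_grow).2 (Or.inl ⟨hB, Or.inl h⟩), Finset.inter_eq_left.2 (ht.subset B hB)⟩
  · rintro ⟨hne, C, hC, rfl⟩
    rw [mem_grow] at hC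
    rcases hC with ⟨hC, -⟩ | ⟨D, hD, -, rfl⟩ | rfl
    · rwa [Finset.inter_eq_left.2 (ht.subset C hC)]
    · rwa [insert_succ_inter_Icc le_rfl, Finset.inter_eq_left.2 (ht.subset D hD)]
    · obtain ⟨x, hx⟩ := hne
      simp only [Finset.mem_inter, Finset.mem_singleton, Finset.mem_Icc] at hx
      omega

/-- Among the vertices other than the new leaf, those containing the new label are enlargements of
vertices above `A`, so the enlarged `A` is the least. -/
lemma singleton_mem_children_grow (ht : IsTree n t) (hA : A ∈ t) {X : Finset ℕ}
    (hX : X ∈ grow (n + 1) t e A) :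
    {n + 1} ∈ children (grow (n + 1) t e A) X ↔ X = insert (n + 1) A := by
  have hjA := succ_notMem (ht.subset A hA)
  have hne : insert (n + 1) A ≠ {n + 1} := fun h => by
    obtain ⟨x, hx⟩ := ht.nonempty A hA
    have : x ∈ ({n + 1} : Finset ℕ) := h ▸ Finset.mem_insert_of_mem hx
    rw [Finset.mem_singleton] at this
    exact hjA (this ▸ hx)
  have hmem : insert (n + 1) A ∈ grow (n + 1) t e A :=
    (mem_grow).2 (Or.inr (Or.inl ⟨A, hA, subset_rfl, rfl⟩))
  rw [mem_children]
  constructor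
  · rintro ⟨-, hjX, hmax⟩
    rw [mem_grow] at hX
    have hj : n + 1 ∈ X := hjX.subset (Finset.mem_singleton_self _)
    rcases hX with ⟨hX, -⟩ | ⟨D, hD, hAD, rfl⟩ | rfl
    · exact absurd hj (succ_notMem (ht.subset X hX))
    · rcases hmax _ hmem (by simp) (Finset.insert_subset_insert _ hAD) with h | h
      · exact absurd h hne
      · exact h.symm
    · exact absurd rfl hjX.ne
  · rintro rfl
    refine ⟨(mem_grow).2 (Or.inr (Or.inr rfl)),
      Finset.ssubset_iff_subset_ne.2 ⟨by simp, hne.symm⟩, fun C hC hjC hCA => ?_⟩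
    rw [mem_grow] at hC
    rcases hC with ⟨hC, -⟩ | ⟨D, hD, hAD, rfl⟩ | rfl
    · exact absurd (hjC (Finset.mem_singleton_self _)) (succ_notMem (ht.subset C hC))
    · right
      refine hCA.antisymm (Finset.insert_subset_insert _ hAD)
    · exact Or.inl rfl

/-- The class of the new leaf. -/
lemma inClass_grow (ht : IsTree n t) (hkn : k ≤ n) (hA : A ∈ t)
    (hBk : B ⊆ Finset.Icc 1 k) :
    InClass k (grow (n + 1) t e A) B {n + 1} ↔
      InClass k t B A ∧ (e → ¬ (A ∩ Finset.Icc 1 k).Nonempty) := by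
  have hBj : ∀ D, B ⊆ insert (n + 1) D ↔ B ⊆ D := fun D => by
    rw [Finset.subset_insert_iff_of_notMem (succ_notMem
      (hBk.trans (Finset.Icc_subset_Icc_right hkn)))]
  simp only [InClass, mem_grow, Finset.singleton_subset_iff]
  constructor
  · intro h
    have h1 : ∀ D ∈ t, (D ∩ Finset.Icc 1 k).Nonempty → (A ⊆ D ↔ B ⊆ D) := fun D hD hne => by
      by_cases hAD : A ⊆ D
      · have := h (insert (n + 1) D) (Or.inr (Or.inl ⟨D, hD, hAD, rfl⟩))
          (by rwa [insert_succ_inter_Icc hkn])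
        rw [hBj] at this
        exact ⟨fun _ => this.1 (Finset.mem_insert_self _ _), fun _ => hAD⟩
      · have := h D (Or.inl ⟨hD, Or.inl hAD⟩) hne
        exact ⟨fun h' => absurd h' hAD,
          fun h' => absurd (this.2 h') (succ_notMem (ht.subset D hD))⟩
    refine ⟨h1, fun he hne => ?_⟩
    exact succ_notMem (ht.subset A hA)
      ((h A (Or.inl ⟨hA, Or.inr ⟨he, rfl⟩⟩) hne).2 ((h1 A hA hne).1 subset_rfl))
  · rintro ⟨h, he⟩ C hC hne
    rcases hC with ⟨hC, hCA | ⟨h', rfl⟩⟩ | ⟨D, hD, hAD, rfl⟩ | rfl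
    · exact ⟨fun h' => absurd h' (succ_notMem (ht.subset C hC)),
        fun h' => absurd ((h C hC hne).2 h') hCA⟩
    · exact absurd hne (he h')
    · rw [insert_succ_inter_Icc hkn] at hne
      rw [hBj]
      exact ⟨fun _ => (h D hD hne).1 hAD, fun _ => Finset.mem_insert_self _ _⟩
    · obtain ⟨x, hx⟩ := hne
      simp only [Finset.mem_inter, Finset.mem_singleton, Finset.mem_Icc] at hx
      omega

open scoped Classical in
lemma classLeafCount_grow (ht : IsTree n t) (hkn : k ≤ n) (hA : A ∈ t)
    (hBk : B ⊆ Finset.Icc 1 k) :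
    classLeafCount k (n + 1) (grow (n + 1) t e A) B = classLeafCount k n t B +
      if InClass k t B A ∧ (e → ¬ (A ∩ Finset.Icc 1 k).Nonempty) then 1 else 0 := by
  have e1 : Finset.Ioc k (n + 1) = insert (n + 1) (Finset.Ioc k n) := by
    ext; simp only [Finset.mem_Ioc, Finset.mem_insert]; omega
  have e2 : (Finset.Ioc k n).filter
      (fun j => InClass k (grow (n + 1) t e A) B {j}) =
      (Finset.Ioc k n).filter fun j => InClass k t B {j} := by
    refine Finset.filter_congr fun j hj => ?_
    rw [Finset.mem_Ioc] at hj
    exact (ht.restricts_grow).inClass_iff hkn hBk (by simp; omega)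
  rw [classLeafCount, classLeafCount, e1, Finset.filter_insert, e2, ht.inClass_grow hkn hA hBk]
  split_ifs with h
  · rw [Finset.card_insert_of_notMem (by simp)]
  · rfl

end IsTree

lemma Restricts.vertexOver_vertexOver {n' : ℕ} {t' : LTree} (ht : IsTree n t)
    (ht' : IsTree n' t') (hn : n ≤ n') (h : Restricts n t t') (hB : B.Nonempty)
    (hBn : B ⊆ Finset.Icc 1 n) : vertexOver t' (vertexOver t B) = vertexOver t' B := by
  have hv := ht.vertexOver_spec hB hBn
  have hv' := ht'.vertexOver_spec hB (hBn.trans (Finset.Icc_subset_Icc_right hn))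
  have hvv := ht'.vertexOver_spec (ht.nonempty _ hv.1)
    ((ht.subset _ hv.1).trans (Finset.Icc_subset_Icc_right hn))
  refine Finset.Subset.antisymm ?_ (hv'.2.2 _ hvv.1 (hv.2.1.trans hvv.2.1))
  refine hvv.2.2 _ hv'.1 ?_
  have hBi := (subset_inter_Icc_iff (D := vertexOver t' B) hBn).2 hv'.2.1
  exact (hv.2.2 _ (h.mem hv'.1 (hB.mono hBi)) hBi).trans Finset.inter_subset_left

/-- Only the insertion at the vertex over `B` changes its degree. -/
lemma IsTree.card_children_grow (ht : IsTree n t) (hA : A ∈ t) (he : e ∨ 2 ≤ A.card)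
    (hB : B.Nonempty) (hBn : B ⊆ Finset.Icc 1 n) :
    (children (grow (n + 1) t e A) (vertexOver (grow (n + 1) t e A) B)).card =
      (children t (vertexOver t B)).card +
        if e = false ∧ A = vertexOver t B then 1 else 0 := by
  have ht' := ht.isTree_grow hA he
  have hr := ht.restricts_grow (e := e) (A := A)
  have hv := ht.vertexOver_spec hB hBn
  rw [← hr.vertexOver_vertexOver ht ht' (by omega) hB hBn]
  set V := vertexOver t B with hV
  have hVne := ht.nonempty _ hv.1
  have hv' := ht'.vertexOver_spec hVne ((ht.subset _ hv.1).trans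
    (Finset.Icc_subset_Icc_right (by omega)))
  have hvi := hr.vertexOver_inter ht' (by omega) hv.1
  set X := vertexOver (grow (n + 1) t e A) V with hX
  -- Children that meet the first `n` labels correspond to the old children; the only other possible
  -- child is the new leaf.
  have h1 := hr.card_children ht' ht (by omega) hv.1
  rw [← Finset.card_filter_add_card_filter_not
    fun C => (C ∩ Finset.Icc 1 n).Nonempty, h1]
  congr 1
  have h2 : (children (grow (n + 1) t e A) X).filter
      (fun C => ¬ (C ∩ Finset.Icc 1 n).Nonempty) =
      if X = insert (n + 1) A then {{n + 1}} else ∅ := by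
    simp only [← ht.singleton_mem_children_grow hA hv'.1]
    ext C
    rw [Finset.mem_filter]
    constructor
    · rintro ⟨hC, hne⟩
      have hCj : C = {n + 1} := by
        rcases (mem_grow).1 (mem_children.1 hC).1 with ⟨h, -⟩ | ⟨D, hD, -, rfl⟩ | h
        · rw [Finset.inter_eq_left.2 (ht.subset C h)] at hne
          exact absurd (ht.nonempty C h) hne
        · rw [insert_succ_inter_Icc le_rfl, Finset.inter_eq_left.2 (ht.subset D hD)] at hne
          exact absurd (ht.nonempty D hD) hne
        · exact h
      subst hCj
      rw [if_pos hC, Finset.mem_singleton]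
    · intro hC
      split_ifs at hC with h
      · rw [Finset.mem_singleton] at hC
        subst hC
        refine ⟨h, ?_⟩
        rintro ⟨x, hx⟩
        simp only [Finset.mem_inter, Finset.mem_singleton, Finset.mem_Icc] at hx
        omega
      · simp at hC
  rw [h2]
  have h3 : X = insert (n + 1) A ↔ e = false ∧ A = V := by
    constructor
    · intro h
      have hVA : A = V := by
        rw [← hvi, h, insert_succ_inter_Icc le_rfl, Finset.inter_eq_left.2 (ht.subset A hA)]
      refine ⟨?_, hVA⟩
      -- For an edge insertion `A` itself remains and is a smaller vertex over `V` than the enlarged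
      -- set.
      by_contra hcon
      have hmem : A ∈ grow (n + 1) t e A :=
        (mem_grow).2 (Or.inl ⟨hA, Or.inr ⟨by simpa using hcon, rfl⟩⟩)
      have := hv'.2.2 A hmem hVA.symm.subset
      rw [h] at this
      exact succ_notMem (ht.subset A hA) (this (Finset.mem_insert_self _ _))
    · rintro ⟨rfl, hAV⟩
      have hm := (mem_grow).1 hv'.1
      rcases hm with ⟨-, hm | hm⟩ | ⟨D, hD, -, hDX⟩ | hm
      · exact absurd (hAV ▸ hv'.2.1) hm
      · exact absurd hm.1 (by simp)
      · rw [← hDX, insert_succ_inter_Icc le_rfl, Finset.inter_eq_left.2 (ht.subset D hD)] at hvi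
        rw [← hDX, hvi, hAV]
      · rw [hm] at hv'
        obtain ⟨x, hx⟩ := hVne
        have := Finset.mem_singleton.1 (hv'.2.1 hx)
        exact absurd (this ▸ hx) (succ_notMem (ht.subset _ hv.1))
  simp only [h3]
  split_ifs <;> simp

end

end AlphaGamma

namespace AlphaGamma

/-! ### The generator -/

/-- The edges of `t`, marked by `true`, and the branch points of `t`, marked by `false`. -/
def moves (t : LTree) : Finset (Bool × Finset ℕ) :=
  (Finset.univ ×ˢ t).filter fun m => m.1 ∨ 2 ≤ m.2.card

/-- The weight of an edge or a branch point. -/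
noncomputable def moveWeight (α γ : ℝ) (t : LTree) (m : Bool × Finset ℕ) : ℝ :=
  if m.1 then edgeWeight α γ m.2 else vertexWeight α γ t m.2

lemma mem_moves {t : LTree} {m : Bool × Finset ℕ} :
    m ∈ moves t ↔ m.2 ∈ t ∧ (m.1 ∨ 2 ≤ m.2.card) := by
  simp [moves]

lemma sum_moves {t : LTree} (F : Bool × Finset ℕ → ℝ) :
    ∑ m ∈ moves t, F m = ∑ A ∈ t, F (true, A) + ∑ A ∈ branchPoints t, F (false, A) := by
  rw [moves, Finset.sum_filter, Finset.sum_product, Fintype.sum_bool, branchPoints,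
    Finset.sum_filter]
  simp

lemma sum_moveWeight (α γ : ℝ) (t : LTree) :
    ∑ m ∈ moves t, moveWeight α γ t m = totalWeight α γ t := by
  simp [sum_moves, moveWeight, totalWeight]

lemma growProb_eq (α γ : ℝ) (j : ℕ) (t t' : LTree) : growProb α γ j t t' =
    (∑ m ∈ moves t, if grow j t m.1 m.2 = t' then moveWeight α γ t m else 0) /
      totalWeight α γ t := by
  simp [sum_moves, moveWeight, growProb, grow]

/-- Sums over successor trees become sums over moves, so it does not matter whether different moves
lead to the same tree. -/
lemma sum_growProb_mul (α γ : ℝ) (j : ℕ) (t : LTree) (U : Finset LTree)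
    (hU : ∀ m ∈ moves t, grow j t m.1 m.2 ∈ U) (F : LTree → ℝ) :
    ∑ t' ∈ U, growProb α γ j t t' * F t' =
      (∑ m ∈ moves t, moveWeight α γ t m * F (grow j t m.1 m.2)) / totalWeight α γ t := by
  simp_rw [growProb_eq, div_mul_eq_mul_div, ← Finset.sum_div, Finset.sum_mul]
  rw [Finset.sum_comm]
  congr 1
  refine Finset.sum_congr rfl fun m hm => ?_
  simp_rw [ite_mul, zero_mul]
  rw [Finset.sum_ite_eq, if_pos (hU m hm)]

section

variable {k n : ℕ} {s t : LTree}

open scoped Classical in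
/-- The indicator of the moves which attach the new leaf at the vertex over `B`. -/
noncomputable def classIndicator (k : ℕ) (t : LTree) (B : Finset ℕ) (m : Bool × Finset ℕ) : ℝ :=
  if InClass k t B m.2 ∧ (m.1 → ¬ (m.2 ∩ Finset.Icc 1 k).Nonempty) then 1 else 0

/-- The indicator of the move which increases the degree of the vertex over `B`. -/
noncomputable def vertexIndicator (t : LTree) (B : Finset ℕ) (m : Bool × Finset ℕ) : ℝ :=
  if m.1 = false ∧ m.2 = vertexOver t B then 1 else 0

lemma edgeLeafCount_grow (ht : IsTree n t) (hs : IsTree k s) (hk : 1 ≤ k) (hkn : k ≤ n)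
    (h : Restricts k s t) {m : Bool × Finset ℕ} (hm : m ∈ moves t) :
    (edgeLeafCount k (n + 1) s (grow (n + 1) t m.1 m.2) : ℝ) =
      edgeLeafCount k n s t + (1 - ∑ B ∈ branchPoints s, classIndicator k t B m) := by
  rw [mem_moves] at hm
  have h1 := edgeLeafCount_eq ht hs hk hkn h
  have h2 := edgeLeafCount_eq (ht.isTree_grow hm.1 hm.2) hs hk (by omega)
    (h.trans hkn ht.restricts_grow)
  rw [Finset.sum_congr rfl fun B hB => ht.classLeafCount_grow hkn hm.1
    (hs.subset B (mem_branchPoints.1 hB).1), Finset.sum_add_distrib] at h2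
  have h1' := congrArg (Nat.cast : ℕ → ℝ) h1
  have h2' := congrArg (Nat.cast : ℕ → ℝ) h2
  rw [Nat.cast_sub hkn] at h1'
  rw [Nat.cast_sub (by omega)] at h2'
  push_cast at h1' h2'
  simp only [classIndicator]
  linarith

lemma sum_moveWeight_classIndicator (α γ : ℝ) (ht : IsTree n t) (hs : IsTree k s) (hkn : k ≤ n)
    (h : Restricts k s t) {B : Finset ℕ} (hB : B ∈ branchPoints s) :
    ∑ m ∈ moves t, moveWeight α γ t m * classIndicator k t B m =
      classLeafCount k n t B + vertexWeight α γ s B := by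
  rw [← sum_class α γ ht hs hkn h hB, sum_moves]
  simp only [moveWeight, classIndicator, mul_ite, mul_one, mul_zero, if_true,
    Bool.false_eq_true, if_false]
  congr 1 <;> refine Finset.sum_congr rfl fun A _ => ?_ <;> congr 1 <;> simp

lemma sum_moveWeight_vertexIndicator (α γ : ℝ) (ht : IsTree n t) (hs : IsTree k s) (hkn : k ≤ n)
    {B : Finset ℕ} (hB : B ∈ branchPoints s) :
    ∑ m ∈ moves t, moveWeight α γ t m * vertexIndicator t B m =
      vertexWeight α γ t (vertexOver t B) := by
  have := vertexOver_mem_branchPoints ht hs hkn hB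
  rw [sum_moves]
  simp [moveWeight, vertexIndicator, this]

/-- The total weight of the edges of the subtree spanned by the root and the first leaves, and of
the subtrees attached to these edges. -/
lemma sum_moveWeight_edge (α γ : ℝ) (ht : IsTree n t) (hs : IsTree k s) (hk : 1 ≤ k) (hkn : k ≤ n)
    (h : Restricts k s t) :
    ∑ m ∈ moves t, moveWeight α γ t m * (1 - ∑ B ∈ branchPoints s, classIndicator k t B m) =
      k * (1 - α) + (branchPoints s).card * γ + edgeLeafCount k n s t := by
  simp_rw [mul_sub, mul_one, Finset.mul_sum]
  rw [Finset.sum_sub_distrib, sum_moveWeight, ht.totalWeight_eq, Finset.sum_comm,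
    Finset.sum_congr rfl fun B hB => sum_moveWeight_classIndicator α γ ht hs hkn h hB,
    Finset.sum_add_distrib, hs.sum_vertexWeight]
  have h1' := congrArg (Nat.cast : ℕ → ℝ) (edgeLeafCount_eq ht hs hk hkn h)
  rw [Nat.cast_sub hkn] at h1'
  push_cast at h1'
  linarith

/-- The weight of the vertex over `B`, divided by `α`. -/
noncomputable def overWeight (α γ : ℝ) (t : LTree) (B : Finset ℕ) : ℝ :=
  ((children t (vertexOver t B)).card : ℝ) - 1 - γ / α

/-- The weight of the part of `t` over the edges of `s`. -/
noncomputable def spineWeight (α γ : ℝ) (k n : ℕ) (s t : LTree) : ℝ :=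
  k * (1 - α) + (branchPoints s).card * γ + edgeLeafCount k n s t

/-- Product of rising factorials of the weights of the parts of `t` seen from `s`. -/
noncomputable def profile (α γ : ℝ) (k n : ℕ) (s : LTree) (p : ℕ) (r : Finset ℕ → ℕ)
    (t : LTree) : ℝ :=
  rising (spineWeight α γ k n s t) p * ∏ B ∈ branchPoints s, rising (overWeight α γ t B) (r B)

lemma overWeight_grow (α γ : ℝ) (ht : IsTree n t) (hs : IsTree k s) (hkn : k ≤ n)
    {m : Bool × Finset ℕ} (hm : m ∈ moves t) {B : Finset ℕ} (hB : B ∈ branchPoints s) :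
    overWeight α γ (grow (n + 1) t m.1 m.2) B = overWeight α γ t B + vertexIndicator t B m := by
  rw [mem_moves] at hm
  rw [mem_branchPoints] at hB
  rw [overWeight, ht.card_children_grow hm.1 hm.2 (hs.nonempty B hB.1)
    ((hs.subset B hB.1).trans (Finset.Icc_subset_Icc_right hkn)), overWeight, vertexIndicator]
  push_cast
  ring

lemma spineWeight_grow (α γ : ℝ) (ht : IsTree n t) (hs : IsTree k s) (hk : 1 ≤ k) (hkn : k ≤ n)
    (h : Restricts k s t) {m : Bool × Finset ℕ} (hm : m ∈ moves t) :
    spineWeight α γ k (n + 1) s (grow (n + 1) t m.1 m.2) = spineWeight α γ k n s t +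
      (1 - ∑ B ∈ branchPoints s, classIndicator k t B m) := by
  rw [spineWeight, edgeLeafCount_grow ht hs hk hkn h hm, spineWeight]
  ring

lemma classIndicator_eq_one {B : Finset ℕ} (ht : IsTree n t) (hs : IsTree k s) (hkn : k ≤ n)
    (h : Restricts k s t) (hB : B ∈ branchPoints s) {m : Bool × Finset ℕ} (hm : m ∈ moves t)
    (hv : vertexIndicator t B m ≠ 0) : classIndicator k t B m = 1 := by
  rw [vertexIndicator] at hv
  split_ifs at hv with h1
  · rw [mem_moves] at hm
    rw [mem_branchPoints] at hB
    refine if_pos ⟨?_, by simp [h1.1]⟩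
    refine (inClass_iff_eq_vertexOver ht hkn (hs.nonempty B hB.1) (hs.subset B hB.1) hm.1 ?_).2 h1.2
    rw [h1.2, h.vertexOver_inter ht hkn hB.1]
    exact hs.nonempty B hB.1
  · exact absurd rfl hv

/-- The new leaf is attached at no more than one vertex. -/
lemma sum_classIndicator_of_ne_zero {B : Finset ℕ} (ht : IsTree n t) (hs : IsTree k s)
    (hkn : k ≤ n) (h : Restricts k s t) (hB : B ∈ branchPoints s) {m : Bool × Finset ℕ}
    (hv : classIndicator k t B m ≠ 0) :
    ∑ B' ∈ branchPoints s, classIndicator k t B' m = 1 ∧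
      ∀ B' ∈ branchPoints s, B' ≠ B → classIndicator k t B' m = 0 := by
  have h1 : InClass k t B m.2 ∧ (m.1 → ¬ (m.2 ∩ Finset.Icc 1 k).Nonempty) := by
    by_contra hcon
    exact hv (if_neg hcon)
  have h2 : ∀ B' ∈ branchPoints s, B' ≠ B → classIndicator k t B' m = 0 := fun B' hB' hne => by
    refine if_neg fun hcon => hne ?_
    exact h.inClass_unique ht hkn hs (mem_branchPoints.1 hB').1 (mem_branchPoints.1 hB).1 hcon.1 h1.1
  refine ⟨?_, h2⟩
  rw [Finset.sum_eq_single_of_mem B hB h2, classIndicator, if_pos h1]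

/-- A move changes at most one factor of the profile: it lands over an edge of `s`, or raises one
degree, or does neither, in the interior of a class. Writing the change linearly in the indicators
prepares for averaging over the moves. -/
lemma profile_grow (α γ : ℝ) (p : ℕ) (r : Finset ℕ → ℕ) (ht : IsTree n t) (hs : IsTree k s)
    (hk : 1 ≤ k) (hkn : k ≤ n) (h : Restricts k s t) {m : Bool × Finset ℕ} (hm : m ∈ moves t) :
    profile α γ k (n + 1) s p r (grow (n + 1) t m.1 m.2) = profile α γ k n s p r t +
      (1 - ∑ B ∈ branchPoints s, classIndicator k t B m) *
        ((rising (spineWeight α γ k n s t + 1) p - rising (spineWeight α γ k n s t) p) *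
          ∏ B ∈ branchPoints s, rising (overWeight α γ t B) (r B)) +
      ∑ B ∈ branchPoints s, vertexIndicator t B m *
        ((rising (overWeight α γ t B + 1) (r B) - rising (overWeight α γ t B) (r B)) *
          (rising (spineWeight α γ k n s t) p *
            ∏ B' ∈ (branchPoints s).erase B, rising (overWeight α γ t B') (r B'))) := by
  rw [profile, spineWeight_grow α γ ht hs hk hkn h hm, Finset.prod_congr rfl fun B hB => by
    rw [overWeight_grow α γ ht hs hkn hm hB], profile]
  by_cases hv : ∃ B ∈ branchPoints s, vertexIndicator t B m ≠ 0
  · obtain ⟨B, hB, hvB⟩ := hv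
    have hc := classIndicator_eq_one ht hs hkn h hB hm hvB
    obtain ⟨h1, h2⟩ := sum_classIndicator_of_ne_zero (m := m) ht hs hkn h hB (by rw [hc]; simp)
    have hv1 : vertexIndicator t B m = 1 := by
      rw [vertexIndicator] at hvB ⊢
      split_ifs at hvB ⊢ with h3
      · rfl
      · exact absurd rfl hvB
    have h0 : ∀ B' ∈ branchPoints s, B' ≠ B → vertexIndicator t B' m = 0 := fun B' hB' hne => by
      by_contra hcon
      have := classIndicator_eq_one ht hs hkn h hB' hm hcon
      rw [h2 B' hB' hne] at this
      simp at this
    rw [h1, Finset.sum_eq_single_of_mem B hB fun B' hB' hne => by rw [h0 B' hB' hne, zero_mul],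
      ← Finset.mul_prod_erase _ _ hB, ← Finset.mul_prod_erase _ _ hB, hv1,
      Finset.prod_congr rfl fun B' hB' => by
        rw [h0 B' (Finset.mem_of_mem_erase hB') (Finset.ne_of_mem_erase hB'), add_zero]]
    simp only [sub_self, add_zero, zero_mul, one_mul]
    ring
  · push Not at hv
    rw [Finset.sum_eq_zero (f := fun B => vertexIndicator t B m * _) fun B hB => by
      rw [hv B hB, zero_mul], Finset.prod_congr rfl fun B hB => by
      rw [hv B hB, add_zero], add_zero]
    -- No degree changes. Either the leaf falls in some class and the profile is constant, or it
    -- falls over an edge and the spine weight increases by one.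
    by_cases hc : ∃ B ∈ branchPoints s, classIndicator k t B m ≠ 0
    · obtain ⟨B, hB, hcB⟩ := hc
      rw [(sum_classIndicator_of_ne_zero ht hs hkn h hB hcB).1]
      simp
    · push Not at hc
      rw [Finset.sum_eq_zero hc, sub_zero]
      ring

/-- The action of the generator on the profiles. -/
lemma sum_moveWeight_mul_profile {α : ℝ} (hα : α ≠ 0) (γ : ℝ) (p : ℕ) (r : Finset ℕ → ℕ)
    (ht : IsTree n t) (hs : IsTree k s) (hk : 1 ≤ k) (hkn : k ≤ n) (h : Restricts k s t) :
    ∑ m ∈ moves t, moveWeight α γ t m *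
        profile α γ k (n + 1) s p r (grow (n + 1) t m.1 m.2) =
      (n - α + p + α * (∑ B ∈ branchPoints s, r B : ℕ)) * profile α γ k n s p r t := by
  rw [Finset.sum_congr rfl fun m hm => by
    rw [profile_grow α γ p r ht hs hk hkn h hm, mul_add, mul_add, ← mul_assoc (moveWeight α γ t m)
      (1 - _), Finset.mul_sum]]
  rw [Finset.sum_add_distrib, Finset.sum_add_distrib, ← Finset.sum_mul, sum_moveWeight,
    ht.totalWeight_eq, ← Finset.sum_mul, sum_moveWeight_edge α γ ht hs hk hkn h, Finset.sum_comm,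
    ← spineWeight]
  have h1 : ∀ B ∈ branchPoints s, (∑ m ∈ moves t, moveWeight α γ t m * (vertexIndicator t B m *
        ((rising (overWeight α γ t B + 1) (r B) - rising (overWeight α γ t B) (r B)) *
          (rising (spineWeight α γ k n s t) p *
            ∏ B' ∈ (branchPoints s).erase B, rising (overWeight α γ t B') (r B'))))) =
      α * r B * profile α γ k n s p r t := fun B hB => by
    simp_rw [← mul_assoc (moveWeight α γ t _)]
    rw [← Finset.sum_mul, sum_moveWeight_vertexIndicator α γ ht hs hkn hB, profile,
      ← Finset.mul_prod_erase _ _ hB]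
    -- The rate is `α` times the argument of the rising factorial, so the eigenvalue is `α * r B`.
    have hw : vertexWeight α γ t (vertexOver t B) = α * overWeight α γ t B := by
      rw [vertexWeight, overWeight]; field_simp
    have := mul_rising_add_one (overWeight α γ t B) (r B)
    rw [hw]
    linear_combination α * (rising (spineWeight α γ k n s t) p *
      ∏ B' ∈ (branchPoints s).erase B, rising (overWeight α γ t B') (r B')) * this
  rw [Finset.sum_congr rfl h1, ← Finset.sum_mul, ← Finset.mul_sum]
  have := mul_rising_add_one (spineWeight α γ k n s t) p
  rw [profile]
  push_cast
  linear_combination (∏ B ∈ branchPoints s, rising (overWeight α γ t B) (r B)) * this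

lemma IsTree.card_eq (ht : IsTree n t) : t.card = n + (branchPoints t).card := by
  have h := Finset.card_filter_add_card_filter_not (s := t) fun A => 2 ≤ A.card
  rw [ht.card_filter_singletons] at h
  rw [branchPoints]
  omega

/-- With `n` leaves, branch points are counted by `t.card - n`. An edge insertion adds two vertices,
the leaf and the enlarged `A`, and one of them is a leaf. -/
lemma IsTree.card_branchPoints_growEdge (ht : IsTree n t) {A : Finset ℕ} (hA : A ∈ t) :
    (branchPoints (grow (n + 1) t true A)).card = (branchPoints t).card + 1 := by
  have h1 := (ht.isTree_grow (e := true) hA (Or.inl rfl)).card_eq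
  have h2 := ht.card_eq
  suffices (grow (n + 1) t true A).card = t.card + 2 by omega
  have hinj : Set.InjOn (fun C => insert (n + 1) C) ((t.filter fun C => A ⊆ C : LTree) : Set (Finset ℕ)) := by
    intro C hC D hD hCD
    rw [Finset.mem_coe, Finset.mem_filter] at hC hD
    have := congrArg (fun E => E ∩ Finset.Icc 1 n) hCD
    simpa only [insert_succ_inter_Icc le_rfl, Finset.inter_eq_left.2 (ht.subset _ hC.1),
      Finset.inter_eq_left.2 (ht.subset _ hD.1)] using this
  have hfil : t.filter (fun C => A ⊆ C) = insert A (t.filter fun C => A ⊂ C) := by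
    ext C
    simp only [Finset.mem_filter, Finset.mem_insert]
    constructor
    · rintro ⟨hC, h⟩
      rcases h.eq_or_ssubset with rfl | h
      · exact Or.inl rfl
      · exact Or.inr ⟨hC, h⟩
    · rintro (rfl | ⟨hC, h⟩)
      · exact ⟨hA, subset_rfl⟩
      · exact ⟨hC, h.subset⟩
  have hcard := Finset.card_filter_add_card_filter_not (s := t) fun C => A ⊂ C
  rw [grow, if_pos rfl, growEdge, Finset.card_union_of_disjoint, Finset.card_union_of_disjoint,
    Finset.card_image_of_injOn hinj, Finset.card_singleton, hfil,
    Finset.card_insert_of_notMem (by simp)]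
  · omega
  · rw [Finset.disjoint_left]
    intro C hC hC'
    obtain ⟨D, -, rfl⟩ := Finset.mem_image.1 hC'
    exact succ_notMem (ht.subset _ (Finset.mem_filter.1 hC).1) (Finset.mem_insert_self _ _)
  · rw [Finset.disjoint_singleton_right, Finset.mem_union]
    rintro (hC | hC)
    · exact succ_notMem (ht.subset _ (Finset.mem_filter.1 hC).1) (Finset.mem_singleton_self _)
    · obtain ⟨D, hD, hDj⟩ := Finset.mem_image.1 hC
      rw [Finset.mem_filter] at hD
      obtain ⟨x, hx⟩ := ht.nonempty D hD.1
      have h3 : x ∈ ({n + 1} : Finset ℕ) := hDj ▸ Finset.mem_insert_of_mem hx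
      rw [Finset.mem_singleton] at h3
      exact succ_notMem (ht.subset D hD.1) (h3 ▸ hx)

end

end AlphaGamma

namespace AlphaGamma

/-! ### Growth paths -/

/-- A sequence of trees which is grown by moves of nonzero weight. -/
structure IsGrowthPath (α γ : ℝ) (x : ℕ → LTree) : Prop where
  init : x 2 = tree2
  step : ∀ n, 2 ≤ n → ∃ m ∈ moves (x n), moveWeight α γ (x n) m ≠ 0 ∧
    grow (n + 1) (x n) m.1 m.2 = x (n + 1)

lemma isTree_tree2 : IsTree 2 tree2 where
  top_mem := by decide
  singleton_mem := by decide
  nonempty := by decide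
  subset := by decide
  laminar := by decide

namespace IsGrowthPath

variable {α γ : ℝ} {x : ℕ → LTree}

lemma isTree (hx : IsGrowthPath α γ x) {n : ℕ} (hn : 2 ≤ n) : IsTree n (x n) := by
  induction n, hn using Nat.le_induction with
  | base => rw [hx.init]; exact isTree_tree2
  | succ n hn ih =>
    obtain ⟨m, hm, -, h⟩ := hx.step n hn
    rw [mem_moves] at hm
    exact h ▸ ih.isTree_grow hm.1 hm.2

lemma restricts (hx : IsGrowthPath α γ x) {k n : ℕ} (hk : 2 ≤ k) (hkn : k ≤ n) :
    Restricts k (x k) (x n) := by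
  induction n, hkn using Nat.le_induction with
  | base => exact (hx.isTree hk).restricts_self
  | succ n hn ih =>
    obtain ⟨m, hm, -, h⟩ := hx.step n (hk.trans hn)
    exact h ▸ ih.trans hn (hx.isTree (hk.trans hn)).restricts_grow

/-- If `γ = α`, then all trees are binary. -/
lemma card_branchPoints (hx : IsGrowthPath α α x) (hα0 : 0 < α) {n : ℕ} (hn : 2 ≤ n) :
    (branchPoints (x n)).card + 1 = n := by
  induction n, hn using Nat.le_induction with
  | base => rw [hx.init]; decide
  | succ n hn ih =>
    obtain ⟨m, hm, hw, h⟩ := hx.step n hn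
    have ht := hx.isTree hn
    have hnn : ∀ A ∈ branchPoints (x n), 0 ≤ vertexWeight α α (x n) A := fun A hA => by
      rw [mem_branchPoints] at hA
      have h2 : (2 : ℝ) ≤ (children (x n) A).card := by
        exact_mod_cast ht.two_le_card_children hA.1 hA.2
      rw [vertexWeight]
      nlinarith
    -- With `n - 1` branch points the vertex weights sum to zero; being nonnegative they all vanish,
    -- so the next move of nonzero weight must be on an edge.
    have h0 : ∑ A ∈ branchPoints (x n), vertexWeight α α (x n) A = 0 := by
      have ih' := congrArg (Nat.cast : ℕ → ℝ) ih
      push_cast at ih'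
      rw [ht.sum_vertexWeight, ← ih']
      ring
    rw [Finset.sum_eq_zero_iff_of_nonneg hnn] at h0
    rw [mem_moves] at hm
    rw [← h]
    by_cases he : m.1
    · rw [he, ht.card_branchPoints_growEdge hm.1, ih]
    · refine absurd ?_ hw
      rw [moveWeight, if_neg he]
      exact h0 _ (mem_branchPoints.2 ⟨hm.1, by simpa [he] using hm.2⟩)

end IsGrowthPath

/-! ### Histories -/

/-- The first `n` trees. -/
def history {Ω : Type*} (T : ℕ → Ω → LTree) (n : ℕ) (ω : Ω) : Finset.Icc 1 n → LTree :=
  fun i => T i ω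

namespace IsAlphaGammaSequence

variable {Ω : Type*} [mΩ : MeasurableSpace Ω] {μ : Measure Ω} {α γ : ℝ} {T : ℕ → Ω → LTree}

lemma measurableSet_history (hT : IsAlphaGammaSequence μ α γ T) (n : ℕ)
    (U : Set (Finset.Icc 1 n → LTree)) : MeasurableSet (history T n ⁻¹' U) := by
  have h1 : ∀ h, MeasurableSet (history T n ⁻¹' {h}) := fun h => by
    have : history T n ⁻¹' {h} = ⋂ i : Finset.Icc 1 n, {ω | T i ω = h i} := by
      ext ω
      simp [history, funext_iff]
    rw [this]
    exact MeasurableSet.iInter fun i =>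
      hT.measurableSet_eq i (Finset.mem_Icc.1 i.2).1 (h i)
  rw [← Set.biUnion_preimage_singleton]
  exact MeasurableSet.biUnion (Set.to_countable U) fun h _ => h1 h

/-- The filtration generated by the trees, from the tree with `k` leaves on. -/
def filtration (hT : IsAlphaGammaSequence μ α γ T) (k : ℕ) : Filtration ℕ mΩ where
  seq n := MeasurableSpace.comap (history T (n + k)) ⊤
  mono' i j hij := by
    rintro _ ⟨U, -, rfl⟩
    refine ⟨(fun h (l : Finset.Icc 1 (i + k)) =>
      h ⟨l, Finset.Icc_subset_Icc_right (by omega) l.2⟩) ⁻¹' U, trivial, rfl⟩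
  le' n := by
    rintro _ ⟨U, -, rfl⟩
    exact hT.measurableSet_history _ U

lemma measureReal_history_inter (hT : IsAlphaGammaSequence μ α γ T) {n : ℕ} (hn : 2 ≤ n)
    (h : Finset.Icc 1 n → LTree) (t' : LTree) :
    μ.real (history T n ⁻¹' {h} ∩ {ω | T (n + 1) ω = t'}) =
      μ.real (history T n ⁻¹' {h}) *
        growProb α γ (n + 1) (h ⟨n, Finset.mem_Icc.2 ⟨by omega, le_rfl⟩⟩) t' := by
  -- The growth rule is applied to the sequence that follows `h` up to `n` and takes the value `t'`
  -- everywhere else, in particular at `n + 1`.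
  have hst := hT.step n hn fun i => if hi : i ∈ Finset.Icc 1 n then h ⟨i, hi⟩ else t'
  have e1 : {ω | ∀ i ∈ Finset.Icc 1 n, T i ω =
      if hi : i ∈ Finset.Icc 1 n then h ⟨i, hi⟩ else t'} = history T n ⁻¹' {h} := by
    ext ω
    simp only [Set.mem_ofPred_eq, Set.mem_preimage, Set.mem_singleton_iff, funext_iff, history,
      Subtype.forall]
    exact forall₂_congr fun i hi => by rw [dif_pos hi]
  have e2 : {ω | ∀ i ∈ Finset.Icc 1 (n + 1), T i ω =
      if hi : i ∈ Finset.Icc 1 n then h ⟨i, hi⟩ else t'} =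
      history T n ⁻¹' {h} ∩ {ω | T (n + 1) ω = t'} := by
    rw [← e1]
    ext ω
    simp only [Set.mem_ofPred_eq, Set.mem_inter_iff]
    constructor
    · intro hω
      refine ⟨fun i hi => hω i (Finset.Icc_subset_Icc_right (by omega) hi), ?_⟩
      rw [hω (n + 1) (by simp), dif_neg (by simp)]
    · rintro ⟨h1, h2⟩ i hi
      by_cases hin : i = n + 1
      · rw [hin, h2, dif_neg (by simp)]
      · exact h1 i (by rw [Finset.mem_Icc] at hi ⊢; omega)
  rw [e1, e2, dif_pos (Finset.mem_Icc.2 ⟨by omega, le_rfl⟩), dif_neg (by simp)] at hst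
  exact hst

lemma measurable_comp (hT : IsAlphaGammaSequence μ α γ T) {k n : ℕ} (hk : 1 ≤ k) (hn : 1 ≤ n)
    {β : Type*} [MeasurableSpace β] (F : LTree → LTree → β) :
    Measurable fun ω => F (T k ω) (T n ω) := by
  intro V _
  have : (fun ω => F (T k ω) (T n ω)) ⁻¹' V =
      ⋃ s, ⋃ t, ⋃ (_ : F s t ∈ V), {ω | T k ω = s} ∩ {ω | T n ω = t} := by
    ext ω
    simp
  rw [this]
  exact MeasurableSet.iUnion fun s => MeasurableSet.iUnion fun t => MeasurableSet.iUnion fun _ =>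
    (hT.measurableSet_eq k hk s).inter (hT.measurableSet_eq n hn t)

variable [IsProbabilityMeasure μ]

/-- There are countably many histories and successors. If no move of nonzero weight leads to the
successor, the growth probability is zero and the event is null. -/
lemma ae_isGrowthPath (hT : IsAlphaGammaSequence μ α γ T) :
    ∀ᵐ ω ∂μ, IsGrowthPath α γ fun n => T n ω := by
  have h1 : ∀ᵐ ω ∂μ, ∀ n, 2 ≤ n → ∀ (h : Finset.Icc 1 n → LTree) (t' : LTree),
      μ.real (history T n ⁻¹' {h} ∩ {ω | T (n + 1) ω = t'}) = 0 →
        ω ∉ history T n ⁻¹' {h} ∩ {ω | T (n + 1) ω = t'} := by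
    refine ae_all_iff.2 fun n => ae_all_iff.2 fun hn => ae_all_iff.2 fun h =>
      ae_all_iff.2 fun t' => ae_all_iff.2 fun h0 => ?_
    exact measure_eq_zero_iff_ae_notMem.1 ((measureReal_eq_zero_iff).1 h0)
  filter_upwards [h1, hT.init] with ω hω hi
  refine ⟨hi.2, fun n hn => ?_⟩
  by_contra hcon
  push Not at hcon
  refine hω n hn (history T n ω) (T (n + 1) ω) ?_ ⟨rfl, rfl⟩
  rw [hT.measureReal_history_inter hn, growProb_eq]
  have : ∑ m ∈ moves (T n ω), (if grow (n + 1) (T n ω) m.1 m.2 = T (n + 1) ω then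
      moveWeight α γ (T n ω) m else 0) = 0 := by
    refine Finset.sum_eq_zero fun m hm => ?_
    by_contra h3
    rw [ite_eq_right_iff, Classical.not_imp] at h3
    exact hcon m hm h3.2 h3.1
  rw [history, this, zero_div, mul_zero]

lemma exists_isGrowthPath (hT : IsAlphaGammaSequence μ α γ T) {S : Set Ω} (hS : μ S ≠ 0) :
    ∃ ω ∈ S, IsGrowthPath α γ fun n => T n ω := by
  by_contra hcon
  push Not at hcon
  refine hS (measure_eq_zero_iff_ae_notMem.2 ?_)
  filter_upwards [hT.ae_isGrowthPath] with ω hω hωS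
  exact hcon ω hωS hω

/-- Almost surely the trees are families of subsets of a fixed finite set, so the function takes
finitely many values. -/
lemma integrable_comp (hT : IsAlphaGammaSequence μ α γ T) {k n : ℕ} (hk : 2 ≤ k) (hn : 2 ≤ n)
    (F : LTree → LTree → ℝ) : Integrable (fun ω => F (T k ω) (T n ω)) μ := by
  refine Integrable.of_bound (hT.measurable_comp (by omega) (by omega) F).aestronglyMeasurable
    (∑ s ∈ (Finset.Icc 1 k).powerset.powerset, ∑ t ∈ (Finset.Icc 1 n).powerset.powerset,
      |F s t|) ?_
  filter_upwards [hT.ae_isGrowthPath] with ω hω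
  have hmem : ∀ i, 2 ≤ i → T i ω ∈ (Finset.Icc 1 i).powerset.powerset := fun i hi => by
    rw [Finset.mem_powerset]
    exact fun A hA => Finset.mem_powerset.2 ((hω.isTree hi).subset A hA)
  calc ‖F (T k ω) (T n ω)‖ ≤ ∑ t ∈ (Finset.Icc 1 n).powerset.powerset, |F (T k ω) t| :=
        Finset.single_le_sum (f := fun t => |F (T k ω) t|) (fun t _ => abs_nonneg _) (hmem n hn)
    _ ≤ _ := Finset.single_le_sum
        (f := fun s => ∑ t ∈ (Finset.Icc 1 n).powerset.powerset, |F s t|)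
        (fun s _ => Finset.sum_nonneg fun t _ => abs_nonneg _) (hmem k hk)

/-- The integral after one step of growth. -/
lemma setIntegral_history (hT : IsAlphaGammaSequence μ α γ T) {n : ℕ} (hn : 2 ≤ n)
    (h : Finset.Icc 1 n → LTree) (F : LTree → ℝ) {t : LTree}
    (ht : h ⟨n, Finset.mem_Icc.2 ⟨by omega, le_rfl⟩⟩ = t) :
    ∫ ω in history T n ⁻¹' {h}, F (T (n + 1) ω) ∂μ = μ.real (history T n ⁻¹' {h}) *
      ((∑ m ∈ moves t, moveWeight α γ t m * F (grow (n + 1) t m.1 m.2)) / totalWeight α γ t) := by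
  set U := (moves t).image fun m => grow (n + 1) t m.1 m.2 with hU
  have hms := hT.measurableSet_history n {h}
  have e1 : ∀ᵐ ω ∂μ.restrict (history T n ⁻¹' {h}), F (T (n + 1) ω) =
      ∑ t' ∈ U, {ω | T (n + 1) ω = t'}.indicator (fun _ => F t') ω := by
    rw [ae_restrict_iff' hms]
    filter_upwards [hT.ae_isGrowthPath] with ω hω hωh
    obtain ⟨m, hm, -, hgrow⟩ := hω.step n hn
    have htω : T n ω = t := by rw [← ht, ← Set.mem_singleton_iff.1 hωh]; rfl
    simp only [htω] at hm hgrow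
    have hmem : T (n + 1) ω ∈ U := Finset.mem_image.2 ⟨m, hm, hgrow⟩
    rw [Finset.sum_eq_single_of_mem _ hmem]
    · simp
    · intro t' _ hne
      exact Set.indicator_of_notMem (by simpa using hne.symm) _
  have hm1 : ∀ t', MeasurableSet {ω | T (n + 1) ω = t'} := hT.measurableSet_eq (n + 1) (by omega)
  rw [integral_congr_ae e1, integral_finsetSum _ fun t' _ =>
    (integrable_const _).indicator (hm1 t'), ← sum_growProb_mul α γ (n + 1) t U
    (fun m hm => Finset.mem_image_of_mem _ hm), Finset.mul_sum]
  refine Finset.sum_congr rfl fun t' _ => ?_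
  rw [integral_indicator_const _ (hm1 t'), smul_eq_mul, measureReal_restrict_apply (hm1 t'),
    Set.inter_comm, hT.measureReal_history_inter hn, ht, mul_assoc]

/-- A function of `T k` and `T n` which is preserved by the generator is a martingale. -/
lemma martingale (hT : IsAlphaGammaSequence μ α γ T) {k : ℕ} (hk : 2 ≤ k)
    (F : ℕ → LTree → LTree → ℝ)
    (hF : ∀ n s t, k ≤ n → IsTree k s → IsTree n t → Restricts k s t →
      (∑ m ∈ moves t, moveWeight α γ t m * F (n + 1) s (grow (n + 1) t m.1 m.2)) =
        totalWeight α γ t * F n s t) (h0 : ∀ n t, k ≤ n → IsTree n t → totalWeight α γ t ≠ 0) :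
    Martingale (fun n ω => F (n + k) (T k ω) (T (n + k) ω)) (hT.filtration k) μ := by
  have hint : ∀ n, Integrable (fun ω => F (n + k) (T k ω) (T (n + k) ω)) μ := fun n =>
    hT.integrable_comp hk (by omega) _
  have hadp : ∀ n, StronglyMeasurable[hT.filtration k n]
      (fun ω => F (n + k) (T k ω) (T (n + k) ω)) := fun n => by
    refine Measurable.stronglyMeasurable fun V _ => ?_
    exact ⟨{h | F (n + k) (h ⟨k, Finset.mem_Icc.2 ⟨by omega, by omega⟩⟩)
      (h ⟨n + k, Finset.mem_Icc.2 ⟨by omega, le_rfl⟩⟩) ∈ V}, trivial, rfl⟩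
  refine martingale_nat hadp hint fun n => ?_
  refine ae_eq_condExp_of_forall_setIntegral_eq ((hT.filtration k).le n) (hint (n + 1))
    (fun _ _ _ => (hint n).integrableOn) ?_ (hadp n).aestronglyMeasurable
  rintro _ ⟨U, -, rfl⟩ -
  -- The conditional expectation is checked on the countably many atoms given by single histories.
  rw [← Set.biUnion_preimage_singleton, Set.biUnion_eq_iUnion]
  have hdis : Pairwise (Function.onFun Disjoint
      fun h : U => history T (n + k) ⁻¹' {(h : Finset.Icc 1 (n + k) → LTree)}) :=
    fun h h' hne => Disjoint.preimage _ (Set.disjoint_singleton.2 (Subtype.coe_ne_coe.2 hne))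
  rw [integral_iUnion (fun h => hT.measurableSet_history _ _) hdis (hint n).integrableOn,
    integral_iUnion (fun h => hT.measurableSet_history _ _) hdis (hint (n + 1)).integrableOn]
  refine tsum_congr fun h => ?_
  obtain ⟨h, -⟩ := h
  have hms := hT.measurableSet_history (n + k) {h}
  by_cases hμ : μ (history T (n + k) ⁻¹' {h}) = 0
  · rw [setIntegral_measure_zero _ hμ, setIntegral_measure_zero _ hμ]
  -- An atom of positive mass contains a growth path, so the history on it consists of genuine trees
  -- and the generator identity applies.
  obtain ⟨ω₀, hω₀, hpath⟩ := hT.exists_isGrowthPath hμ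
  have hh : ∀ ω ∈ history T (n + k) ⁻¹' {h}, T k ω = T k ω₀ ∧ T (n + k) ω = T (n + k) ω₀ :=
    fun ω hω => by
      have : history T (n + k) ω = history T (n + k) ω₀ := by
        rw [Set.mem_singleton_iff.1 hω, Set.mem_singleton_iff.1 hω₀]
      exact ⟨congrFun this ⟨k, Finset.mem_Icc.2 ⟨by omega, by omega⟩⟩,
        congrFun this ⟨n + k, Finset.mem_Icc.2 ⟨by omega, le_rfl⟩⟩⟩
  have htree := hpath.isTree (n := n + k) (by omega)
  have e1 : ∫ ω in history T (n + k) ⁻¹' {h}, F (n + k) (T k ω) (T (n + k) ω) ∂μ =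
      ∫ _ in history T (n + k) ⁻¹' {h}, F (n + k) (T k ω₀) (T (n + k) ω₀) ∂μ :=
    setIntegral_congr_fun hms fun ω hω => by
      rw [(hh ω hω).1, (hh ω hω).2]
  have e2 : ∫ ω in history T (n + k) ⁻¹' {h}, F (n + 1 + k) (T k ω) (T (n + 1 + k) ω) ∂μ =
      ∫ ω in history T (n + k) ⁻¹' {h}, F (n + k + 1) (T k ω₀) (T (n + k + 1) ω) ∂μ :=
    setIntegral_congr_fun hms fun ω hω => by
      rw [(hh ω hω).1, add_right_comm n 1 k]
  refine e1.trans (Eq.trans ?_ e2.symm)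
  rw [hT.setIntegral_history (by omega) h _ (t := T (n + k) ω₀)
      (by rw [← Set.mem_singleton_iff.1 hω₀]; rfl),
    hF (n + k) (T k ω₀) _ (by omega) (hpath.isTree hk) htree (hpath.restricts hk (by omega)),
    mul_div_cancel_left₀ _ (h0 _ _ (by omega) htree), setIntegral_const, smul_eq_mul]

end IsAlphaGammaSequence

end AlphaGamma

/-! ### Profile martingales and their limits -/

namespace AlphaGamma

/-- A nonnegative martingale is bounded in `L¹` by its constant mean. -/
lemma ae_exists_tendsto_of_nonneg_martingale {Ω : Type*} [mΩ : MeasurableSpace Ω] {μ : Measure Ω}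
    [IsFiniteMeasure μ] {ℱ : Filtration ℕ mΩ} {f : ℕ → Ω → ℝ} (hf : Martingale f ℱ μ)
    (hnn : ∀ n, 0 ≤ᵐ[μ] f n) : ∀ᵐ ω ∂μ, ∃ l, Tendsto (fun n => f n ω) atTop (𝓝 l) := by
  have h := hf.submartingale.ae_tendsto_limitProcess (R := (∫ ω, f 0 ω ∂μ).toNNReal) fun n => by
    have h1 : ∫ ω, f n ω ∂μ = ∫ ω, f 0 ω ∂μ := by
      have := hf.setIntegral_eq (Nat.zero_le n) MeasurableSet.univ
      simpa using this.symm
    rw [eLpNorm_one_eq_lintegral_enorm, ← h1, ← ENNReal.ofReal,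
      ofReal_integral_eq_lintegral_ofReal (hf.integrable n) (hnn n)]
    refine le_of_eq (lintegral_congr_ae ?_)
    filter_upwards [hnn n] with ω hω
    rw [← ofReal_norm, Real.norm_of_nonneg hω]
  filter_upwards [h] with ω hω
  exact ⟨_, hω⟩

section

variable {k n : ℕ} {s t : LTree} {α γ : ℝ}

lemma IsTree.vertexOver_self (ht : IsTree n t) {B : Finset ℕ} (hB : B ∈ t) :
    vertexOver t B = B := by
  have hv := ht.vertexOver_spec (ht.nonempty B hB) (ht.subset B hB)
  exact (hv.2.2 B hB subset_rfl).antisymm hv.2.1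

lemma overWeight_nonneg (hα0 : 0 < α) (hγα : γ ≤ α) (ht : IsTree n t) (hs : IsTree k s)
    (hkn : k ≤ n) {B : Finset ℕ} (hB : B ∈ branchPoints s) : 0 ≤ overWeight α γ t B := by
  have hv := mem_branchPoints.1 (vertexOver_mem_branchPoints ht hs hkn hB)
  have h2 : (2 : ℝ) ≤ (children t (vertexOver t B)).card := by
    exact_mod_cast ht.two_le_card_children hv.1 hv.2
  have h3 : γ / α ≤ 1 := (div_le_one hα0).2 hγα
  rw [overWeight]
  linarith

lemma spineWeight_nonneg (hα1 : α < 1) (hγ0 : 0 < γ) : 0 ≤ spineWeight α γ k n s t := by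
  have : 0 ≤ 1 - α := by linarith
  rw [spineWeight]
  positivity

lemma profile_nonneg (hα0 : 0 < α) (hα1 : α < 1) (hγ0 : 0 < γ) (hγα : γ ≤ α) (ht : IsTree n t)
    (hs : IsTree k s) (hkn : k ≤ n) (p : ℕ) (r : Finset ℕ → ℕ) :
    0 ≤ profile α γ k n s p r t :=
  mul_nonneg (rising_nonneg (spineWeight_nonneg hα1 hγ0) p)
    (Finset.prod_nonneg fun _ hB => rising_nonneg (overWeight_nonneg hα0 hγα ht hs hkn hB) _)

lemma profile_sq_le (hα0 : 0 < α) (hα1 : α < 1) (hγ0 : 0 < γ) (hγα : γ ≤ α) (ht : IsTree n t)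
    (hs : IsTree k s) (hkn : k ≤ n) (p : ℕ) (r : Finset ℕ → ℕ) :
    profile α γ k n s p r t ^ 2 ≤ profile α γ k n s (2 * p) (fun B => 2 * r B) t := by
  have h0 : ∀ B ∈ branchPoints s, 0 ≤ overWeight α γ t B := fun B hB =>
    overWeight_nonneg hα0 hγα ht hs hkn hB
  rw [profile, mul_pow, ← Finset.prod_pow, profile]
  refine mul_le_mul (rising_sq_le (spineWeight_nonneg hα1 hγ0) p)
    (Finset.prod_le_prod (fun B hB => sq_nonneg _) fun B hB => rising_sq_le (h0 B hB) _)
    (Finset.prod_nonneg fun B hB => sq_nonneg _) (rising_nonneg (spineWeight_nonneg hα1 hγ0) _)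

lemma profile_self (hs : IsTree k s) (p : ℕ) (r : Finset ℕ → ℕ) :
    profile α γ k k s p r s = rising (k * (1 - α) + (branchPoints s).card * γ) p *
      ∏ B ∈ branchPoints s, rising ((children s B).card - 1 - γ / α) (r B) := by
  rw [profile, spineWeight, edgeLeafCount, Finset.Ioc_self]
  simp only [Finset.filter_empty, Finset.card_empty, Nat.cast_zero, add_zero]
  congr 1
  refine Finset.prod_congr rfl fun B hB => ?_
  rw [overWeight, hs.vertexOver_self (mem_branchPoints.1 hB).1]

/-- The order of growth of a profile. -/
noncomputable def profileExponent (α : ℝ) (s : LTree) (p : ℕ) (r : Finset ℕ → ℕ) : ℝ :=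
  p + α * (∑ B ∈ branchPoints s, r B : ℕ)

lemma profileExponent_nonneg (hα0 : 0 < α) (p : ℕ) (r : Finset ℕ → ℕ) :
    0 ≤ profileExponent α s p r := by
  rw [profileExponent]
  positivity

/-- The normalisation which turns a profile into a martingale. -/
noncomputable def profileNorm (α x : ℝ) (n : ℕ) : ℝ :=
  Real.Gamma (n - α) / Real.Gamma (n - α + x)

lemma profileNorm_pos (hα1 : α < 1) {x : ℝ} (hx : 0 ≤ x) (hn : 1 ≤ n) : 0 < profileNorm α x n := by
  have h1 : (1 : ℝ) ≤ n := by exact_mod_cast hn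
  exact div_pos (Real.Gamma_pos_of_pos (by linarith)) (Real.Gamma_pos_of_pos (by linarith))

/-- The recursion that trades the eigenvalue `n - α + x` of the generator for the total weight `n -
α`. -/
lemma profileNorm_succ (hα1 : α < 1) {x : ℝ} (hx : 0 ≤ x) (hn : 1 ≤ n) :
    (n - α + x) * profileNorm α x (n + 1) = (n - α) * profileNorm α x n := by
  have h1 : (1 : ℝ) ≤ n := by exact_mod_cast hn
  have e1 : ((n + 1 : ℕ) : ℝ) - α = (n - α) + 1 := by push_cast; ring
  have e2 : (n - α : ℝ) + 1 + x = (n - α + x) + 1 := by ring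
  have hpos := Real.Gamma_pos_of_pos (show (0 : ℝ) < n - α + x by linarith)
  have hne : (n - α + x : ℝ) ≠ 0 := by linarith
  rw [profileNorm, profileNorm, e1, e2, Real.Gamma_add_one (by linarith), Real.Gamma_add_one hne]
  field_simp

lemma tendsto_inv_profileNorm (hα1 : α < 1) {x : ℝ} (hx : 0 ≤ x) :
    Tendsto (fun n : ℕ => (profileNorm α x n * (n : ℝ) ^ x)⁻¹) atTop (𝓝 1) := by
  refine (tendsto_Gamma_ratio (c := -α) (by linarith) hx).congr fun n => ?_
  rw [profileNorm, ← sub_eq_add_neg, div_mul_eq_mul_div, inv_div]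

end

namespace IsAlphaGammaSequence

variable {Ω : Type*} [mΩ : MeasurableSpace Ω] {μ : Measure Ω} {α γ : ℝ} {T : ℕ → Ω → LTree}
  [IsProbabilityMeasure μ]

lemma martingale_profile (hT : IsAlphaGammaSequence μ α γ T) (hα0 : 0 < α) (hα1 : α < 1) {k : ℕ}
    (hk : 2 ≤ k) (s : LTree) (p : ℕ) (r : Finset ℕ → ℕ) :
    Martingale (fun n ω => if T k ω = s then profile α γ k (n + k) s p r (T (n + k) ω) *
      profileNorm α (profileExponent α s p r) (n + k) else 0) (hT.filtration k) μ := by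
  refine hT.martingale hk (fun n u t => if u = s then profile α γ k n s p r t *
    profileNorm α (profileExponent α s p r) n else 0) (fun n u t hkn hu ht h => ?_)
    fun n t hkn ht => ?_
  · by_cases hus : u = s
    · subst hus
      simp only [if_true, ← mul_assoc, ← Finset.sum_mul]
      rw [sum_moveWeight_mul_profile hα0.ne' γ p r ht hu (by omega) hkn h, ht.totalWeight_eq]
      have h1 := profileNorm_succ hα1 (profileExponent_nonneg (s := u) hα0 p r)
        (show 1 ≤ n by omega)
      rw [profileExponent] at h1 ⊢
      rw [← add_assoc] at h1
      linear_combination profile α γ k n u p r t * h1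
    · simp [hus]
  · have h2 : (2 : ℝ) ≤ n := by exact_mod_cast hk.trans hkn
    rw [ht.totalWeight_eq]
    linarith

/-- The normalised profile is a nonnegative martingale, and `profileNorm α x n` is asymptotic to `n
^ (-x)`. -/
lemma ae_tendsto_profile (hT : IsAlphaGammaSequence μ α γ T) (hα0 : 0 < α) (hα1 : α < 1)
    (hγ0 : 0 < γ) (hγα : γ ≤ α) {k : ℕ} (hk : 2 ≤ k) (s : LTree) (p : ℕ) (r : Finset ℕ → ℕ) :
    ∀ᵐ ω ∂μ, T k ω = s → ∃ l, Tendsto (fun n : ℕ => profile α γ k n s p r (T n ω) /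
      (n : ℝ) ^ profileExponent α s p r) atTop (𝓝 l) := by
  have hx := profileExponent_nonneg (s := s) hα0 p r
  have h := ae_exists_tendsto_of_nonneg_martingale (hT.martingale_profile hα0 hα1 hk s p r)
    fun n => by
      filter_upwards [hT.ae_isGrowthPath] with ω hω
      change 0 ≤ ite _ _ _
      split_ifs with hs
      · exact mul_nonneg (profile_nonneg hα0 hα1 hγ0 hγα (hω.isTree (by omega))
          (hs ▸ hω.isTree hk) (by omega) p r) (profileNorm_pos hα1 hx (by omega)).le
      · exact le_rfl
  filter_upwards [h] with ω hω hs
  obtain ⟨l, hl⟩ := hω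
  simp only [hs, if_true] at hl
  rw [tendsto_add_atTop_iff_nat (f := fun n => profile α γ k n s p r (T n ω) *
    profileNorm α (profileExponent α s p r) n) k] at hl
  refine ⟨l, ?_⟩
  have h2 := hl.mul (tendsto_inv_profileNorm hα1 hx)
  rw [mul_one] at h2
  refine h2.congr' ?_
  filter_upwards [eventually_ge_atTop 1] with n hn
  have := (profileNorm_pos hα1 hx hn).ne'
  field_simp

/-- The mean of the martingale is constant; at time `k` the profile is a function of `s` alone. -/
lemma integral_profile (hT : IsAlphaGammaSequence μ α γ T) (hα0 : 0 < α) (hα1 : α < 1) {k : ℕ}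
    (hk : 2 ≤ k) {s : LTree} (hs : IsTree k s) (p : ℕ) (r : Finset ℕ → ℕ) (n : ℕ) :
    ∫ ω, (if T k ω = s then profile α γ k (n + k) s p r (T (n + k) ω) *
      profileNorm α (profileExponent α s p r) (n + k) else 0) ∂μ =
      μ.real {ω | T k ω = s} * (rising (k * (1 - α) + (branchPoints s).card * γ) p *
        (∏ B ∈ branchPoints s, rising ((children s B).card - 1 - γ / α) (r B)) *
        profileNorm α (profileExponent α s p r) k) := by
  have h1 := (hT.martingale_profile hα0 hα1 hk s p r).setIntegral_eq (Nat.zero_le n)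
    MeasurableSet.univ
  simp only [Measure.restrict_univ, zero_add] at h1
  have h2 : (fun ω => if T k ω = s then profile α γ k k s p r (T k ω) *
      profileNorm α (profileExponent α s p r) k else 0) = {ω | T k ω = s}.indicator
      fun _ => profile α γ k k s p r s * profileNorm α (profileExponent α s p r) k := by
    ext ω
    by_cases h : T k ω = s <;> simp [h]
  rw [← h1, h2, integral_indicator_const _ (hT.measurableSet_eq k (by omega) s), smul_eq_mul,
    profile_self hs]

/-- The joint moments of the limits. -/
lemma integral_limit (hT : IsAlphaGammaSequence μ α γ T) (hα0 : 0 < α) (hα1 : α < 1)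
    (hγ0 : 0 < γ) (hγα : γ ≤ α) {k : ℕ} (hk : 2 ≤ k) {s : LTree} (hs : IsTree k s)
    {W : Ω → ℝ} {C : Ω → Finset ℕ → ℝ}
    (hW : ∀ᵐ ω ∂μ, Tendsto (fun n : ℕ => (edgeLeafCount k n (T k ω) (T n ω) : ℝ) / (n : ℝ))
      atTop (𝓝 (W ω)))
    (hC : ∀ᵐ ω ∂μ, ∀ B ∈ branchPoints (T k ω), Tendsto
      (fun n : ℕ => (degree (T n ω) (vertexOver (T n ω) B) : ℝ) / (n : ℝ) ^ α)
        atTop (𝓝 (C ω B)))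
    (p : ℕ) (r : Finset ℕ → ℕ) :
    IntegrableOn (fun ω => W ω ^ p * ∏ B ∈ branchPoints s, C ω B ^ r B) {ω | T k ω = s} μ ∧
    ∫ ω in {ω | T k ω = s}, W ω ^ p * ∏ B ∈ branchPoints s, C ω B ^ r B ∂μ =
      μ.real {ω | T k ω = s} * (rising (k * (1 - α) + (branchPoints s).card * γ) p *
        (∏ B ∈ branchPoints s, rising ((children s B).card - 1 - γ / α) (r B)) *
        profileNorm α (profileExponent α s p r) k) := by
  have hS := hT.measurableSet_eq k (by omega) s
  set x := profileExponent α s p r with hx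
  have hx0 : 0 ≤ x := profileExponent_nonneg hα0 p r
  set X : ℕ → Ω → ℝ := fun n ω => if T k ω = s then
    profile α γ k (n + k) s p r (T (n + k) ω) / ((n + k : ℕ) : ℝ) ^ x else 0 with hX
  have hXm : ∀ n, Measurable (X n) := fun n => hT.measurable_comp (by omega) (by omega)
    fun u t => if u = s then profile α γ k (n + k) s p r t / ((n + k : ℕ) : ℝ) ^ x else 0
  have hnat : Tendsto (fun n : ℕ => (n : ℝ)) atTop atTop := tendsto_natCast_atTop_atTop
  have hnatα : Tendsto (fun n : ℕ => (n : ℝ) ^ α) atTop atTop :=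
    (tendsto_rpow_atTop hα0).comp hnat
  have hlim : ∀ᵐ ω ∂μ, Tendsto (fun n => X n ω) atTop (𝓝 ({ω | T k ω = s}.indicator
      (fun ω => W ω ^ p * ∏ B ∈ branchPoints s, C ω B ^ r B) ω)) := by
    filter_upwards [hW, hC] with ω hW hC
    by_cases h : T k ω = s
    · rw [Set.indicator_of_mem (by exact h)]
      simp only [hX, h, if_true]
      rw [h] at hW hC
      rw [tendsto_add_atTop_iff_nat (f := fun n : ℕ => profile α γ k n s p r (T n ω) /
        (n : ℝ) ^ x) k]
      have h1 : Tendsto (fun n : ℕ => spineWeight α γ k n s (T n ω) / (n : ℝ)) atTop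
          (𝓝 (W ω)) := by
        have := (tendsto_const_nhds (x := k * (1 - α) +
          (branchPoints s).card * γ)).div_atTop hnat |>.add hW
        rw [zero_add] at this
        exact this.congr fun n => by rw [spineWeight, ← add_div]
      have h2 : ∀ B ∈ branchPoints s, Tendsto (fun n : ℕ => overWeight α γ (T n ω) B /
          (n : ℝ) ^ α) atTop (𝓝 (C ω B)) := fun B hB => by
        -- The degree is the number of children plus one, and `overWeight` is that number minus `1 +
        -- γ / α`.
        have := (tendsto_const_nhds (x := -2 - γ / α)).div_atTop hnatα |>.add (hC B hB)
        rw [zero_add] at this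
        refine this.congr fun n => ?_
        rw [overWeight, degree, ← add_div]
        push_cast
        ring
      have h3 := (tendsto_rising_div_pow hnat h1 p).mul (tendsto_finsetProd (branchPoints s)
        fun B hB => tendsto_rising_div_pow hnatα (h2 B hB) (r B))
      refine h3.congr' ?_
      filter_upwards [eventually_ge_atTop 1] with n hn
      have hn0 : (0 : ℝ) < n := by exact_mod_cast hn
      rw [Finset.prod_div_distrib, div_mul_div_comm, profile, hx, profileExponent,
        Real.rpow_add hn0, Real.rpow_natCast, Real.rpow_mul hn0.le, Real.rpow_natCast,
        Finset.prod_pow_eq_pow_sum]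
    · rw [Set.indicator_of_notMem (by exact h)]
      simp only [hX, h, if_false]
      exact tendsto_const_nhds
  have hmean : ∀ (p : ℕ) (r : Finset ℕ → ℕ), ∀ n, ∫ ω, (if T k ω = s then
      profile α γ k (n + k) s p r (T (n + k) ω) /
        ((n + k : ℕ) : ℝ) ^ profileExponent α s p r else 0) ∂μ =
      μ.real {ω | T k ω = s} * (rising (k * (1 - α) + (branchPoints s).card * γ) p *
        (∏ B ∈ branchPoints s, rising ((children s B).card - 1 - γ / α) (r B)) *
        profileNorm α (profileExponent α s p r) k) *
        (profileNorm α (profileExponent α s p r) (n + k) *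
          ((n + k : ℕ) : ℝ) ^ profileExponent α s p r)⁻¹ := fun p r n => by
    rw [← hT.integral_profile hα0 hα1 hk hs p r n, ← integral_mul_const]
    refine integral_congr_ae (ae_of_all _ fun ω => ?_)
    have := (profileNorm_pos hα1 (profileExponent_nonneg (s := s) hα0 p r)
      (show 1 ≤ n + k by omega)).ne'
    dsimp only
    split_ifs
    · field_simp
    · simp
  have hconv : ∀ (p : ℕ) (r : Finset ℕ → ℕ), Tendsto (fun n => ∫ ω, (if T k ω = s then
      profile α γ k (n + k) s p r (T (n + k) ω) /
        ((n + k : ℕ) : ℝ) ^ profileExponent α s p r else 0) ∂μ) atTop (𝓝 (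
      μ.real {ω | T k ω = s} * (rising (k * (1 - α) + (branchPoints s).card * γ) p *
        (∏ B ∈ branchPoints s, rising ((children s B).card - 1 - γ / α) (r B)) *
        profileNorm α (profileExponent α s p r) k))) := fun p r => by
    simp_rw [hmean]
    have := (tendsto_inv_profileNorm hα1
      (profileExponent_nonneg (s := s) hα0 p r)).comp (tendsto_add_atTop_nat k)
    simpa using this.const_mul _
  -- The means for doubled exponents converge, hence are bounded, and they dominate the second
  -- moments of `X`.
  obtain ⟨K, hK⟩ := (hconv (2 * p) fun B => 2 * r B).bddAbove_range
  have hbd : ∀ n, ∫⁻ ω, ENNReal.ofReal (X n ω ^ 2) ∂μ ≤ ENNReal.ofReal K := fun n => by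
    have hx2 : profileExponent α s (2 * p) (fun B => 2 * r B) = x * 2 := by
      rw [hx, profileExponent, profileExponent, ← Finset.mul_sum]
      push_cast
      ring
    have hK' := hK ⟨n, rfl⟩
    refine le_trans ?_ (ENNReal.ofReal_le_ofReal hK')
    dsimp only
    rw [ofReal_integral_eq_lintegral_ofReal (hT.integrable_comp hk (by omega) fun u t =>
      if u = s then profile α γ k (n + k) s (2 * p) (fun B => 2 * r B) t /
        ((n + k : ℕ) : ℝ) ^ profileExponent α s (2 * p) (fun B => 2 * r B) else 0)]
    · refine lintegral_mono_ae ?_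
      filter_upwards [hT.ae_isGrowthPath] with ω hω
      refine ENNReal.ofReal_le_ofReal ?_
      simp only [hX]
      split_ifs
      · rw [div_pow, hx2, Real.rpow_mul (by positivity), Real.rpow_two]
        refine div_le_div_of_nonneg_right ?_ (by positivity)
        exact profile_sq_le hα0 hα1 hγ0 hγα (hω.isTree (by omega)) hs (by omega) p r
      · simp
    · filter_upwards [hT.ae_isGrowthPath] with ω hω
      change 0 ≤ ite _ _ _
      split_ifs
      · exact div_nonneg (profile_nonneg hα0 hα1 hγ0 hγα (hω.isTree (by omega)) hs (by omega) _ _)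
          (by positivity)
      · exact le_rfl
  have hfin := tendsto_integral_of_sq_bounded μ hXm hbd hlim
  rw [integrable_indicator_iff hS, integral_indicator hS] at hfin
  exact ⟨hfin.1, tendsto_nhds_unique hfin.2 (hconv p r)⟩

/-- The almost sure convergence of the numbers of leaves over the edges. -/
lemma exists_tendsto_edgeLeafCount (hT : IsAlphaGammaSequence μ α γ T) (hα0 : 0 < α)
    (hα1 : α < 1) (hγ0 : 0 < γ) (hγα : γ ≤ α) {k : ℕ} (hk : 2 ≤ k) :
    ∃ W : Ω → ℝ, Measurable W ∧ ∀ᵐ ω ∂μ,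
      Tendsto (fun n : ℕ => (edgeLeafCount k n (T k ω) (T n ω) : ℝ) / (n : ℝ))
        atTop (𝓝 (W ω)) := by
  have h1 : ∀ᵐ ω ∂μ, ∃ l, Tendsto
      (fun n : ℕ => (edgeLeafCount k n (T k ω) (T n ω) : ℝ) / (n : ℝ)) atTop (𝓝 l) := by
    filter_upwards [ae_all_iff.2 fun s =>
      hT.ae_tendsto_profile hα0 hα1 hγ0 hγα hk s 1 0] with ω hω
    obtain ⟨l, hl⟩ := hω _ rfl
    have := hl.sub ((tendsto_const_nhds (x := k * (1 - α) +
      (branchPoints (T k ω)).card * γ)).div_atTop tendsto_natCast_atTop_atTop)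
    refine ⟨_, this.congr fun n => ?_⟩
    simp [profile, profileExponent, spineWeight, add_div]
  -- The shift by `k` avoids `T 0`, of which no measurability is known.
  obtain ⟨W, hWm, hW⟩ := measurable_limit_of_tendsto_metrizable_ae (μ := μ) (L := atTop)
    (f := fun (n : ℕ) ω => (edgeLeafCount k (n + k) (T k ω) (T (n + k) ω) : ℝ) /
      ((n + k : ℕ) : ℝ))
    (fun n => (hT.measurable_comp (by omega) (by omega)
      fun u t => (edgeLeafCount k (n + k) u t : ℝ) / ((n + k : ℕ) : ℝ)).aemeasurable)
    (h1.mono fun ω ⟨l, hl⟩ => ⟨l, hl.comp (tendsto_add_atTop_nat k)⟩)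
  refine ⟨W, hWm, hW.mono fun ω hω => ?_⟩
  exact (tendsto_add_atTop_iff_nat (f := fun n : ℕ =>
    (edgeLeafCount k n (T k ω) (T n ω) : ℝ) / (n : ℝ)) k).1 hω

/-- The almost sure convergence of the degrees. -/
lemma exists_tendsto_degree (hT : IsAlphaGammaSequence μ α γ T) (hα0 : 0 < α)
    (hα1 : α < 1) (hγ0 : 0 < γ) (hγα : γ ≤ α) {k : ℕ} (hk : 2 ≤ k) :
    ∃ C : Ω → Finset ℕ → ℝ, (∀ B, Measurable fun ω => C ω B) ∧
      (∀ᵐ ω ∂μ, ∀ B ∈ branchPoints (T k ω), Tendsto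
        (fun n : ℕ => (degree (T n ω) (vertexOver (T n ω) B) : ℝ) / (n : ℝ) ^ α)
          atTop (𝓝 (C ω B))) := by
  have hnatα : Tendsto (fun n : ℕ => (n : ℝ) ^ α) atTop atTop :=
    (tendsto_rpow_atTop hα0).comp tendsto_natCast_atTop_atTop
  have h1 : ∀ B, ∃ C : Ω → ℝ, Measurable C ∧ ∀ᵐ ω ∂μ, B ∈ branchPoints (T k ω) → Tendsto
      (fun n : ℕ => (degree (T n ω) (vertexOver (T n ω) B) : ℝ) / (n : ℝ) ^ α)
        atTop (𝓝 (C ω)) := fun B => by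
    have h2 : ∀ᵐ ω ∂μ, B ∈ branchPoints (T k ω) → ∃ l, Tendsto
        (fun n : ℕ => (degree (T n ω) (vertexOver (T n ω) B) : ℝ) / (n : ℝ) ^ α)
          atTop (𝓝 l) := by
      filter_upwards [ae_all_iff.2 fun s =>
        hT.ae_tendsto_profile hα0 hα1 hγ0 hγα hk s 0 (Pi.single B 1)] with ω hω hB
      obtain ⟨l, hl⟩ := hω _ rfl
      have e1 : ∀ t, profile α γ k 0 (T k ω) 0 (Pi.single B 1) t = overWeight α γ t B := fun t => by
        rw [profile, Finset.prod_eq_single_of_mem B hB fun B' _ hne => by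
          rw [Pi.single_eq_of_ne hne, rising_zero]]
        simp
      have e2 : profileExponent α (T k ω) 0 (Pi.single B 1) = α := by
        rw [profileExponent, Finset.sum_eq_single_of_mem B hB fun B' _ hne =>
          Pi.single_eq_of_ne hne _]
        simp
      have := hl.add ((tendsto_const_nhds (x := 2 + γ / α)).div_atTop hnatα)
      refine ⟨_, this.congr fun n => ?_⟩
      have e3 : profile α γ k n (T k ω) 0 (Pi.single B 1) (T n ω) = overWeight α γ (T n ω) B := by
        rw [← e1, profile, profile, rising_zero, rising_zero]
      rw [e2, e3, ← add_div, overWeight, degree]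
      push_cast
      ring
    obtain ⟨C, hCm, hC⟩ := measurable_limit_of_tendsto_metrizable_ae (μ := μ) (L := atTop)
      (f := fun (n : ℕ) ω => if B ∈ branchPoints (T k ω) then
        (degree (T (n + k) ω) (vertexOver (T (n + k) ω) B) : ℝ) / ((n + k : ℕ) : ℝ) ^ α else 0)
      (fun n => (hT.measurable_comp (by omega) (by omega) fun u t => if B ∈ branchPoints u then
        (degree t (vertexOver t B) : ℝ) / ((n + k : ℕ) : ℝ) ^ α else 0).aemeasurable)
      (h2.mono fun ω hω => by
        by_cases hB : B ∈ branchPoints (T k ω)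
        · obtain ⟨l, hl⟩ := hω hB
          refine ⟨l, ?_⟩
          simp only [hB, if_true]
          exact hl.comp (tendsto_add_atTop_nat k)
        · exact ⟨0, by simp only [hB, if_false]; exact tendsto_const_nhds⟩)
    refine ⟨C, hCm, hC.mono fun ω hω hB => ?_⟩
    simp only [hB, if_true] at hω
    exact (tendsto_add_atTop_iff_nat (f := fun n : ℕ =>
      (degree (T n ω) (vertexOver (T n ω) B) : ℝ) / (n : ℝ) ^ α) k).1 hω
  choose C hCm hC using h1
  exact ⟨fun ω B => C B ω, hCm, ae_all_iff.2 hC⟩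

end IsAlphaGammaSequence

end AlphaGamma

/-! ### The conditional law given `T k`, and the degenerate case -/

namespace AlphaGamma

lemma prod_branchPoints {m : ℕ} {t : LTree} (v : Fin (m + 1) ≃ {B // B ∈ branchPoints t})
    (f : Finset ℕ → ℝ) : ∏ B ∈ branchPoints t, f B = ∏ i, f (v i) := by
  rw [← Finset.prod_coe_sort, ← v.prod_comp]

lemma sum_branchPoints {m : ℕ} {t : LTree} (v : Fin (m + 1) ≃ {B // B ∈ branchPoints t})
    {M : Type*} [AddCommMonoid M] (f : Finset ℕ → M) :
    ∑ B ∈ branchPoints t, f B = ∑ i, f (v i) := by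
  rw [← Finset.sum_coe_sort, ← v.sum_comp]

lemma card_branchPoints_eq {m : ℕ} {t : LTree} (v : Fin (m + 1) ≃ {B // B ∈ branchPoints t}) :
    (branchPoints t).card = m + 1 := by
  simpa using (Fintype.card_congr v).symm

namespace IsAlphaGammaSequence

variable {Ω : Type*} [mΩ : MeasurableSpace Ω] {μ : Measure Ω} {α γ : ℝ} {T : ℕ → Ω → LTree}

lemma measurable_sum_branchPoints (hT : IsAlphaGammaSequence μ α γ T) {k : ℕ} (hk : 1 ≤ k)
    {C : Ω → Finset ℕ → ℝ} (hC : ∀ B, Measurable fun ω => C ω B) :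
    Measurable fun ω => ∑ B ∈ branchPoints (T k ω), C ω B := by
  intro V hV
  have : (fun ω => ∑ B ∈ branchPoints (T k ω), C ω B) ⁻¹' V =
      ⋃ s, {ω | T k ω = s} ∩ (fun ω => ∑ B ∈ branchPoints s, C ω B) ⁻¹' V := by
    ext ω
    simp
  rw [this]
  exact MeasurableSet.iUnion fun s => (hT.measurableSet_eq k hk s).inter
    ((Finset.measurable_fun_sum _ fun B _ => hC B) hV)

variable {k : ℕ} {W : Ω → ℝ} {C : Ω → Finset ℕ → ℝ}

lemma ae_nonneg_of_tendsto
    (hW : ∀ᵐ ω ∂μ, Tendsto (fun n : ℕ => (edgeLeafCount k n (T k ω) (T n ω) : ℝ) / (n : ℝ))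
      atTop (𝓝 (W ω)))
    (hC : ∀ᵐ ω ∂μ, ∀ B ∈ branchPoints (T k ω), Tendsto
      (fun n : ℕ => (degree (T n ω) (vertexOver (T n ω) B) : ℝ) / (n : ℝ) ^ α)
        atTop (𝓝 (C ω B))) :
    ∀ᵐ ω ∂μ, 0 ≤ W ω ∧ W ω ≤ 1 ∧ ∀ B ∈ branchPoints (T k ω), 0 ≤ C ω B := by
  filter_upwards [hW, hC] with ω hW hC
  refine ⟨ge_of_tendsto' hW fun n => by positivity, le_of_tendsto' hW fun n => ?_,
    fun B hB => ge_of_tendsto' (hC B hB) fun n => by positivity⟩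
  refine div_le_one_of_le₀ ?_ (by positivity)
  have h := Finset.card_filter_le (Finset.Ioc k n)
    fun j => ∀ B ∈ branchPoints (T k ω), attachVertex k (T n ω) j ≠ vertexOver (T n ω) B
  rw [Nat.card_Ioc] at h
  exact_mod_cast h.trans (Nat.sub_le n k)

/-- There are countably many trees, and those of probability zero can be discarded. -/
lemma ae_forall_tree {P : LTree → Ω → Prop}
    (h : ∀ t, μ {ω | T k ω = t} ≠ 0 → ∀ᵐ ω ∂μ, T k ω = t → P t ω) : ∀ᵐ ω ∂μ, P (T k ω) ω := by
  have h1 : ∀ᵐ ω ∂μ, ∀ t, T k ω = t → P t ω := ae_all_iff.2 fun t => by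
    by_cases ht : μ {ω | T k ω = t} = 0
    · filter_upwards [measure_eq_zero_iff_ae_notMem.1 ht] with ω hω hωt
      exact absurd hωt hω
    · exact h t ht
  exact h1.mono fun ω hω => hω _ rfl

variable [IsProbabilityMeasure μ]

/-- The conditional law of the limits. -/
lemma map_cond_eq (hT : IsAlphaGammaSequence μ α γ T) (hα0 : 0 < α) (hα1 : α < 1)
    (hγ0 : 0 < γ) (hγα : γ < α) (hk : 2 ≤ k) {g : ℝ → ℝ} (hg : IsMittagLefflerDensity α g)
    (hWm : Measurable W) (hCm : ∀ B, Measurable fun ω => C ω B)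
    (hW : ∀ᵐ ω ∂μ, Tendsto (fun n : ℕ => (edgeLeafCount k n (T k ω) (T n ω) : ℝ) / (n : ℝ))
      atTop (𝓝 (W ω)))
    (hC : ∀ᵐ ω ∂μ, ∀ B ∈ branchPoints (T k ω), Tendsto
      (fun n : ℕ => (degree (T n ω) (vertexOver (T n ω) B) : ℝ) / (n : ℝ) ^ α)
        atTop (𝓝 (C ω B)))
    {t : LTree} (hμt : μ {ω | T k ω = t} ≠ 0) {m : ℕ}
    (v : Fin (m + 1) ≃ {B // B ∈ branchPoints t}) :
    (μ[|{ω | T k ω = t}]).map (fun ω => (W ω,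
        (∑ B ∈ branchPoints (T k ω), C ω B) / (1 - W ω) ^ α,
        fun i => C ω (v i) / ∑ B ∈ branchPoints (T k ω), C ω B)) =
      productLaw α (k * (1 - α) + (m + 1) * γ) ((k - 1) * α - (m + 1) * γ) g
        (fun i => ((children t (v i)).card : ℝ) - 1 - γ / α) ∧
      ∀ i, 0 < ((children t (v i)).card : ℝ) - 1 - γ / α := by
  set S := {ω | T k ω = t} with hS
  have hSm : MeasurableSet S := hT.measurableSet_eq k (by omega) t
  have := cond_isProbabilityMeasure hμt
  have ht : IsTree k t := by
    obtain ⟨ω, hω, hp⟩ := hT.exists_isGrowthPath hμt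
    exact (show T k ω = t from hω) ▸ hp.isTree hk
  have hcard := card_branchPoints_eq v
  have hb : ∀ i, 0 < ((children t (v i)).card : ℝ) - 1 - γ / α := fun i => by
    have hv := mem_branchPoints.1 (v i).2
    have h2 : (2 : ℝ) ≤ (children t (v i)).card := by
      exact_mod_cast ht.two_le_card_children hv.1 hv.2
    have : γ / α < 1 := (div_lt_one hα0).2 hγα
    linarith
  refine ⟨?_, hb⟩
  have hk2 : (2 : ℝ) ≤ k := by exact_mod_cast hk
  have ha : 0 < k * (1 - α) + (m + 1) * γ := by
    have : 0 < 1 - α := by linarith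
    positivity
  -- The sum of the vertex weights of `t`, computed in two ways; this is the compatibility required
  -- by `lintegral_productLaw`.
  have hθ : ((k : ℝ) - 1) * α - (m + 1) * γ =
      α * ∑ i, (((children t (v i)).card : ℝ) - 1 - γ / α) := by
    have h := ht.sum_vertexWeight α γ
    rw [hcard, sum_branchPoints v] at h
    push_cast at h
    rw [← h, Finset.mul_sum]
    refine Finset.sum_congr rfl fun i _ => ?_
    rw [vertexWeight]
    field_simp
  have hN : k * (1 - α) + (m + 1) * γ + ((k - 1) * α - (m + 1) * γ) = k - α := by ring
  have hSae : ∀ᵐ ω ∂(μ[|S]), ω ∈ S := ae_cond_mem hSm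
  have hac : μ[|S] ≪ μ := cond_absolutelyContinuous
  set Z : Ω → ℝ × (Fin (m + 1) → ℝ) := fun ω => (W ω, fun i => C ω (v i)) with hZ
  have hZm : Measurable Z := hWm.prodMk (measurable_pi_lambda _ fun i => hCm _)
  have : IsProbabilityMeasure ((μ[|S]).map Z) :=
    Measure.isProbabilityMeasure_map hZm.aemeasurable
  have hnn := hac.ae_le (ae_nonneg_of_tendsto hW hC)
  have key := map_eq_of_jointMoments hα0 ha hb hθ (by rw [hN]; linarith) hg ((μ[|S]).map Z)
    (by
      rw [ae_map_iff hZm.aemeasurable (by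
        simp only [Set.ofPred_and, Set.ofPred_forall]
        exact (measurableSet_le measurable_const measurable_fst).inter
          (MeasurableSet.iInter fun i => measurableSet_le measurable_const (by fun_prop)))]
      filter_upwards [hnn, hSae] with ω hω hωS
      refine ⟨hω.1, fun i => hω.2.2 _ ?_⟩
      rw [show T k ω = t from hωS]
      exact (v i).2)
    (fun p r => by
      rw [lintegral_map (by fun_prop) hZm, ProbabilityTheory.cond, lintegral_smul_measure]
      -- The exponents are carried over to branch points by the enumeration `v`; the value zero
      -- elsewhere is never used.
      set r' : Finset ℕ → ℕ := fun B => if h : B ∈ branchPoints t then r (v.symm ⟨B, h⟩) else 0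
        with hr'
      have hri : ∀ i, r' (v i) = r i := fun i => by simp [hr']
      have hlim := hT.integral_limit hα0 hα1 hγ0 hγα.le hk ht hW hC p r'
      simp only [prod_branchPoints v, hri, hcard] at hlim
      have h1 : ∫⁻ ω in S, ENNReal.ofReal ((Z ω).1 ^ p * ∏ i, (Z ω).2 i ^ r i) ∂μ =
          ENNReal.ofReal (∫ ω in S, W ω ^ p * ∏ i, C ω (v i) ^ r i ∂μ) := by
        refine (ofReal_integral_eq_lintegral_ofReal hlim.1 ?_).symm
        rw [EventuallyLE, ae_restrict_iff' hSm]
        filter_upwards [ae_nonneg_of_tendsto hW hC] with ω hω hωS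
        refine mul_nonneg (pow_nonneg hω.1 _) (Finset.prod_nonneg fun i _ => pow_nonneg ?_ _)
        refine hω.2.2 _ ?_
        rw [show T k ω = t from hωS]
        exact (v i).2
      -- The mass of `S` cancels against the conditioning, and the normalisation at time `k` is the
      -- Gamma quotient of `jointMoment` with `N = k - α`.
      rw [h1, hlim.2, ENNReal.ofReal_mul measureReal_nonneg, ofReal_measureReal, smul_eq_mul,
        ← mul_assoc, ENNReal.inv_mul_cancel hμt (measure_ne_top _ _), one_mul, jointMoment, hN,
        profileNorm, profileExponent, sum_branchPoints v, ← add_assoc]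
      simp only [hri]
      push_cast
      rfl)
  rw [← key, Measure.map_map (by fun_prop) hZm]
  refine Measure.map_congr ?_
  filter_upwards [hSae] with ω hωS
  simp only [Function.comp, hZ, show T k ω = t from hωS, sum_branchPoints v]

lemma ae_of_ae_cond {S : Set Ω} (hS : MeasurableSet S) {P : Ω → Prop}
    (h : ∀ᵐ ω ∂(μ[|S]), P ω) : ∀ᵐ ω ∂μ, ω ∈ S → P ω := by
  rw [ProbabilityTheory.cond, Measure.ae_ennreal_smul_measure_iff
    (ENNReal.inv_ne_zero.2 (measure_ne_top _ _)), ae_restrict_iff' hS] at h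
  exact h

/-- The limits do not degenerate if `γ < α`. -/
lemma ae_lt_one_and_sum_pos (hT : IsAlphaGammaSequence μ α γ T) (hα0 : 0 < α) (hα1 : α < 1)
    (hγ0 : 0 < γ) (hγα : γ < α) (hk : 2 ≤ k) {g : ℝ → ℝ} (hg : IsMittagLefflerDensity α g)
    (hWm : Measurable W) (hCm : ∀ B, Measurable fun ω => C ω B)
    (hW : ∀ᵐ ω ∂μ, Tendsto (fun n : ℕ => (edgeLeafCount k n (T k ω) (T n ω) : ℝ) / (n : ℝ))
      atTop (𝓝 (W ω)))
    (hC : ∀ᵐ ω ∂μ, ∀ B ∈ branchPoints (T k ω), Tendsto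
      (fun n : ℕ => (degree (T n ω) (vertexOver (T n ω) B) : ℝ) / (n : ℝ) ^ α)
        atTop (𝓝 (C ω B))) :
    ∀ᵐ ω ∂μ, W ω < 1 ∧ 0 < ∑ B ∈ branchPoints (T k ω), C ω B := by
  refine ae_forall_tree (T := T) (k := k)
    (P := fun t ω => W ω < 1 ∧ 0 < ∑ B ∈ branchPoints t, C ω B) fun t hμt => ?_
  obtain ⟨ω₀, hω₀, hp⟩ := hT.exists_isGrowthPath hμt
  have ht : IsTree k t := (show T k ω₀ = t from hω₀) ▸ hp.isTree hk
  have hpos : 0 < (branchPoints t).card := Finset.card_pos.2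
    ⟨_, mem_branchPoints.2 ⟨ht.top_mem, by simpa using hk⟩⟩
  obtain ⟨m, hm⟩ := Nat.exists_eq_add_of_lt hpos
  rw [zero_add] at hm
  have v : Fin (m + 1) ≃ {B // B ∈ branchPoints t} :=
    Fintype.equivOfCardEq (by rw [Fintype.card_fin, Fintype.card_coe, hm])
  obtain ⟨hlaw, hb⟩ := hT.map_cond_eq hα0 hα1 hγ0 hγα hk hg hWm hCm hW hC hμt v
  have hSm := hT.measurableSet_eq k (by omega) t
  have hsum := hT.measurable_sum_branchPoints (k := k) (by omega) hCm
  have hθ : 0 < ((k : ℝ) - 1) * α - (m + 1) * γ := by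
    have h := ht.sum_vertexWeight α γ
    rw [hm, sum_branchPoints v] at h
    push_cast at h
    rw [← h]
    refine Finset.sum_pos (fun i _ => ?_) Finset.univ_nonempty
    have := mul_pos hα0 (hb i)
    rw [vertexWeight]
    have e : γ / α * α = γ := div_mul_cancel₀ _ hα0.ne'
    nlinarith
  have ha : 0 < k * (1 - α) + (m + 1) * γ := by
    have : 0 < 1 - α := by linarith
    positivity
  have hae := ae_productLaw hα0 ha hb hθ hg
  rw [← hlaw] at hae
  -- Under the product law `W < 1` and `M > 0`; as `M` is the sum of the limits divided by a
  -- positive number, the sum is positive.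
  have h2 := ae_of_ae_cond hSm (ae_of_ae_map (Measurable.aemeasurable (by
    exact hWm.prodMk ((hsum.div ((measurable_const.sub hWm).pow_const α)).prodMk
      (measurable_pi_lambda _ fun i => (hCm _).div hsum)))) hae)
  filter_upwards [h2] with ω hω hωt
  obtain ⟨h3, h4, -⟩ := hω hωt
  refine ⟨h3.2, ?_⟩
  have h5 : 0 < (1 - W ω) ^ α := Real.rpow_pos_of_pos (by linarith [h3.2]) α
  have h6 := (div_pos_iff_of_pos_right h5).1 h4
  rwa [hωt] at h6

/-- The limits are degenerate if `γ = α`. -/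
lemma ae_eq_one_and_eq_zero (hT : IsAlphaGammaSequence μ α α T) (hα0 : 0 < α) (hα1 : α < 1)
    (hk : 2 ≤ k)
    (hW : ∀ᵐ ω ∂μ, Tendsto (fun n : ℕ => (edgeLeafCount k n (T k ω) (T n ω) : ℝ) / (n : ℝ))
      atTop (𝓝 (W ω)))
    (hC : ∀ᵐ ω ∂μ, ∀ B ∈ branchPoints (T k ω), Tendsto
      (fun n : ℕ => (degree (T n ω) (vertexOver (T n ω) B) : ℝ) / (n : ℝ) ^ α)
        atTop (𝓝 (C ω B))) :
    ∀ᵐ ω ∂μ, W ω = 1 ∧ ∀ B ∈ branchPoints (T k ω), C ω B = 0 := by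
  refine ae_forall_tree (T := T) (k := k)
    (P := fun t ω => W ω = 1 ∧ ∀ B ∈ branchPoints t, C ω B = 0) fun t hμt => ?_
  obtain ⟨ω₀, hω₀, hp⟩ := hT.exists_isGrowthPath hμt
  have ht : IsTree k t := (show T k ω₀ = t from hω₀) ▸ hp.isTree hk
  have hcard : (branchPoints t).card + 1 = k :=
    (show T k ω₀ = t from hω₀) ▸ hp.card_branchPoints hα0 hk
  have hcard' : ((branchPoints t).card : ℝ) = k - 1 := by
    rw [← hcard]; push_cast; ring
  have hSm := hT.measurableSet_eq k (by omega) t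
  have hk2 : (2 : ℝ) ≤ k := by exact_mod_cast hk
  have hnn := ae_nonneg_of_tendsto hW hC
  -- For binary `t` the initial spine weight is the total weight `k - α`, so `W` has conditional
  -- mean one; since `W ≤ 1`, it equals one.
  have hnorm : (k * (1 - α) + (branchPoints t).card * α) * profileNorm α 1 k = 1 := by
    have e : k * (1 - α) + ((k : ℝ) - 1) * α = k - α := by ring
    have hpos := Real.Gamma_pos_of_pos (show (0 : ℝ) < k - α by linarith)
    have hne : (k : ℝ) - α ≠ 0 := by linarith
    rw [hcard', e, profileNorm, Real.Gamma_add_one hne]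
    field_simp
  have hW1 : ∀ᵐ ω ∂μ.restrict {ω | T k ω = t}, 1 - W ω = 0 := by
    obtain ⟨h1, h2⟩ := hT.integral_limit hα0 hα1 hα0 le_rfl hk ht hW hC 1 0
    simp only [pow_one, Pi.zero_apply, pow_zero, Finset.prod_const_one, mul_one, rising_one,
      rising_zero, profileExponent, Nat.cast_one, Finset.sum_const_zero, Nat.cast_zero, mul_zero,
      add_zero, hnorm] at h1 h2
    have h3 : ∫ ω in {ω | T k ω = t}, (1 - W ω) ∂μ = 0 := by
      rw [integral_sub (integrable_const _) h1, h2]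
      simp
    refine (integral_eq_zero_iff_of_nonneg_ae ?_ ((integrable_const _).sub h1)).1 h3
    filter_upwards [ae_restrict_of_ae hnn] with ω hω
    exact sub_nonneg.2 hω.2.1
  have hC0 : ∀ B ∈ branchPoints t, ∀ᵐ ω ∂μ.restrict {ω | T k ω = t}, C ω B = 0 := fun B hB => by
    obtain ⟨h1, h2⟩ := hT.integral_limit hα0 hα1 hα0 le_rfl hk ht hW hC 0 (Pi.single B 1)
    have e : ∀ ω, ∏ B' ∈ branchPoints t, C ω B' ^ (Pi.single B 1 : Finset ℕ → ℕ) B' = C ω B :=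
      fun ω => by
        rw [Finset.prod_eq_single_of_mem B hB fun B' _ hne => by
          rw [Pi.single_eq_of_ne hne, pow_zero], Pi.single_eq_same, pow_one]
    have hnnv : ∀ A ∈ branchPoints t, 0 ≤ vertexWeight α α t A := fun A hA => by
      rw [mem_branchPoints] at hA
      have h2 : (2 : ℝ) ≤ (children t A).card := by
        exact_mod_cast ht.two_le_card_children hA.1 hA.2
      rw [vertexWeight]
      nlinarith
    have h0 : vertexWeight α α t B = 0 := by
      refine (Finset.sum_eq_zero_iff_of_nonneg hnnv).1 ?_ B hB
      rw [ht.sum_vertexWeight, hcard']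
      ring
    -- The initial over-weight vanishes, hence so does the first moment of the nonnegative limit
    -- `C`.
    have hb0 : ((children t B).card : ℝ) - 1 - α / α = 0 := by
      rw [vertexWeight] at h0
      rw [div_self hα0.ne']
      have : (((children t B).card : ℝ) - 1 - 1) * α = 0 := by linarith
      exact (mul_eq_zero.1 this).resolve_right hα0.ne'
    have hprod : ∏ B' ∈ branchPoints t, rising (((children t B').card : ℝ) - 1 - α / α)
        ((Pi.single B 1 : Finset ℕ → ℕ) B') = 0 :=
      Finset.prod_eq_zero hB (by rw [Pi.single_eq_same, rising_one, hb0])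
    simp only [e, pow_zero, one_mul, hprod, mul_zero, zero_mul] at h1 h2
    refine (integral_eq_zero_iff_of_nonneg_ae ?_ h1).1 h2
    rw [EventuallyLE, ae_restrict_iff' hSm]
    filter_upwards [hnn] with ω hω hωt
    exact hω.2.2 B (by rwa [show T k ω = t from hωt])
  rw [ae_restrict_iff' hSm] at hW1
  have hC0' : ∀ᵐ ω ∂μ, ∀ B ∈ branchPoints t, T k ω = t → C ω B = 0 :=
    (ae_ball_iff (Finset.countable_toSet _)).2 fun B hB => by
      have := hC0 B hB
      rwa [ae_restrict_iff' hSm] at this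
  filter_upwards [hW1, hC0'] with ω h1 h2 hωt
  exact ⟨by linarith [h1 hωt], fun B hB => h2 B hB hωt⟩

end IsAlphaGammaSequence

end AlphaGamma

/-! ### The main theorem -/

theorem mainTheorem10 {Ω : Type*} [MeasurableSpace Ω] (μ : Measure Ω) [IsProbabilityMeasure μ]
    (α γ : ℝ) (hα0 : 0 < α) (hα1 : α < 1) (hγ0 : 0 < γ) (hγα : γ ≤ α)
    (T : ℕ → Ω → AlphaGamma.LTree) (hT : AlphaGamma.IsAlphaGammaSequence μ α γ T)
    (k : ℕ) (hk : 2 ≤ k) :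
    ∃ g : ℝ → ℝ, AlphaGamma.IsMittagLefflerDensity α g ∧
    ∃ (W M : Ω → ℝ) (D : Ω → Finset ℕ → ℝ),
      Measurable W ∧ Measurable M ∧ (∀ B, Measurable fun ω => D ω B) ∧
      (∀ᵐ ω ∂μ, Tendsto
        (fun n : ℕ => (AlphaGamma.edgeLeafCount k n (T k ω) (T n ω) : ℝ) / (n : ℝ))
        atTop (𝓝 (W ω))) ∧
      (∀ᵐ ω ∂μ, ∀ B ∈ AlphaGamma.branchPoints (T k ω), Tendsto
        (fun n : ℕ =>
          (AlphaGamma.degree (T n ω) (AlphaGamma.vertexOver (T n ω) B) : ℝ) / (n : ℝ) ^ α)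
        atTop (𝓝 ((1 - W ω) ^ α * M ω * D ω B))) ∧
      (γ = α → ∀ᵐ ω ∂μ, W ω = 1) ∧
      (γ < α → ∀ t : AlphaGamma.LTree, μ {ω | T k ω = t} ≠ 0 →
        ∀ (m : ℕ) (v : Fin (m + 1) ≃ {B // B ∈ AlphaGamma.branchPoints t}),
          (ProbabilityTheory.cond μ {ω | T k ω = t}).map
              (fun ω => (W ω, M ω, fun i => D ω (v i))) =
            (betaMeasure ((k : ℝ) * (1 - α) + ((m : ℝ) + 1) * γ)
                (((k : ℝ) - 1) * α - ((m : ℝ) + 1) * γ)).prod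
              ((AlphaGamma.tiltedMeasure α (((k : ℝ) - 1) * α - ((m : ℝ) + 1) * γ) g).prod
                (AlphaGamma.dirichletMeasure fun i =>
                  ((AlphaGamma.children t (v i)).card : ℝ) - 1 - γ / α))) := by
  obtain ⟨g, hg⟩ := AlphaGamma.exists_isMittagLefflerDensity hα0 hα1
  obtain ⟨W, hWm, hW⟩ := hT.exists_tendsto_edgeLeafCount hα0 hα1 hγ0 hγα hk
  obtain ⟨C, hCm, hC⟩ := hT.exists_tendsto_degree hα0 hα1 hγ0 hγα hk
  have hsum := hT.measurable_sum_branchPoints (k := k) (by omega) hCm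
  -- `M` and `D` solve `C = (1 - W) ^ α * M * D` with the entries of `D` summing to one.
  refine ⟨g, hg, W, fun ω => (∑ B ∈ AlphaGamma.branchPoints (T k ω), C ω B) / (1 - W ω) ^ α,
    fun ω B => C ω B / ∑ B ∈ AlphaGamma.branchPoints (T k ω), C ω B, hWm,
    hsum.div ((measurable_const.sub hWm).pow_const α), fun B => (hCm B).div hsum, hW, ?_, ?_,
    fun hlt t hμt m v => (hT.map_cond_eq hα0 hα1 hγ0 hlt hk hg hWm hCm hW hC hμt v).1⟩
  · rcases hγα.lt_or_eq with hlt | rfl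
    · filter_upwards [hC, hT.ae_lt_one_and_sum_pos hα0 hα1 hγ0 hlt hk hg hWm hCm hW hC]
        with ω hω ⟨h1, h2⟩ B hB
      have h3 : (1 - W ω) ^ α ≠ 0 := (Real.rpow_pos_of_pos (by linarith) α).ne'
      rw [mul_div_cancel₀ _ h3, mul_div_cancel₀ _ h2.ne']
      exact hω B hB
    -- Here the limits `C` vanish, so `D` takes the value zero by the convention for division, and
    -- the product is the correct limit zero.
    · filter_upwards [hC, hT.ae_eq_one_and_eq_zero hα0 hα1 hk hW hC] with ω hω ⟨h1, h2⟩ B hB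
      have h3 := hω B hB
      rw [h2 B hB] at h3
      simpa [h2 B hB] using h3
  · rintro rfl
    exact (hT.ae_eq_one_and_eq_zero hα0 hα1 hk hW hC).mono fun ω hω => hω.1
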